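/- Let $0\le\alpha<\theta<\tfrac12$, and let $W\colon(0,\infty)^2\to[0,\infty)$ be symmetric and homogeneous of degree zero with $0\le W(x,y)\le (x/y)^\alpha+(y/x)^\alpha$ for all $x,y>0$. Assume moreover that there are $C_0>0$ and $\gamma>0$ such that the following hold. (i) $W(\cdot,1)$ has an analytic extension to $\mathbb C\setminus(-\infty,0]$, again written $W(\xi,1)$, with $\operatorname{Re}W(\xi,1)\ge0$ for $\operatorname{Re}\xi\ge0$, $\xi\neq0$, and $|W(\xi,1)|\le C_0(|\xi|^{-\alpha}+|\xi|^{\alpha})$. (ii) The restrictions $W_+$ and $W_-$ of $W(\cdot,1)$ to $\{\operatorname{Im}\xi>0\}$ and $\{\operatorname{Im}\xi<0\}$ extend to differentiable functions on $\{\operatorname{Im}\xi\ge0\}\setminus\{0\}$ and $\{\operatorname{Im}\xi\le0\}\setminus\{0\}$, respectively, with $|W_\pm(z)|\le C_0(|z|^{-\alpha}+|z|^{\alpha})$ and $|W_\pm'(z)|\le C_0(|z|^{-\alpha-1}+|z|^{\alpha-1})$. Moreover, if $|z_1-z_2|\le\tfrac12 r$ with $r=\min\{|z_1|,|z_2|\}$,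 then $|W_\pm'(z_1)-W_\pm'(z_2)|\le C_0\,\rho(r)\,|z_1-z_2|^\gamma$, where $\rho(r)=r^{-\alpha-1-\gamma}$ for $r\le1$ and $\rho(r)=r^{\alpha-1-\gamma}$ for $r>1$. (iii) If $\alpha>0$, there is a constant $C_W>0$ such that $\xi^\alpha W(\xi,1)\to C_W$ as $\xi\to0$ in $\mathbb C\setminus(-\infty,0]$ (principal power). For $\varepsilon>0$ put $K_\varepsilon=2+\varepsilon W$. A *rescaled solution* for $K_\varepsilon$ is a non-negative $\mu\in L^1_{\mathrm{loc}}([0,\infty))$ with $\int_0^\infty x e^{-x}\mu(x)\,dx<\infty$ which satisfies, for almost every $x>0$, $$x^2\mu(x)=\int_0^x\int_{x-y}^\infty y\,K_\varepsilon(y,z)\,\mu(y)\,\mu(z)\,e^{x-(y+z)}\,dz\,dy,$$ and which is normalised so that $f(x)=e^{-x}\mu(x)$ satisfies $\frac{\log f(x)}{x}\to-1$ as $x\to\infty$ (along almost all $x$). For a function $\omega$ on $(0,\infty)$ such that $\int_0^\infty|\omega(x)|e^{-px}\,dx<\infty$ for all $p>0$, let $\Omega(p)=\int_0^\infty\omega(x)e^{-px}\,dx$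 and $$\|\omega\|_2=\sum_{\ell=0}^2\ \sup_{p>0}\ \frac{p^{1+\ell}}{(1+p)^{1-\theta}}\,\bigl|\partial_p^\ell\Omega(p)\bigr|\in[0,\infty].$$ Then the following hold. 1. There exist $C>0$ and $\varepsilon_0>0$ such that for all $\varepsilon\in(0,\varepsilon_0)$ and every rescaled solution $\mu$ for $K_\varepsilon$, the Laplace transform of $\mu$ exists in the above sense for all $p>0$ and $\|\mu\|_2<C$. 2. For every $\delta>0$ there exists $\varepsilon_0>0$ such that for all $\varepsilon\in(0,\varepsilon_0)$ and every rescaled solution $\mu$ for $K_\varepsilon$, the Laplace transform of $m=\mu-1$ exists in the above sense for all $p>0$ and $\|m\|_2\le\delta$. -/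

import Mathlib

open MeasureTheory Set Filter Topology
open scoped ENNReal

namespace Smoluchowski

noncomputable section

/-- `G` is continuously differentiable (in the complex sense, up to the boundary) on the set `S`,
which is one of the two closed half planes without the origin; `G` and `G'` satisfy the growth
conditions with exponent `α`, and `G'` satisfies the uniform local Hölder condition with
exponent `γ`. -/
structure HasHolderExtensionBounds (α C γ : ℝ) (S : Set ℂ) (G : ℂ → ℂ) : Prop where
  differentiable : DifferentiableOn ℂ G S
  growth : ∀ z ∈ S, ‖G z‖ ≤ C * (‖z‖ ^ (-α) + ‖z‖ ^ α)
  growth_deriv : ∀ z ∈ S, ‖derivWithin G S z‖ ≤ C * (‖z‖ ^ (-α - 1) + ‖z‖ ^ (α - 1))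
  holder : ∀ z₁ ∈ S, ∀ z₂ ∈ S, ‖z₁ - z₂‖ ≤ (1 / 2) * min ‖z₁‖ ‖z₂‖ →
    ‖derivWithin G S z₁ - derivWithin G S z₂‖ ≤
      C * (if min ‖z₁‖ ‖z₂‖ ≤ 1 then (min ‖z₁‖ ‖z₂‖) ^ (-α - 1 - γ)
            else (min ‖z₁‖ ‖z₂‖) ^ (α - 1 - γ)) * ‖z₁ - z₂‖ ^ γ

/-- The closed upper half plane without the origin. -/
def upperSet : Set ℂ := {z | 0 ≤ z.im ∧ z ≠ 0}

/-- The closed lower half plane without the origin. -/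
def lowerSet : Set ℂ := {z | z.im ≤ 0 ∧ z ≠ 0}

/-- The standing assumptions on the perturbation `W : (0,∞)² → [0,∞)` with exponent `α`
(values of `W` at non-positive arguments are irrelevant). `Complex.slitPlane` is
`ℂ ∖ (-∞, 0]`. -/
structure IsAdmissiblePerturbation (α : ℝ) (W : ℝ → ℝ → ℝ) : Prop where
  symm : ∀ x y, 0 < x → 0 < y → W x y = W y x
  homogeneous : ∀ c x y, 0 < c → 0 < x → 0 < y → W (c * x) (c * y) = W x y
  nonneg : ∀ x y, 0 < x → 0 < y → 0 ≤ W x y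
  le : ∀ x y, 0 < x → 0 < y → W x y ≤ (x / y) ^ α + (y / x) ^ α
  /-- `F` is the analytic extension of `W(·,1)`, and `Wp`, `Wm` are the extensions of its
  restrictions to the open upper and lower half planes, up to the punctured real line. -/
  analytic : ∃ (F Wp Wm : ℂ → ℂ) (C γ : ℝ), 0 < γ ∧
    DifferentiableOn ℂ F Complex.slitPlane ∧
    (∀ x : ℝ, 0 < x → F (x : ℂ) = ((W x 1 : ℝ) : ℂ)) ∧
    (∀ z ∈ Complex.slitPlane, 0 ≤ z.re → 0 ≤ (F z).re) ∧
    (∀ z ∈ Complex.slitPlane, ‖F z‖ ≤ C * (‖z‖ ^ (-α) + ‖z‖ ^ α)) ∧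
    (∀ z : ℂ, 0 < z.im → Wp z = F z) ∧
    (∀ z : ℂ, z.im < 0 → Wm z = F z) ∧
    HasHolderExtensionBounds α C γ upperSet Wp ∧
    HasHolderExtensionBounds α C γ lowerSet Wm ∧
    -- if `α > 0`: `F z ∼ C_W z ^ (-α)` as `z → 0` in the slit plane, with the principal power
    (0 < α → ∃ CW : ℝ, 0 < CW ∧
      Tendsto (fun z : ℂ => z ^ (α : ℂ) * F z) (𝓝[Complex.slitPlane] 0) (𝓝 (CW : ℂ)))

/-- The coagulation kernel `K = 2 + ε W`. -/
def kernel (ε : ℝ) (W : ℝ → ℝ → ℝ) (x y : ℝ) : ℝ := 2 + ε * W x y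

/-- `μ` solves, for the kernel `K`,
`x² μ(x) = ∫_0^x ∫_{x-y}^∞ y K(y,z) μ(y) μ(z) e^{x-(y+z)} dz dy` for almost every `x > 0`,
where `f(x) = e^{-x} μ(x)` is a self-similar profile (non-negative, locally integrable on `[0,∞)`,
with finite first moment) rescaled so that `log f(x) / x → -1` as `x → ∞`.
As `μ` is an almost-everywhere class, the limit is taken along almost all `x`. The integrand of
the equation is non-negative, so the integral is taken with values in `[0,∞]`. -/
structure IsRescaledSolution (K : ℝ → ℝ → ℝ) (μ : ℝ → ℝ) : Prop where
  locallyIntegrable : LocallyIntegrableOn μ (Ici 0)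
  nonneg : ∀ᵐ x ∂(volume.restrict (Ioi (0 : ℝ))), 0 ≤ μ x
  moment : IntegrableOn (fun x => x * (Real.exp (-x) * μ x)) (Ioi 0)
  equation : ∀ᵐ x ∂(volume.restrict (Ioi (0 : ℝ))),
    ENNReal.ofReal (x ^ 2 * μ x) =
      ∫⁻ y in Ioo 0 x, ∫⁻ z in Ioi (x - y),
        ENNReal.ofReal (y * K y z * μ y * μ z * Real.exp (x - (y + z)))
  normalized : Tendsto (fun x => Real.log (Real.exp (-x) * μ x) / x)
    (atTop ⊓ ae (volume : Measure ℝ)) (𝓝 (-1))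

/-- The (signed) measure `ω(x) dx` on `(0,∞)` has a Laplace transform: its positive and its
negative part have finite Laplace transforms at every `p > 0`. -/
def HasLaplace (ω : ℝ → ℝ) : Prop :=
  ∀ p : ℝ, 0 < p → IntegrableOn (fun x => ω x * Real.exp (-(p * x))) (Ioi 0)

/-- The Laplace transform `Ω(p) = ∫_0^∞ ω(x) e^{-px} dx`. -/
def laplace (ω : ℝ → ℝ) (p : ℝ) : ℝ :=
  ∫ x in Ioi (0 : ℝ), ω x * Real.exp (-(p * x))

/-- The seminorm `sup_{p>0} p^{1+k} (1+p)^{χ-1} |∂_p^k Ω(p)|`, with values in `[0,∞]`. -/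
def snorm (k : ℕ) (χ : ℝ) (ω : ℝ → ℝ) : ℝ≥0∞ :=
  ⨆ (p : ℝ) (_ : 0 < p),
    ENNReal.ofReal (p ^ (1 + k) / (1 + p) ^ (1 - χ) * |iteratedDeriv k (laplace ω) p|)

/-- The norm `‖ω‖_{k,χ}`, the sum of the seminorms of orders `0, …, k`, with values in `[0,∞]`. -/
def fnorm (k : ℕ) (χ : ℝ) (ω : ℝ → ℝ) : ℝ≥0∞ :=
  ∑ l ∈ Finset.range (k + 1), snorm l χ ω

end

end Smoluchowski

/-! Let U be the Laplace transform of the solution and D = -U'. Testing the equation with the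
derivative of (e^{-(p-1)x} - 1)/x and symmetrising in the two cluster sizes gives
(`laplace_equation`) U(1) - U(p) - (p-1) D(p) = (U(1) - U(p))² + ε R(p), where R(p) ≥ 0 is half the
quadratic form of W on the increment u |e^{-px} - e^{-x}|. This Riccati equation is linearised by
Z(p) = (p-1)/(U(1) - U(p)), for which Z' = 1 + ε R/(U(1) - U(p))². If ε = 0, then Z - p is constant;
the blow-up U(0+) = ∞ forces Z(0+) = 0, so Z = p, and U(∞) = 0 then gives U = 1/p, the transform of
the constant 1. The theorem is a quantitative perturbation of this computation.

Two ingredients carry it. The blow-up at 0 (`exists_lt_laplace`) is where the normalisation enters: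
if U stayed bounded near 0, the equation itself would yield an exponential moment of u,
contradicting the subexponential lower bound. The remainder is controlled through W ≤ √(x/y) +
√(y/x) and the Cauchy-Schwarz inequality: R/(U(1) - U(p))² ≤ 5 (1 + Z)/√|1-p| (`R_div_le_of_lt_one`,
`R_div_le_of_one_lt`). The singularity at p = 1 is integrable, so Z - p is at most a constant times
ε p (1 + Z) (`quotient_sub_le`).

This settles p ≤ P for a large cutoff P. Beyond P, where U should be small, U(p) √(p-1) is
nonincreasing (`U_mul_sqrt_le`). Together they give |p U(p) - 1| ≤ δ √(1+p), uniformly in p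
(`abs_sub_le`), which is enough for the norm because θ < 1/2. The first two derivatives follow by
convexity: U and -U' are convex, so closeness of the functions passes to the slopes. -/

namespace Smoluchowski

/-! ### Regular representatives of solutions and the symmetrised weak equation. -/

/-- A symmetric measurable perturbation on the quadrant dominated by `√(x/y) + √(y/x)`. -/
structure IsSqrtPerturbation (W : ℝ → ℝ → ℝ) : Prop where
  measurable : Measurable (Function.uncurry W)
  symm : ∀ x y, W x y = W y x
  nonneg : ∀ x y, 0 ≤ W x y
  le : ∀ x y, 0 < x → 0 < y → W x y ≤ √x * (√y)⁻¹ + (√x)⁻¹ * √y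

/-- A measurable, everywhere non-negative representative of a rescaled solution, with the
normalisation recorded through the Laplace transform and a subexponential lower bound. -/
structure IsRegularSolution (ε : ℝ) (W : ℝ → ℝ → ℝ) (u : ℝ → ℝ) : Prop where
  measurable : Measurable u
  nonneg : ∀ x, 0 ≤ u x
  hasLaplace : HasLaplace u
  equation : ∀ᵐ x ∂(volume.restrict (Ioi (0 : ℝ))),
    ENNReal.ofReal (x ^ 2 * u x) =
      ∫⁻ y in Ioo 0 x, ∫⁻ z in Ioi (x - y),
        ENNReal.ofReal (y * kernel ε W y z * u y * u z * Real.exp (x - (y + z)))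
  lower : ∀ η : ℝ, 0 < η → ∃ X : ℝ, 0 < X ∧ ∀ᵐ x : ℝ, X < x → Real.exp (-(η * x)) ≤ u x

variable {ε : ℝ} {W : ℝ → ℝ → ℝ} {u : ℝ → ℝ}

theorem IsSqrtPerturbation.measurable_kernel (hW : IsSqrtPerturbation W) :
    Measurable (Function.uncurry (kernel ε W)) := by
  have := hW.measurable
  unfold kernel
  exact (measurable_const.add (this.const_mul ε))

theorem IsSqrtPerturbation.measurable_comp₂ (hW : IsSqrtPerturbation W) {β : Type*}
    [MeasurableSpace β] {a b : β → ℝ} (ha : Measurable a) (hb : Measurable b) :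
    Measurable fun t => W (a t) (b t) :=
  hW.measurable.comp (ha.prodMk hb)

theorem IsSqrtPerturbation.measurable_kernel_comp₂ (hW : IsSqrtPerturbation W) {β : Type*}
    [MeasurableSpace β] {a b : β → ℝ} (ha : Measurable a) (hb : Measurable b) :
    Measurable fun t => kernel ε W (a t) (b t) :=
  hW.measurable_kernel.comp (ha.prodMk hb)

/-- The equation in weak form, tested with a non-negative function `ψ`. -/
theorem IsRegularSolution.lintegral_test (hW : IsSqrtPerturbation W)
    (hu : IsRegularSolution ε W u) {ψ : ℝ → ℝ≥0∞} (hψ : Measurable ψ) :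
    ∫⁻ x in Ioi (0 : ℝ), ENNReal.ofReal (x ^ 2 * u x * Real.exp (-x)) * ψ x =
      ∫⁻ y in Ioi (0 : ℝ), ∫⁻ z in Ioi (0 : ℝ),
        ENNReal.ofReal (y * kernel ε W y z * (u y * Real.exp (-y)) * (u z * Real.exp (-z))) *
          ∫⁻ x in Ioo y (y + z), ψ x := by
  have hum := hu.measurable
  set G : ℝ → ℝ → ℝ≥0∞ := fun y z =>
    ENNReal.ofReal (y * kernel ε W y z * (u y * Real.exp (-y)) * (u z * Real.exp (-z))) with hG
  have hGm : Measurable (Function.uncurry G) := by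
    have h1 : Measurable fun t : ℝ × ℝ => kernel ε W t.1 t.2 :=
      hW.measurable_kernel_comp₂ measurable_fst measurable_snd
    have h2 : Measurable fun t : ℝ × ℝ => u t.1 := hum.comp measurable_fst
    have h3 : Measurable fun t : ℝ × ℝ => u t.2 := hum.comp measurable_snd
    simp only [hG, Function.uncurry_def]
    fun_prop
  -- The indicator of y < x < y + z moves the x-dependent domain into the integrand, so that Tonelli
  -- applies on a fixed octant.
  set I : ℝ → ℝ → ℝ → ℝ≥0∞ := fun x y z =>
    {t : ℝ × ℝ × ℝ | t.2.1 < t.1 ∧ t.1 < t.2.1 + t.2.2}.indicator 1 (x, y, z) with hI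
  have hIm : Measurable fun t : ℝ × ℝ × ℝ => I t.1 t.2.1 t.2.2 := by
    simp only [hI, Prod.mk.eta]
    refine measurable_one.indicator ?_
    have h1 : MeasurableSet {t : ℝ × ℝ × ℝ | t.2.1 < t.1} :=
      measurableSet_lt (by fun_prop) (by fun_prop)
    have h2 : MeasurableSet {t : ℝ × ℝ × ℝ | t.1 < t.2.1 + t.2.2} :=
      measurableSet_lt (by fun_prop) (by fun_prop)
    exact h1.inter h2
  have key : ∀ᵐ x ∂(volume.restrict (Ioi (0 : ℝ))),
      ENNReal.ofReal (x ^ 2 * u x * Real.exp (-x)) * ψ x =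
        ∫⁻ y in Ioi (0 : ℝ), ∫⁻ z in Ioi (0 : ℝ), G y z * (I x y z * ψ x) := by
    filter_upwards [hu.equation, ae_restrict_mem measurableSet_Ioi] with x hx hx0
    have hx0 : 0 < x := hx0
    rw [ENNReal.ofReal_mul' (Real.exp_pos _).le, hx]
    have e1 : (Ioo 0 x) = Iio x ∩ Ioi 0 := by ext; simp [and_comm]
    have hHm : Measurable fun y => ∫⁻ z in Ioi (0:ℝ), G y z * (I x y z * ψ x) := by
      apply Measurable.lintegral_prod_right (f := fun y z => G y z * (I x y z * ψ x))
      have : Measurable fun t : ℝ × ℝ => I x t.1 t.2 :=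
        hIm.comp (by fun_prop : Measurable fun t : ℝ × ℝ => (x, t.1, t.2))
      exact hGm.mul (this.mul_const _)
    rw [← lintegral_mul_const' _ _ ENNReal.ofReal_ne_top,
      ← lintegral_mul_const'' _ ?_]
    swap
    · refine Measurable.aemeasurable ?_
      refine Measurable.mul_const ?_ _
      have : (fun y => ∫⁻ z in Ioi (x - y),
          ENNReal.ofReal (y * kernel ε W y z * u y * u z * Real.exp (x - (y + z)))) =
          fun y => ∫⁻ z, {t : ℝ × ℝ | x - t.1 < t.2}.indicator (fun t => ENNReal.ofReal
            (t.1 * kernel ε W t.1 t.2 * u t.1 * u t.2 * Real.exp (x - (t.1 + t.2)))) (y, z) := by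
        ext y
        rw [← lintegral_indicator measurableSet_Ioi]
        congr 1
      rw [this]
      apply Measurable.lintegral_prod_right'
        (f := {t : ℝ × ℝ | x - t.1 < t.2}.indicator (fun t => ENNReal.ofReal
            (t.1 * kernel ε W t.1 t.2 * u t.1 * u t.2 * Real.exp (x - (t.1 + t.2)))))
      refine Measurable.indicator ?_ (measurableSet_lt (by fun_prop) (by fun_prop))
      have h1 : Measurable fun t : ℝ × ℝ => kernel ε W t.1 t.2 :=
        hW.measurable_kernel_comp₂ measurable_fst measurable_snd
      have h2 : Measurable fun t : ℝ × ℝ => u t.1 := hum.comp measurable_fst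
      have h3 : Measurable fun t : ℝ × ℝ => u t.2 := hum.comp measurable_snd
      fun_prop
    rw [e1, ← Measure.restrict_restrict measurableSet_Iio,
      ← lintegral_indicator measurableSet_Iio]
    refine lintegral_congr fun y => ?_
    by_cases hy : y < x
    · rw [indicator_of_mem (by exact hy)]
      have e2 : (Ioi (x - y)) = Ioi (x - y) ∩ Ioi 0 := by
        ext z; simp only [mem_Ioi, mem_inter_iff]; constructor
        · intro h; exact ⟨h, by linarith⟩
        · exact fun h => h.1
      rw [← lintegral_mul_const' _ _ ENNReal.ofReal_ne_top,
        ← lintegral_mul_const'' _ ?_, e2, ← Measure.restrict_restrict measurableSet_Ioi,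
        ← lintegral_indicator measurableSet_Ioi]
      · refine lintegral_congr fun z => ?_
        by_cases hz : x - y < z
        · rw [indicator_of_mem (by exact hz)]
          have : I x y z = 1 := by
            simp only [hI]; rw [indicator_of_mem]; · rfl
            exact ⟨hy, by simp only; linarith⟩
          rw [this, one_mul, ← ENNReal.ofReal_mul' (Real.exp_pos _).le]
          congr 2
          rw [show x - (y + z) = x + (-y) + (-z) by ring, Real.exp_add, Real.exp_add]
          have : Real.exp x * Real.exp (-x) = 1 := by rw [← Real.exp_add]; simp
          linear_combination (y * kernel ε W y z * u y * u z * Real.exp (-y) * Real.exp (-z)) * this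
        · rw [indicator_of_notMem (by exact hz)]
          have : I x y z = 0 := by
            simp only [hI]; rw [indicator_of_notMem]
            rintro ⟨_, h⟩; simp only at h; exact hz (by linarith)
          simp [this]
      · have h1 : Measurable fun z : ℝ => kernel ε W y z :=
          hW.measurable_kernel_comp₂ measurable_const measurable_id
        exact Measurable.aemeasurable (by fun_prop)
    · rw [indicator_of_notMem (by exact hy)]
      have : ∀ z, I x y z = 0 := by
        intro z; simp only [hI]; rw [indicator_of_notMem]
        rintro ⟨h, _⟩; exact hy h
      simp [this]
  rw [lintegral_congr_ae key, lintegral_lintegral_swap]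
  · refine setLIntegral_congr_fun measurableSet_Ioi fun y hy => ?_
    have hy : 0 < y := hy
    rw [lintegral_lintegral_swap]
    · refine lintegral_congr fun z => ?_
      rw [lintegral_const_mul]
      · congr 1
        have e : Ioo y (y + z) = Ioo y (y + z) ∩ Ioi 0 := by
          ext x; simp only [mem_Ioo, mem_inter_iff, mem_Ioi]; constructor
          · intro h; exact ⟨h, by linarith⟩
          · exact fun h => h.1
        rw [e, ← Measure.restrict_restrict measurableSet_Ioo,
          ← lintegral_indicator measurableSet_Ioo]
        refine lintegral_congr fun x => ?_
        by_cases hx : x ∈ Ioo y (y + z)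
        · have : I x y z = 1 := by
            simp only [hI]; rw [indicator_of_mem]; · rfl
            exact ⟨hx.1, hx.2⟩
          simp [this, hx]
        · have : I x y z = 0 := by
            simp only [hI]; rw [indicator_of_notMem]
            exact hx
          simp [this, hx]
      · exact (hIm.comp (by fun_prop : Measurable fun x : ℝ => (x, y, z))).mul hψ
    · refine Measurable.aemeasurable ?_
      refine Measurable.mul ?_ (Measurable.mul ?_ (hψ.comp measurable_fst))
      · exact hGm.comp (by fun_prop : Measurable fun t : ℝ × ℝ => (y, t.2))
      · exact hIm.comp (by fun_prop : Measurable fun t : ℝ × ℝ => (t.1, y, t.2))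
  · refine Measurable.aemeasurable ?_
    apply Measurable.lintegral_prod_right
      (f := fun (t : ℝ × ℝ) z => G t.2 z * (I t.1 t.2 z * ψ t.1))
    refine Measurable.mul ?_ (Measurable.mul ?_ ?_)
    · exact hGm.comp (by fun_prop : Measurable fun t : (ℝ × ℝ) × ℝ => (t.1.2, t.2))
    · exact hIm.comp (by fun_prop : Measurable fun t : (ℝ × ℝ) × ℝ => (t.1.1, t.1.2, t.2))
    · exact hψ.comp (by fun_prop : Measurable fun t : (ℝ × ℝ) × ℝ => t.1.1)

/-- The equation tested with `(χ - 1) / x`: the symmetrised weak form. -/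
theorem IsRegularSolution.two_mul_lintegral_eq (hε : 0 ≤ ε) (hW : IsSqrtPerturbation W)
    (hu : IsRegularSolution ε W u) {χ χ' : ℝ → ℝ} (hχ : ∀ x, HasDerivAt χ (χ' x) x)
    (hχ' : Continuous χ') (hpos : ∀ x, 0 < x → 0 ≤ x * χ' x - (χ x - 1)) :
    2 * ∫⁻ x in Ioi (0 : ℝ),
        ENNReal.ofReal (u x * Real.exp (-x) * (x * χ' x - (χ x - 1))) =
      ∫⁻ y in Ioi (0 : ℝ), ∫⁻ z in Ioi (0 : ℝ),
        ENNReal.ofReal (kernel ε W y z * (u y * Real.exp (-y)) * (u z * Real.exp (-z)) *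
          (χ (y + z) - χ y - χ z + 1)) := by
  have hum := hu.measurable
  have hχc : Continuous χ := continuous_iff_continuousAt.2 fun x => (hχ x).continuousAt
  -- ψ is the derivative of Ψ(x) = (χ(x) - 1)/x, and `hpos` says that it is non-negative. Its
  -- integral over (y, y+z) is therefore an increment of the monotone function Ψ.
  set ψ : ℝ → ℝ := fun x => (x * χ' x - (χ x - 1)) / x ^ 2 with hψ
  have hψm : Measurable ψ := by
    have := hχ'.measurable
    have := hχc.measurable
    simp only [hψ]; fun_prop
  have hψ0 : ∀ x, 0 < x → 0 ≤ ψ x := fun x hx => div_nonneg (hpos x hx) (sq_nonneg x)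
  have hK : ∀ y z, 0 ≤ kernel ε W y z := fun y z => by
    have := mul_nonneg hε (hW.nonneg y z); unfold kernel; linarith
  set Ψ : ℝ → ℝ := fun x => (χ x - 1) / x with hΨ
  have hint : ∀ y z, 0 < y → 0 < z →
      ∫⁻ x in Ioo y (y + z), ENNReal.ofReal (ψ x) = ENNReal.ofReal (Ψ (y + z) - Ψ y) := by
    intro y z hy hz
    have hc : ContinuousOn ψ (Icc y (y + z)) := by
      simp only [hψ]
      refine ContinuousOn.div (by fun_prop) (by fun_prop) ?_
      intro x hx; have : 0 < x := lt_of_lt_of_le hy hx.1; positivity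
    have hi : IntervalIntegrable ψ volume y (y + z) :=
      ContinuousOn.intervalIntegrable (by rwa [uIcc_of_le (by linarith)])
    have hftc : ∫ x in y..(y + z), ψ x = Ψ (y + z) - Ψ y := by
      refine intervalIntegral.integral_eq_sub_of_hasDerivAt ?_ hi
      intro x hx
      rw [uIcc_of_le (by linarith)] at hx
      have hx0 : x ≠ 0 := (lt_of_lt_of_le hy hx.1).ne'
      have := ((hχ x).sub_const 1).div (hasDerivAt_id x) hx0
      refine this.congr_deriv ?_
      simp only [hψ, id]; ring
    rw [← hftc, intervalIntegral.integral_of_le (by linarith), integral_Ioc_eq_integral_Ioo,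
      ofReal_integral_eq_lintegral_ofReal]
    · exact (hc.integrableOn_Icc).mono_set Ioo_subset_Icc_self
    · filter_upwards [ae_restrict_mem measurableSet_Ioo] with x hx
      exact hψ0 x (hy.trans hx.1)
  have h := hu.lintegral_test hW (ψ := fun x => ENNReal.ofReal (ψ x)) hψm.ennreal_ofReal
  set g : ℝ → ℝ := fun x => u x * Real.exp (-x) with hg
  have hg0 : ∀ x, 0 ≤ g x := fun x => mul_nonneg (hu.nonneg x) (Real.exp_pos _).le
  have hgm : Measurable g := by simp only [hg]; fun_prop
  set H : ℝ → ℝ → ℝ≥0∞ := fun y z =>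
    ENNReal.ofReal (y * kernel ε W y z * g y * g z * (Ψ (y + z) - Ψ y)) with hH
  have hΨm : Measurable Ψ := by have := hχc.measurable; simp only [hΨ]; fun_prop
  have hHm : Measurable (Function.uncurry H) := by
    have h1 : Measurable fun t : ℝ × ℝ => kernel ε W t.1 t.2 :=
      hW.measurable_kernel_comp₂ measurable_fst measurable_snd
    have h2 : Measurable fun t : ℝ × ℝ => g t.1 := hgm.comp measurable_fst
    have h3 : Measurable fun t : ℝ × ℝ => g t.2 := hgm.comp measurable_snd
    have h4 : Measurable fun t : ℝ × ℝ => Ψ (t.1 + t.2) :=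
      hΨm.comp (measurable_fst.add measurable_snd)
    have h5 : Measurable fun t : ℝ × ℝ => Ψ t.1 := hΨm.comp measurable_fst
    simp only [hH, Function.uncurry_def]
    fun_prop
  have hL : ∫⁻ x in Ioi (0 : ℝ), ENNReal.ofReal (g x * (x * χ' x - (χ x - 1))) =
      ∫⁻ y in Ioi (0 : ℝ), ∫⁻ z in Ioi (0 : ℝ), H y z := by
    refine Eq.trans ?_ (h.trans ?_)
    · refine setLIntegral_congr_fun measurableSet_Ioi fun x hx => ?_
      have hx : 0 < x := hx
      rw [← ENNReal.ofReal_mul' (hψ0 x hx)]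
      congr 1
      simp only [hψ, hg]; field_simp
    · refine setLIntegral_congr_fun measurableSet_Ioi fun y hy => ?_
      refine setLIntegral_congr_fun measurableSet_Ioi fun z hz => ?_
      have hy : 0 < y := hy
      have hz : 0 < z := hz
      rw [hint y z hy hz, ← ENNReal.ofReal_mul]
      exact mul_nonneg (mul_nonneg (mul_nonneg hy.le (hK y z)) (hg0 y)) (hg0 z)
  -- Adding the version with y and z exchanged removes the factor y: y(Ψ(y+z) - Ψ(y)) + z(Ψ(y+z) -
  -- Ψ(z)) = χ(y+z) - χ(y) - χ(z) + 1.
  have hL' : ∫⁻ y in Ioi (0 : ℝ), ∫⁻ z in Ioi (0 : ℝ), H y z =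
      ∫⁻ y in Ioi (0 : ℝ), ∫⁻ z in Ioi (0 : ℝ), H z y :=
    lintegral_lintegral_swap hHm.aemeasurable
  have hm : ∀ y, Measurable (H y) := fun y =>
    hHm.comp (by fun_prop : Measurable fun z : ℝ => (y, z))
  rw [two_mul]
  change (∫⁻ x in Ioi (0 : ℝ), ENNReal.ofReal (g x * (x * χ' x - (χ x - 1)))) +
    ∫⁻ x in Ioi (0 : ℝ), ENNReal.ofReal (g x * (x * χ' x - (χ x - 1))) = _
  nth_rewrite 2 [hL.trans hL']
  rw [hL, ← lintegral_add_left (Measurable.lintegral_prod_right hHm)]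
  refine setLIntegral_congr_fun measurableSet_Ioi fun y hy => ?_
  have hy : 0 < y := hy
  rw [← lintegral_add_left (hm y)]
  refine setLIntegral_congr_fun measurableSet_Ioi fun z hz => ?_
  have hz : 0 < z := hz
  have hmono : ∀ a b, 0 < a → 0 < b → 0 ≤ Ψ (a + b) - Ψ a := by
    intro a b ha hb
    have hm : MonotoneOn Ψ (Ioi 0) := by
      refine monotoneOn_of_deriv_nonneg (convex_Ioi 0) ?_ ?_ ?_
      · simp only [hΨ]
        exact ContinuousOn.div (by fun_prop) (by fun_prop) fun x hx => (ne_of_gt hx)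
      · intro x hx
        rw [interior_Ioi] at hx
        exact (((hχ x).sub_const 1).div (hasDerivAt_id x)
          (ne_of_gt hx)).differentiableAt.differentiableWithinAt
      · intro x hx
        rw [interior_Ioi] at hx
        have := (((hχ x).sub_const 1).div (hasDerivAt_id x) (ne_of_gt hx)).deriv
        have h2 : deriv Ψ x = ψ x := by
          refine this.trans ?_
          simp only [hψ, id]; ring
        rw [h2]; exact hψ0 x hx
    exact sub_nonneg.2 (hm ha (show (0:ℝ) < a + b by linarith) (by linarith))
  have hpos' : ∀ a b, 0 < a → 0 < b →
      0 ≤ a * kernel ε W a b * g a * g b * (Ψ (a + b) - Ψ a) := fun a b ha hb =>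
    mul_nonneg (mul_nonneg (mul_nonneg (mul_nonneg ha.le (hK a b)) (hg0 a)) (hg0 b))
      (hmono a b ha hb)
  simp only [hH]
  rw [← ENNReal.ofReal_add (hpos' y z hy hz) (hpos' z y hz hy)]
  congr 1
  have hKs : kernel ε W z y = kernel ε W y z := by unfold kernel; rw [hW.symm]
  rw [hKs]
  simp only [hΨ]
  rw [add_comm z y]
  have : y + z ≠ 0 := by positivity
  field_simp
  ring

end Smoluchowski

/-! ### Quadratic forms and Laplace transforms. -/

namespace Smoluchowski

variable {ε : ℝ} {W : ℝ → ℝ → ℝ} {u : ℝ → ℝ}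

/-- The quadratic form `∬ W(y,z) g(y) g(z)` of the perturbation. -/
noncomputable def quadForm (W : ℝ → ℝ → ℝ) (g : ℝ → ℝ) : ℝ≥0∞ :=
  ∫⁻ y in Ioi (0 : ℝ), ∫⁻ z in Ioi (0 : ℝ), ENNReal.ofReal (W y z * g y * g z)

theorem lintegral_ofReal_mul_ofReal {g h : ℝ → ℝ} (hg0 : ∀ x, 0 < x → 0 ≤ g x)
    (hh0 : ∀ x, 0 < x → 0 ≤ h x) (hg : IntegrableOn g (Ioi 0)) (hh : IntegrableOn h (Ioi 0)) :
    ∫⁻ y in Ioi (0 : ℝ), ∫⁻ z in Ioi (0 : ℝ), ENNReal.ofReal (g y * h z) =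
      ENNReal.ofReal ((∫ x in Ioi 0, g x) * ∫ x in Ioi 0, h x) := by
  have hg0' : 0 ≤ᵐ[volume.restrict (Ioi 0)] g := by
    filter_upwards [ae_restrict_mem measurableSet_Ioi] with x hx using hg0 x hx
  have hh0' : 0 ≤ᵐ[volume.restrict (Ioi 0)] h := by
    filter_upwards [ae_restrict_mem measurableSet_Ioi] with x hx using hh0 x hx
  rw [ENNReal.ofReal_mul (integral_nonneg_of_ae hg0'),
    ofReal_integral_eq_lintegral_ofReal hg hg0', ofReal_integral_eq_lintegral_ofReal hh hh0',
    ← lintegral_lintegral_mul hg.aemeasurable.ennreal_ofReal hh.aemeasurable.ennreal_ofReal]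
  refine setLIntegral_congr_fun measurableSet_Ioi fun y hy => ?_
  refine lintegral_congr fun z => ?_
  exact ENNReal.ofReal_mul (hg0 y hy)

theorem IsSqrtPerturbation.lintegral_kernel (hε : 0 ≤ ε) (hW : IsSqrtPerturbation W) {g : ℝ → ℝ}
    (hgm : Measurable g) (hg0 : ∀ x, 0 < x → 0 ≤ g x) (hg : IntegrableOn g (Ioi 0)) :
    ∫⁻ y in Ioi (0 : ℝ), ∫⁻ z in Ioi (0 : ℝ), ENNReal.ofReal (kernel ε W y z * g y * g z) =
      ENNReal.ofReal (2 * (∫ x in Ioi 0, g x) ^ 2) + ENNReal.ofReal ε * quadForm W g := by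
  have hgg := lintegral_ofReal_mul_ofReal hg0 hg0 hg hg
  have e1 : ENNReal.ofReal (2 * (∫ x in Ioi 0, g x) ^ 2) =
      2 * ∫⁻ y in Ioi (0 : ℝ), ∫⁻ z in Ioi (0 : ℝ), ENNReal.ofReal (g y * g z) := by
    rw [hgg, ENNReal.ofReal_mul (by norm_num), sq]; simp
  have m1 : Measurable fun t : ℝ × ℝ => ENNReal.ofReal (g t.1 * g t.2) := by
    have h2 : Measurable fun t : ℝ × ℝ => g t.1 := hgm.comp measurable_fst
    have h3 : Measurable fun t : ℝ × ℝ => g t.2 := hgm.comp measurable_snd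
    fun_prop
  have m2 : Measurable fun t : ℝ × ℝ => ENNReal.ofReal (W t.1 t.2 * g t.1 * g t.2) := by
    have h1 : Measurable fun t : ℝ × ℝ => W t.1 t.2 :=
      hW.measurable_comp₂ measurable_fst measurable_snd
    have h2 : Measurable fun t : ℝ × ℝ => g t.1 := hgm.comp measurable_fst
    have h3 : Measurable fun t : ℝ × ℝ => g t.2 := hgm.comp measurable_snd
    fun_prop
  rw [e1, quadForm, ← lintegral_const_mul' _ _ (by simp),
    ← lintegral_const_mul' _ _ (by simp), ← lintegral_add_left]
  · refine setLIntegral_congr_fun measurableSet_Ioi fun y hy => ?_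
    have hy : 0 < y := hy
    have m1' : Measurable fun z => ENNReal.ofReal (g y * g z) := by fun_prop
    rw [← lintegral_const_mul' _ _ (by simp),
      ← lintegral_const_mul' _ _ (by simp), ← lintegral_add_left (m1'.const_mul 2)]
    refine setLIntegral_congr_fun measurableSet_Ioi fun z hz => ?_
    have hz : 0 < z := hz
    have h0 := mul_nonneg (hg0 y hy) (hg0 z hz)
    have h1 := mul_nonneg (mul_nonneg (hW.nonneg y z) (hg0 y hy)) (hg0 z hz)
    rw [show (2 : ℝ≥0∞) = ENNReal.ofReal 2 by simp, ← ENNReal.ofReal_mul (by norm_num),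
      ← ENNReal.ofReal_mul hε, ← ENNReal.ofReal_add (by positivity) (by positivity)]
    congr 1
    unfold kernel; ring
  · exact (Measurable.lintegral_prod_right' m1).const_mul 2

/-- Each of the two terms dominating W is a product of a function of y and a function of z, so the
double integral splits. -/
theorem IsSqrtPerturbation.quadForm_le (hW : IsSqrtPerturbation W) {g : ℝ → ℝ}
    (hgm : Measurable g) (hg0 : ∀ x, 0 < x → 0 ≤ g x)
    (hp : IntegrableOn (fun x => √x * g x) (Ioi 0))
    (hm : IntegrableOn (fun x => (√x)⁻¹ * g x) (Ioi 0)) :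
    quadForm W g ≤
      ENNReal.ofReal (2 * (∫ x in Ioi 0, √x * g x) * ∫ x in Ioi 0, (√x)⁻¹ * g x) := by
  have hp0 : ∀ x, 0 < x → 0 ≤ √x * g x := fun x hx => mul_nonneg (by positivity) (hg0 x hx)
  have hm0 : ∀ x, 0 < x → 0 ≤ (√x)⁻¹ * g x := fun x hx => mul_nonneg (by positivity) (hg0 x hx)
  have h1 := lintegral_ofReal_mul_ofReal hp0 hm0 hp hm
  have h2 := lintegral_ofReal_mul_ofReal hm0 hp0 hm hp
  have m1 : Measurable fun t : ℝ × ℝ =>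
      ENNReal.ofReal (√t.1 * g t.1 * ((√t.2)⁻¹ * g t.2)) := by
    have h2 : Measurable fun t : ℝ × ℝ => g t.1 := hgm.comp measurable_fst
    have h3 : Measurable fun t : ℝ × ℝ => g t.2 := hgm.comp measurable_snd
    fun_prop
  have i1 : 0 ≤ ∫ x in Ioi 0, √x * g x := setIntegral_nonneg measurableSet_Ioi hp0
  have i2 : 0 ≤ ∫ x in Ioi 0, (√x)⁻¹ * g x := setIntegral_nonneg measurableSet_Ioi hm0
  have e : ENNReal.ofReal (2 * (∫ x in Ioi 0, √x * g x) * ∫ x in Ioi 0, (√x)⁻¹ * g x) =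
      ENNReal.ofReal ((∫ x in Ioi 0, √x * g x) * ∫ x in Ioi 0, (√x)⁻¹ * g x) +
      ENNReal.ofReal ((∫ x in Ioi 0, (√x)⁻¹ * g x) * ∫ x in Ioi 0, √x * g x) := by
    rw [← ENNReal.ofReal_add (by positivity) (by positivity)]; congr 1; ring
  rw [e, ← h1, ← h2, ← lintegral_add_left (Measurable.lintegral_prod_right' m1), quadForm]
  refine setLIntegral_mono' measurableSet_Ioi fun y hy => ?_
  have hy : 0 < y := hy
  have m1' : Measurable fun z => ENNReal.ofReal (√y * g y * ((√z)⁻¹ * g z)) := by fun_prop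
  rw [← lintegral_add_left m1']
  refine setLIntegral_mono' measurableSet_Ioi fun z hz => ?_
  have hz : 0 < z := hz
  rw [← ENNReal.ofReal_add (mul_nonneg (hp0 y hy) (hm0 z hz))
    (mul_nonneg (hm0 y hy) (hp0 z hz))]
  refine ENNReal.ofReal_le_ofReal ?_
  have := mul_le_mul_of_nonneg_right (hW.le y z hy hz) (mul_nonneg (hg0 y hy) (hg0 z hz))
  linarith

theorem abs_exp_sub_exp_le (a b : ℝ) :
    |Real.exp (-a) - Real.exp (-b)| ≤ |a - b| * Real.exp (-(min a b)) := by
  wlog h : a ≤ b generalizing a b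
  · rw [abs_sub_comm, abs_sub_comm a b, min_comm]; exact this b a (le_of_not_ge h)
  rw [min_eq_left h, abs_of_nonneg (sub_nonneg.2 (Real.exp_le_exp.2 (by linarith))),
    abs_sub_comm, abs_of_nonneg (sub_nonneg.2 h)]
  have h1 : Real.exp (-b) = Real.exp (-a) * Real.exp (-(b - a)) := by
    rw [← Real.exp_add]; ring_nf
  have h2 := Real.add_one_le_exp (-(b - a))
  rw [h1]
  nlinarith [Real.exp_pos (-a)]

/-- The difference of exponentials vanishes linearly at 0, so it suffices that x g has a Laplace
transform. This admits g = x^{-1/2} u and g = x^{-1} u, whose integrability at 0 is not known. -/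
theorem integrableOn_mul_exp_sub_exp {g : ℝ → ℝ} (hgm : AEStronglyMeasurable g
      (volume.restrict (Ioi 0))) (hg : HasLaplace fun x => x * g x) {p : ℝ} (hp : 0 < p) :
    IntegrableOn (fun x => g x * (Real.exp (-(p * x)) - Real.exp (-x))) (Ioi 0) := by
  have h1 := ((hg (min p 1) (by positivity)).norm).const_mul |p - 1|
  refine h1.mono' (hgm.mul (by fun_prop)) ?_
  filter_upwards [ae_restrict_mem measurableSet_Ioi] with x hx
  have hx : 0 < x := hx
  have := abs_exp_sub_exp_le (p * x) x
  have h2 : |p * x - x| = |p - 1| * x := by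
    rw [show p * x - x = (p - 1) * x by ring, abs_mul, abs_of_pos hx]
  have h3 : min (p * x) x = min p 1 * x := by
    rw [min_mul_of_nonneg _ _ hx.le, one_mul]
  rw [h2, h3] at this
  simp only [Real.norm_eq_abs, abs_mul, abs_of_pos hx, Real.abs_exp]
  calc _ ≤ |g x| * (|p - 1| * x * Real.exp (-(min p 1 * x))) := by gcongr
    _ = _ := by ring

theorem hasDerivAt_integral_mul_exp_sub_exp {g : ℝ → ℝ} (hgm : AEStronglyMeasurable g
      (volume.restrict (Ioi 0))) (hg : HasLaplace fun x => x * g x) {p : ℝ} (hp : 0 < p) :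
    HasDerivAt (fun p => ∫ x in Ioi 0, g x * (Real.exp (-(p * x)) - Real.exp (-x)))
      (-laplace (fun x => x * g x) p) p := by
  have hs : Ioi (p / 2) ∈ 𝓝 p := Ioi_mem_nhds (by linarith)
  have key := hasDerivAt_integral_of_dominated_loc_of_deriv_le
    (μ := volume.restrict (Ioi (0 : ℝ)))
    (F := fun p x => g x * (Real.exp (-(p * x)) - Real.exp (-x)))
    (F' := fun p x => -(x * g x * Real.exp (-(p * x)))) (x₀ := p)
    (bound := fun x => ‖x * g x * Real.exp (-(p / 2 * x))‖) hs
    (Eventually.of_forall fun q => hgm.mul (by fun_prop))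
    (integrableOn_mul_exp_sub_exp hgm hg hp)
    (hg p hp).aestronglyMeasurable.neg ?_ (hg (p / 2) (by linarith)).norm ?_
  · refine key.2.congr_deriv ?_
    rw [laplace, integral_neg]
  · filter_upwards [ae_restrict_mem measurableSet_Ioi] with x hx q hq
    have hx : 0 < x := hx
    have hq : p / 2 < q := hq
    rw [norm_neg, norm_mul, norm_mul (x * g x)]
    refine mul_le_mul_of_nonneg_left ?_ (norm_nonneg _)
    rw [Real.norm_of_nonneg (Real.exp_pos _).le, Real.norm_of_nonneg (Real.exp_pos _).le]
    exact Real.exp_le_exp.2 (by nlinarith)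
  · refine Eventually.of_forall fun x q _ => ?_
    have h1 : HasDerivAt (fun q => Real.exp (-(q * x))) (Real.exp (-(q * x)) * (-(1 * x))) q :=
      (((hasDerivAt_id q).mul_const x).neg).exp
    have := (h1.sub_const (Real.exp (-x))).const_mul (g x)
    exact this.congr_deriv (by ring)

theorem HasLaplace.aestronglyMeasurable {ω : ℝ → ℝ} (h : HasLaplace ω) :
    AEStronglyMeasurable ω (volume.restrict (Ioi 0)) := by
  have h1 := (h 1 one_pos).aestronglyMeasurable.mul
    (by fun_prop : AEStronglyMeasurable (fun x : ℝ => Real.exp x) (volume.restrict (Ioi 0)))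
  refine h1.congr (Eventually.of_forall fun x => ?_)
  simp only [Pi.mul_apply, one_mul]
  rw [mul_assoc, ← Real.exp_add]; simp

/-- A function with subexponential growth may be inserted into a Laplace transform. -/
theorem HasLaplace.mul_of_le {ω c : ℝ → ℝ} (h : HasLaplace ω)
    (hc : AEStronglyMeasurable c (volume.restrict (Ioi 0))) {a b : ℝ}
    (hle : ∀ x, 0 < x → |c x| ≤ a + b * x) : HasLaplace fun x => c x * ω x := by
  intro p hp
  have h1 := ((h p hp).norm.const_mul |a|).add ((h (p / 2) (by linarith)).norm.const_mul
    (|b| * (2 / p)))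
  refine h1.mono' ((hc.mul h.aestronglyMeasurable).mul (by fun_prop)) ?_
  filter_upwards [ae_restrict_mem measurableSet_Ioi] with x hx
  have hx : 0 < x := hx
  simp only [Pi.add_apply, norm_mul, Real.norm_eq_abs, Real.abs_exp]
  have h2 : x * Real.exp (-(p * x)) ≤ 2 / p * Real.exp (-(p / 2 * x)) := by
    have e1 : Real.exp (-(p * x)) = Real.exp (-(p / 2 * x)) * Real.exp (-(p / 2 * x)) := by
      rw [← Real.exp_add]; ring_nf
    have e2 : x * Real.exp (-(p / 2 * x)) ≤ 2 / p := by
      have e3 := Real.add_one_le_exp (p / 2 * x)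
      rw [Real.exp_neg, ← div_eq_mul_inv, div_le_div_iff₀ (Real.exp_pos _) hp]
      nlinarith
    rw [e1, ← mul_assoc]
    exact mul_le_mul_of_nonneg_right e2 (Real.exp_pos _).le
  have h3 : |c x| ≤ |a| + |b| * x :=
    (hle x hx).trans (add_le_add (le_abs_self a) (mul_le_mul_of_nonneg_right (le_abs_self b) hx.le))
  calc |c x| * |ω x| * Real.exp (-(p * x))
      ≤ (|a| + |b| * x) * |ω x| * Real.exp (-(p * x)) := by gcongr
    _ = |a| * (|ω x| * Real.exp (-(p * x))) + |b| * |ω x| * (x * Real.exp (-(p * x))) := by ring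
    _ ≤ |a| * (|ω x| * Real.exp (-(p * x))) +
          |b| * |ω x| * (2 / p * Real.exp (-(p / 2 * x))) := by gcongr
    _ = _ := by ring

theorem HasLaplace.id_mul {ω : ℝ → ℝ} (h : HasLaplace ω) : HasLaplace fun x => x * ω x :=
  h.mul_of_le (a := 0) (b := 1) (by fun_prop) fun x hx => by rw [abs_of_pos hx]; linarith

theorem sqrt_le_one_add {x : ℝ} (hx : 0 < x) : √x ≤ 1 + x := by
  nlinarith [Real.sq_sqrt hx.le, Real.sqrt_nonneg x, sq_nonneg (√x - 1)]

theorem HasLaplace.sqrt_mul {ω : ℝ → ℝ} (h : HasLaplace ω) : HasLaplace fun x => √x * ω x :=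
  h.mul_of_le (a := 1) (b := 1) (by fun_prop) fun x hx => by
    rw [abs_of_nonneg (Real.sqrt_nonneg _), one_mul]; exact sqrt_le_one_add hx

theorem HasLaplace.integral_mul_exp_sub_exp {ω : ℝ → ℝ} (h : HasLaplace ω) {p : ℝ} (hp : 0 < p) :
    ∫ x in Ioi 0, ω x * (Real.exp (-(p * x)) - Real.exp (-x)) = laplace ω p - laplace ω 1 := by
  have h1 := h p hp
  have h2 := h 1 one_pos
  rw [laplace, laplace, ← integral_sub h1 h2]
  refine integral_congr_ae (Eventually.of_forall fun x => ?_)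
  simp only [one_mul]; ring

theorem HasLaplace.hasDerivAt {ω : ℝ → ℝ} (h : HasLaplace ω) {p : ℝ} (hp : 0 < p) :
    HasDerivAt (laplace ω) (-laplace (fun x => x * ω x) p) p := by
  have h1 := (hasDerivAt_integral_mul_exp_sub_exp h.aestronglyMeasurable h.id_mul hp).add_const
    (laplace ω 1)
  refine h1.congr_of_eventuallyEq ?_
  filter_upwards [Ioi_mem_nhds hp] with q hq
  have : (∫ x in Ioi 0, ω x * (Real.exp (-(q * x)) - Real.exp (-x))) + laplace ω 1 =
      laplace ω q := by rw [h.integral_mul_exp_sub_exp hq]; ring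
  exact this.symm

theorem laplace_nonneg {ω : ℝ → ℝ} (h0 : ∀ x, 0 < x → 0 ≤ ω x) (p : ℝ) : 0 ≤ laplace ω p :=
  setIntegral_nonneg measurableSet_Ioi fun x hx => mul_nonneg (h0 x hx) (Real.exp_pos _).le

theorem HasLaplace.laplace_anti {ω : ℝ → ℝ} (h : HasLaplace ω) (h0 : ∀ x, 0 < x → 0 ≤ ω x)
    {p q : ℝ} (hp : 0 < p) (hpq : p ≤ q) : laplace ω q ≤ laplace ω p := by
  refine setIntegral_mono_on (h q (hp.trans_le hpq)) (h p hp) measurableSet_Ioi fun x hx => ?_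
  have hx : 0 < x := hx
  exact mul_le_mul_of_nonneg_left (Real.exp_le_exp.2 (by nlinarith)) (h0 x hx)

theorem HasLaplace.tendsto_atTop {ω : ℝ → ℝ} (h : HasLaplace ω) :
    Tendsto (laplace ω) atTop (𝓝 0) := by
  have := tendsto_integral_filter_of_dominated_convergence
    (μ := volume.restrict (Ioi (0 : ℝ))) (l := atTop)
    (F := fun p x => ω x * Real.exp (-(p * x))) (f := fun _ => 0)
    (fun x => ‖ω x * Real.exp (-(1 * x))‖) ?_ ?_ (h 1 one_pos).norm ?_
  · rw [integral_zero] at this; exact this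
  · exact Eventually.of_forall fun p => h.aestronglyMeasurable.mul (by fun_prop)
  · filter_upwards [eventually_ge_atTop 1] with p hp
    filter_upwards [ae_restrict_mem measurableSet_Ioi] with x hx
    have hx : 0 < x := hx
    rw [norm_mul, norm_mul (ω x)]
    refine mul_le_mul_of_nonneg_left ?_ (norm_nonneg _)
    rw [Real.norm_of_nonneg (Real.exp_pos _).le, Real.norm_of_nonneg (Real.exp_pos _).le]
    exact Real.exp_le_exp.2 (by nlinarith)
  · filter_upwards [ae_restrict_mem measurableSet_Ioi] with x hx
    have hx : 0 < x := hx
    have : Tendsto (fun p => Real.exp (-(p * x))) atTop (𝓝 0) :=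
      Real.tendsto_exp_atBot.comp (tendsto_neg_atTop_atBot.comp (tendsto_id.atTop_mul_const hx))
    simpa using this.const_mul (ω x)

end Smoluchowski

/-! ### The Laplace transformed equation and Cauchy-Schwarz bounds for the remainder. -/

namespace Smoluchowski

variable {ε : ℝ} {W : ℝ → ℝ → ℝ} {u : ℝ → ℝ}

/-- For b > 0 the hypothesis says that a τ² - 2bτ + d is non-negative for τ > 0; for τ ≤ 0 this is
clear, so the discriminant is nonpositive. -/
theorem le_sqrt_mul_of_forall {a b d : ℝ}
    (h : ∀ τ : ℝ, 0 < τ → b ≤ (τ * a + τ⁻¹ * d) / 2) (ha : 0 ≤ a) (hd : 0 ≤ d) :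
    b ≤ √(a * d) := by
  rcases le_or_gt b 0 with hb | hb
  · exact hb.trans (Real.sqrt_nonneg _)
  refine Real.le_sqrt_of_sq_le ?_
  have h1 : ∀ τ : ℝ, 0 ≤ a * (τ * τ) + (-(2 * b)) * τ + d := by
    intro τ
    rcases le_or_gt τ 0 with hτ | hτ
    · nlinarith [mul_nonneg ha (mul_self_nonneg τ)]
    · have h2 := mul_le_mul_of_nonneg_left (h τ hτ) hτ.le
      have h3 : τ * ((τ * a + τ⁻¹ * d) / 2) = (a * (τ * τ) + d) / 2 := by field_simp
      rw [h3] at h2; linarith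
  have := discrim_le_zero h1
  rw [discrim] at this; nlinarith

/-- Cauchy-Schwarz inequality, for an integrand dominated by a geometric mean. -/
theorem integral_le_sqrt_of_amgm {k g₁ g₂ : ℝ → ℝ} (hk : IntegrableOn k (Ioi 0))
    (h₁ : IntegrableOn g₁ (Ioi 0)) (h₂ : IntegrableOn g₂ (Ioi 0))
    (h₁0 : ∀ x, 0 < x → 0 ≤ g₁ x) (h₂0 : ∀ x, 0 < x → 0 ≤ g₂ x)
    (hle : ∀ τ : ℝ, 0 < τ → ∀ x, 0 < x → k x ≤ (τ * g₁ x + τ⁻¹ * g₂ x) / 2) :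
    ∫ x in Ioi 0, k x ≤ √((∫ x in Ioi 0, g₁ x) * ∫ x in Ioi 0, g₂ x) := by
  refine le_sqrt_mul_of_forall (fun τ hτ => ?_) (setIntegral_nonneg measurableSet_Ioi h₁0)
    (setIntegral_nonneg measurableSet_Ioi h₂0)
  rw [← integral_const_mul, ← integral_const_mul,
    ← integral_add (h₁.const_mul τ) (h₂.const_mul _), ← integral_div]
  exact setIntegral_mono_on hk (((h₁.const_mul τ).add (h₂.const_mul _)).div_const 2)
    measurableSet_Ioi fun x hx => hle τ hτ x hx

theorem sqrt_le_amgm {τ x : ℝ} (hτ : 0 < τ) (hx : 0 < x) : √x ≤ (τ + τ⁻¹ * x) / 2 := by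
  have h := mul_nonneg (inv_pos.2 hτ).le (sq_nonneg (τ - √x))
  have h1 : τ⁻¹ * (τ - √x) ^ 2 = τ + τ⁻¹ * x - 2 * √x := by
    have := Real.sq_sqrt hx.le
    field_simp; linear_combination this
  linarith

theorem inv_sqrt_le_amgm {τ x : ℝ} (hτ : 0 < τ) (hx : 0 < x) :
    (√x)⁻¹ ≤ (τ + τ⁻¹ * x⁻¹) / 2 := by
  rw [← Real.sqrt_inv]; exact sqrt_le_amgm hτ (inv_pos.2 hx)

theorem integral_sqrt_mul_le {g : ℝ → ℝ} (hg0 : ∀ x, 0 < x → 0 ≤ g x)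
    (h : IntegrableOn g (Ioi 0)) (h1 : IntegrableOn (fun x => x * g x) (Ioi 0))
    (h2 : IntegrableOn (fun x => √x * g x) (Ioi 0)) :
    ∫ x in Ioi 0, √x * g x ≤ √((∫ x in Ioi 0, g x) * ∫ x in Ioi 0, x * g x) := by
  refine integral_le_sqrt_of_amgm h2 h h1 hg0 (fun x hx => mul_nonneg hx.le (hg0 x hx)) ?_
  intro τ hτ x hx
  have := mul_le_mul_of_nonneg_right (sqrt_le_amgm hτ hx) (hg0 x hx)
  linarith

theorem integral_inv_sqrt_mul_le {g : ℝ → ℝ} (hg0 : ∀ x, 0 < x → 0 ≤ g x)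
    (h : IntegrableOn g (Ioi 0)) (h1 : IntegrableOn (fun x => x⁻¹ * g x) (Ioi 0))
    (h2 : IntegrableOn (fun x => (√x)⁻¹ * g x) (Ioi 0)) :
    ∫ x in Ioi 0, (√x)⁻¹ * g x ≤ √((∫ x in Ioi 0, g x) * ∫ x in Ioi 0, x⁻¹ * g x) := by
  refine integral_le_sqrt_of_amgm h2 h h1 hg0
    (fun x hx => mul_nonneg (inv_pos.2 hx).le (hg0 x hx)) ?_
  intro τ hτ x hx
  have := mul_le_mul_of_nonneg_right (inv_sqrt_le_amgm hτ hx) (hg0 x hx)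
  linarith

/-- The remainder in the Laplace transformed equation. -/
noncomputable def remainder (W : ℝ → ℝ → ℝ) (u : ℝ → ℝ) (p : ℝ) : ℝ :=
  (quadForm W fun x => u x * |Real.exp (-(p * x)) - Real.exp (-x)|).toReal / 2

theorem remainder_nonneg (W : ℝ → ℝ → ℝ) (u : ℝ → ℝ) (p : ℝ) : 0 ≤ remainder W u p :=
  div_nonneg ENNReal.toReal_nonneg zero_le_two

/-- The part `∫ x^{-1/2} u (e^{-px} - e^{-x})` of the remainder coming from small clusters. -/
noncomputable def smallPart (u : ℝ → ℝ) (p : ℝ) : ℝ :=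
  ∫ x in Ioi 0, (√x)⁻¹ * u x * (Real.exp (-(p * x)) - Real.exp (-x))

/-- First moment of `u` against `e^{-px}`, i.e. minus the derivative of the Laplace transform. -/
noncomputable def laplaceMoment (u : ℝ → ℝ) : ℝ → ℝ := laplace fun x => x * u x

theorem integrableOn_mul_abs {w : ℝ → ℝ} {p : ℝ}
    (h : IntegrableOn (fun x => w x * (Real.exp (-(p * x)) - Real.exp (-x))) (Ioi 0))
    (hw : ∀ x, 0 < x → 0 ≤ w x) :
    IntegrableOn (fun x => w x * |Real.exp (-(p * x)) - Real.exp (-x)|) (Ioi 0) := by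
  refine h.norm.congr ?_
  filter_upwards [ae_restrict_mem measurableSet_Ioi] with x hx
  rw [Real.norm_eq_abs, abs_mul, abs_of_nonneg (hw x hx)]

theorem integral_mul_abs_of_le_one {w : ℝ → ℝ} {p : ℝ} (hp : p ≤ 1) :
    ∫ x in Ioi 0, w x * |Real.exp (-(p * x)) - Real.exp (-x)| =
      ∫ x in Ioi 0, w x * (Real.exp (-(p * x)) - Real.exp (-x)) := by
  refine setIntegral_congr_fun measurableSet_Ioi fun x hx => ?_
  have hx : 0 < x := hx
  rw [abs_of_nonneg (sub_nonneg.2 (Real.exp_le_exp.2 (by nlinarith)))]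

theorem integral_mul_abs_of_one_le {w : ℝ → ℝ} {p : ℝ} (hp : 1 ≤ p) :
    ∫ x in Ioi 0, w x * |Real.exp (-(p * x)) - Real.exp (-x)| =
      -∫ x in Ioi 0, w x * (Real.exp (-(p * x)) - Real.exp (-x)) := by
  rw [← integral_neg]
  refine setIntegral_congr_fun measurableSet_Ioi fun x hx => ?_
  have hx : 0 < x := hx
  rw [abs_of_nonpos (sub_nonpos.2 (Real.exp_le_exp.2 (by nlinarith)))]; ring

namespace IsRegularSolution

theorem hasLaplace_inv_sqrt (hu : IsRegularSolution ε W u) :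
    HasLaplace fun x => x * ((√x)⁻¹ * u x) := by
  intro p hp
  refine (hu.hasLaplace.sqrt_mul p hp).congr_fun (fun x hx => ?_) measurableSet_Ioi
  have hx : 0 < x := hx
  simp only
  rw [← mul_assoc, ← div_eq_mul_inv, Real.div_sqrt]

theorem hasLaplace_inv (hu : IsRegularSolution ε W u) :
    HasLaplace fun x => x * (x⁻¹ * u x) := by
  intro p hp
  refine (hu.hasLaplace p hp).congr_fun (fun x hx => ?_) measurableSet_Ioi
  have hx : 0 < x := hx
  simp only
  rw [← mul_assoc, mul_inv_cancel₀ hx.ne', one_mul]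

theorem integrableOn_increment (hu : IsRegularSolution ε W u) {p : ℝ} (hp : 0 < p) :
    IntegrableOn (fun x => u x * |Real.exp (-(p * x)) - Real.exp (-x)|) (Ioi 0) :=
  integrableOn_mul_abs (integrableOn_mul_exp_sub_exp hu.measurable.aestronglyMeasurable
    hu.hasLaplace.id_mul hp) fun x _ => hu.nonneg x

theorem integrableOn_sqrt_mul_increment (hu : IsRegularSolution ε W u) {p : ℝ} (hp : 0 < p) :
    IntegrableOn (fun x => √x * (u x * |Real.exp (-(p * x)) - Real.exp (-x)|)) (Ioi 0) := by
  have hum := hu.measurable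
  have h := integrableOn_mul_abs (integrableOn_mul_exp_sub_exp (g := fun x => √x * u x)
    (by fun_prop) hu.hasLaplace.sqrt_mul.id_mul hp)
    fun x _ => mul_nonneg (Real.sqrt_nonneg x) (hu.nonneg x)
  simpa only [mul_assoc] using h

theorem integrableOn_inv_sqrt_mul_increment (hu : IsRegularSolution ε W u) {p : ℝ} (hp : 0 < p) :
    IntegrableOn (fun x => (√x)⁻¹ * (u x * |Real.exp (-(p * x)) - Real.exp (-x)|)) (Ioi 0) := by
  have hum := hu.measurable
  have h := integrableOn_mul_abs (integrableOn_mul_exp_sub_exp (g := fun x => (√x)⁻¹ * u x)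
    (by fun_prop) hu.hasLaplace_inv_sqrt hp)
    fun x _ => mul_nonneg (inv_nonneg.2 (Real.sqrt_nonneg x)) (hu.nonneg x)
  simpa only [mul_assoc] using h

theorem integrableOn_id_mul_increment (hu : IsRegularSolution ε W u) {p : ℝ} (hp : 0 < p) :
    IntegrableOn (fun x => x * (u x * |Real.exp (-(p * x)) - Real.exp (-x)|)) (Ioi 0) := by
  have hum := hu.measurable
  have h := integrableOn_mul_abs (integrableOn_mul_exp_sub_exp (g := fun x => x * u x)
    (by fun_prop) hu.hasLaplace.id_mul.id_mul hp)
    fun x hx => mul_nonneg hx.le (hu.nonneg x)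
  simpa only [mul_assoc] using h

theorem integrableOn_inv_mul_increment (hu : IsRegularSolution ε W u) {p : ℝ} (hp : 0 < p) :
    IntegrableOn (fun x => x⁻¹ * (u x * |Real.exp (-(p * x)) - Real.exp (-x)|)) (Ioi 0) := by
  have hum := hu.measurable
  have h := integrableOn_mul_abs (integrableOn_mul_exp_sub_exp (g := fun x => x⁻¹ * u x)
    (by fun_prop) hu.hasLaplace_inv hp)
    fun x hx => mul_nonneg (inv_pos.2 hx).le (hu.nonneg x)
  simpa only [mul_assoc] using h

theorem increment_nonneg (hu : IsRegularSolution ε W u) (p x : ℝ) :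
    0 ≤ u x * |Real.exp (-(p * x)) - Real.exp (-x)| :=
  mul_nonneg (hu.nonneg x) (abs_nonneg _)

theorem integral_increment_of_le_one (hu : IsRegularSolution ε W u) {p : ℝ} (hp : 0 < p)
    (hp1 : p ≤ 1) : ∫ x in Ioi 0, u x * |Real.exp (-(p * x)) - Real.exp (-x)| =
      laplace u p - laplace u 1 := by
  rw [integral_mul_abs_of_le_one hp1, hu.hasLaplace.integral_mul_exp_sub_exp hp]

theorem integral_increment_of_one_le (hu : IsRegularSolution ε W u) {p : ℝ}
    (hp1 : 1 ≤ p) : ∫ x in Ioi 0, u x * |Real.exp (-(p * x)) - Real.exp (-x)| =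
      laplace u 1 - laplace u p := by
  rw [integral_mul_abs_of_one_le hp1,
    hu.hasLaplace.integral_mul_exp_sub_exp (by linarith), neg_sub]

/-- Finiteness of the form is recorded as well, because `remainder` is a `toReal` and would carry no
information at ∞. -/
theorem remainder_le (hW : IsSqrtPerturbation W) (hu : IsRegularSolution ε W u) {p : ℝ}
    (hp : 0 < p) : quadForm W (fun x => u x * |Real.exp (-(p * x)) - Real.exp (-x)|) ≠ ∞ ∧
    remainder W u p ≤
      (∫ x in Ioi 0, √x * (u x * |Real.exp (-(p * x)) - Real.exp (-x)|)) *
        ∫ x in Ioi 0, (√x)⁻¹ * (u x * |Real.exp (-(p * x)) - Real.exp (-x)|) := by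
  have hum := hu.measurable
  have h := hW.quadForm_le (g := fun x => u x * |Real.exp (-(p * x)) - Real.exp (-x)|)
    (by fun_prop) (fun x _ => hu.increment_nonneg p x) (hu.integrableOn_sqrt_mul_increment hp)
    (hu.integrableOn_inv_sqrt_mul_increment hp)
  refine ⟨ne_top_of_le_ne_top ENNReal.ofReal_ne_top h, ?_⟩
  have h1 := ENNReal.toReal_mono ENNReal.ofReal_ne_top h
  rw [ENNReal.toReal_ofReal] at h1
  · rw [remainder]; linarith
  · refine mul_nonneg (mul_nonneg zero_le_two ?_) ?_
    · exact setIntegral_nonneg measurableSet_Ioi fun x _ =>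
        mul_nonneg (Real.sqrt_nonneg x) (hu.increment_nonneg p x)
    · exact setIntegral_nonneg measurableSet_Ioi fun x _ =>
        mul_nonneg (inv_nonneg.2 (Real.sqrt_nonneg x)) (hu.increment_nonneg p x)

/-- The Laplace transformed equation. -/
theorem laplace_equation (hε : 0 ≤ ε) (hW : IsSqrtPerturbation W)
    (hu : IsRegularSolution ε W u) {p : ℝ} (hp : 0 < p) :
    laplace u 1 - laplace u p - (p - 1) * laplaceMoment u p =
      (laplace u 1 - laplace u p) ^ 2 + ε * remainder W u p := by
  have hum := hu.measurable
  set g : ℝ → ℝ := fun x => u x * |Real.exp (-(p * x)) - Real.exp (-x)| with hg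
  have hfin := (hu.remainder_le hW hp).1
  -- For χ(x) = e^{-(p-1)x} the bracket χ(y+z) - χ(y) - χ(z) + 1 equals (χ(y) - 1)(χ(z) - 1), and
  -- e^{-x}(χ(x) - 1) = e^{-px} - e^{-x}. The two increments have the same sign, so absolute values
  -- may be inserted.
  have hd : ∀ x, HasDerivAt (fun x => Real.exp (-((p - 1) * x)))
      (Real.exp (-((p - 1) * x)) * (-((p - 1) * 1))) x := fun x =>
    (((hasDerivAt_id x).const_mul (p - 1)).neg).exp
  have hpos : ∀ x, 0 < x → 0 ≤ x * (Real.exp (-((p - 1) * x)) * (-((p - 1) * 1))) -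
      (Real.exp (-((p - 1) * x)) - 1) := by
    intro x _
    have h1 := Real.add_one_le_exp ((p - 1) * x)
    have h2 : Real.exp (-((p - 1) * x)) * Real.exp ((p - 1) * x) = 1 := by
      rw [← Real.exp_add]; simp
    nlinarith [Real.exp_pos (-((p - 1) * x))]
  have h := hu.two_mul_lintegral_eq hε hW hd (by fun_prop) hpos
  have hexp : ∀ x, Real.exp (-x) * Real.exp (-((p - 1) * x)) = Real.exp (-(p * x)) := by
    intro x; rw [← Real.exp_add]; ring_nf
  have hR : ∫⁻ y in Ioi (0 : ℝ), ∫⁻ z in Ioi (0 : ℝ),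
        ENNReal.ofReal (kernel ε W y z * (u y * Real.exp (-y)) * (u z * Real.exp (-z)) *
          (Real.exp (-((p - 1) * (y + z))) - Real.exp (-((p - 1) * y)) -
            Real.exp (-((p - 1) * z)) + 1)) =
      ∫⁻ y in Ioi (0 : ℝ), ∫⁻ z in Ioi (0 : ℝ), ENNReal.ofReal (kernel ε W y z * g y * g z) := by
    refine setLIntegral_congr_fun measurableSet_Ioi fun y hy => ?_
    refine setLIntegral_congr_fun measurableSet_Ioi fun z hz => ?_
    have hy : 0 < y := hy
    have hz : 0 < z := hz
    have e1 : Real.exp (-((p - 1) * (y + z))) =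
        Real.exp (-((p - 1) * y)) * Real.exp (-((p - 1) * z)) := by
      rw [← Real.exp_add]; ring_nf
    have e2 : |Real.exp (-(p * y)) - Real.exp (-y)| * |Real.exp (-(p * z)) - Real.exp (-z)| =
        (Real.exp (-(p * y)) - Real.exp (-y)) * (Real.exp (-(p * z)) - Real.exp (-z)) := by
      rw [← abs_mul]
      refine abs_of_nonneg ?_
      rcases le_total p 1 with h1 | h1
      · exact mul_nonneg (sub_nonneg.2 (Real.exp_le_exp.2 (by nlinarith)))
          (sub_nonneg.2 (Real.exp_le_exp.2 (by nlinarith)))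
      · exact mul_nonneg_of_nonpos_of_nonpos (sub_nonpos.2 (Real.exp_le_exp.2 (by nlinarith)))
          (sub_nonpos.2 (Real.exp_le_exp.2 (by nlinarith)))
    congr 1
    simp only [hg]
    rw [e1]
    rw [← hexp y, ← hexp z] at e2 ⊢
    linear_combination (-(kernel ε W y z * u y * u z)) * e2
  have hLi : IntegrableOn (fun x => u x * Real.exp (-x) *
      (x * (Real.exp (-((p - 1) * x)) * (-((p - 1) * 1))) -
        (Real.exp (-((p - 1) * x)) - 1))) (Ioi 0) ∧
      ∫ x in Ioi 0, u x * Real.exp (-x) * (x * (Real.exp (-((p - 1) * x)) * (-((p - 1) * 1))) -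
        (Real.exp (-((p - 1) * x)) - 1)) =
      laplace u 1 - laplace u p - (p - 1) * laplaceMoment u p := by
    have i1 := hu.hasLaplace 1 one_pos
    have i2 := hu.hasLaplace p hp
    have i3 := (hu.hasLaplace.id_mul p hp).const_mul (p - 1)
    have e : (fun x => u x * Real.exp (-x) * (x * (Real.exp (-((p - 1) * x)) * (-((p - 1) * 1))) -
        (Real.exp (-((p - 1) * x)) - 1))) = fun x => u x * Real.exp (-(1 * x)) -
          u x * Real.exp (-(p * x)) - (p - 1) * (x * u x * Real.exp (-(p * x))) := by
      ext x; rw [← hexp x, one_mul]; ring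
    rw [e]
    refine ⟨(i1.sub i2).sub i3, ?_⟩
    refine (integral_sub (i1.sub i2) i3).trans ?_
    rw [integral_const_mul]
    congr 1
    exact integral_sub i1 i2
  rw [hR, hW.lintegral_kernel hε (by fun_prop) (fun x _ => hu.increment_nonneg p x)
    (hu.integrableOn_increment hp), ← ofReal_integral_eq_lintegral_ofReal hLi.1, hLi.2] at h
  · have h1 := congrArg ENNReal.toReal h
    have hL0 : 0 ≤ laplace u 1 - laplace u p - (p - 1) * laplaceMoment u p := by
      rw [← hLi.2]
      exact setIntegral_nonneg measurableSet_Ioi fun x hx =>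
        mul_nonneg (mul_nonneg (hu.nonneg x) (Real.exp_pos _).le) (hpos x hx)
    rw [ENNReal.toReal_add ENNReal.ofReal_ne_top (ENNReal.mul_ne_top ENNReal.ofReal_ne_top hfin),
      ENNReal.toReal_mul, ENNReal.toReal_mul, ENNReal.toReal_ofReal hL0,
      ENNReal.toReal_ofReal (by positivity), ENNReal.toReal_ofReal hε] at h1
    have h2 : (∫ x in Ioi 0, g x) ^ 2 = (laplace u 1 - laplace u p) ^ 2 := by
      rcases le_total p 1 with hp1 | hp1
      · rw [hu.integral_increment_of_le_one hp hp1]; ring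
      · rw [hu.integral_increment_of_one_le hp1]
    rw [h2] at h1
    rw [remainder]
    simp only [ENNReal.toReal_ofNat] at h1
    linarith
  · filter_upwards [ae_restrict_mem measurableSet_Ioi] with x hx
    exact mul_nonneg (mul_nonneg (hu.nonneg x) (Real.exp_pos _).le) (hpos x hx)

theorem hasDerivAt_smallPart (hu : IsRegularSolution ε W u) {p : ℝ} (hp : 0 < p) :
    HasDerivAt (smallPart u) (-laplace (fun x => √x * u x) p) p := by
  have hum := hu.measurable
  have h := hasDerivAt_integral_mul_exp_sub_exp (g := fun x => (√x)⁻¹ * u x)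
    (by fun_prop) hu.hasLaplace_inv_sqrt hp
  refine h.congr_deriv ?_
  rw [laplace, laplace]
  congr 1
  refine setIntegral_congr_fun measurableSet_Ioi fun x hx => ?_
  have hx : 0 < x := hx
  rw [← mul_assoc, ← div_eq_mul_inv, Real.div_sqrt]

theorem laplace_sqrt_le (hu : IsRegularSolution ε W u) {p : ℝ} (hp : 0 < p) :
    laplace (fun x => √x * u x) p ≤ √(laplace u p * laplaceMoment u p) := by
  have h := integral_sqrt_mul_le (g := fun x => u x * Real.exp (-(p * x)))
    (fun x _ => mul_nonneg (hu.nonneg x) (Real.exp_pos _).le) (hu.hasLaplace p hp)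
    (by simpa only [mul_assoc] using hu.hasLaplace.id_mul p hp)
    (by simpa only [mul_assoc] using hu.hasLaplace.sqrt_mul p hp)
  simpa only [laplaceMoment, laplace, mul_assoc] using h

/-- Cauchy-Schwarz is applied to the √x factor only. The x^{-1/2} factor is kept as `smallPart`,
whose p-derivative is minus the transform of √x u; it is estimated in `TransformData.S_le` by
integrating from p to 1. -/
theorem remainder_le_of_lt_one (hW : IsSqrtPerturbation W) (hu : IsRegularSolution ε W u) {p : ℝ}
    (hp : 0 < p) (hp1 : p ≤ 1) : remainder W u p ≤
      √((laplace u p - laplace u 1) * laplaceMoment u p) * smallPart u p := by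
  refine (hu.remainder_le hW hp).2.trans ?_
  have e : ∫ x in Ioi 0, (√x)⁻¹ * (u x * |Real.exp (-(p * x)) - Real.exp (-x)|) =
      smallPart u p := by
    rw [smallPart, ← integral_mul_abs_of_le_one hp1]
    simp only [mul_assoc]
  rw [e]
  refine mul_le_mul_of_nonneg_right ?_ ?_
  · refine (integral_sqrt_mul_le (fun x _ => hu.increment_nonneg p x)
      (hu.integrableOn_increment hp) (hu.integrableOn_id_mul_increment hp)
      (hu.integrableOn_sqrt_mul_increment hp)).trans ?_
    rw [hu.integral_increment_of_le_one hp hp1]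
    refine Real.sqrt_le_sqrt (mul_le_mul_of_nonneg_left ?_ ?_)
    · refine setIntegral_mono_on (hu.integrableOn_id_mul_increment hp)
        (hu.hasLaplace.id_mul p hp) measurableSet_Ioi fun x hx => ?_
      have hx : 0 < x := hx
      rw [mul_assoc]
      refine mul_le_mul_of_nonneg_left (mul_le_mul_of_nonneg_left ?_ (hu.nonneg x)) hx.le
      rw [abs_of_nonneg (sub_nonneg.2 (Real.exp_le_exp.2 (by nlinarith)))]
      linarith [Real.exp_pos (-x)]
    · exact sub_nonneg.2 (hu.hasLaplace.laplace_anti (fun x _ => hu.nonneg x) hp hp1)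
  · rw [← e]
    exact setIntegral_nonneg measurableSet_Ioi fun x _ =>
      mul_nonneg (inv_nonneg.2 (Real.sqrt_nonneg x)) (hu.increment_nonneg p x)

/-- Here both factors are treated by Cauchy-Schwarz; the moment of order -1 is harmless because
(e^{-x} - e^{-px})/x ≤ (p-1) e^{-x}. -/
theorem remainder_le_of_one_le (hW : IsSqrtPerturbation W) (hu : IsRegularSolution ε W u) {p : ℝ}
    (hp1 : 1 ≤ p) : remainder W u p ≤
      √((laplace u 1 - laplace u p) * laplaceMoment u 1) *
        √((laplace u 1 - laplace u p) * ((p - 1) * laplace u 1)) := by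
  have hp : 0 < p := by linarith
  have hQ : 0 ≤ laplace u 1 - laplace u p :=
    sub_nonneg.2 (hu.hasLaplace.laplace_anti (fun x _ => hu.nonneg x) one_pos hp1)
  have habs : ∀ x, 0 < x → |Real.exp (-(p * x)) - Real.exp (-x)| =
      Real.exp (-x) - Real.exp (-(p * x)) := fun x hx => by
    rw [abs_of_nonpos (sub_nonpos.2 (Real.exp_le_exp.2 (by nlinarith)))]; ring
  refine (hu.remainder_le hW hp).2.trans (mul_le_mul ?_ ?_ ?_ (Real.sqrt_nonneg _))
  · refine (integral_sqrt_mul_le (fun x _ => hu.increment_nonneg p x)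
      (hu.integrableOn_increment hp) (hu.integrableOn_id_mul_increment hp)
      (hu.integrableOn_sqrt_mul_increment hp)).trans ?_
    rw [hu.integral_increment_of_one_le hp1]
    refine Real.sqrt_le_sqrt (mul_le_mul_of_nonneg_left ?_ hQ)
    refine setIntegral_mono_on (hu.integrableOn_id_mul_increment hp)
      (hu.hasLaplace.id_mul 1 one_pos) measurableSet_Ioi fun x hx => ?_
    have hx : 0 < x := hx
    rw [mul_assoc, habs x hx, one_mul]
    refine mul_le_mul_of_nonneg_left (mul_le_mul_of_nonneg_left ?_ (hu.nonneg x)) hx.le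
    linarith [Real.exp_pos (-(p * x))]
  · refine (integral_inv_sqrt_mul_le (fun x _ => hu.increment_nonneg p x)
      (hu.integrableOn_increment hp) (hu.integrableOn_inv_mul_increment hp)
      (hu.integrableOn_inv_sqrt_mul_increment hp)).trans ?_
    rw [hu.integral_increment_of_one_le hp1]
    refine Real.sqrt_le_sqrt (mul_le_mul_of_nonneg_left ?_ hQ)
    rw [laplace, ← integral_const_mul]
    refine setIntegral_mono_on (hu.integrableOn_inv_mul_increment hp)
      ((hu.hasLaplace 1 one_pos).const_mul _) measurableSet_Ioi fun x hx => ?_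
    have hx : 0 < x := hx
    have h1 := abs_exp_sub_exp_le (p * x) x
    rw [min_eq_right (by nlinarith), show p * x - x = (p - 1) * x by ring,
      abs_of_nonneg (mul_nonneg (by linarith) hx.le)] at h1
    rw [one_mul]
    calc _ ≤ x⁻¹ * (u x * ((p - 1) * x * Real.exp (-x))) := by
          have := hu.nonneg x
          gcongr
      _ = _ := by field_simp
  · exact setIntegral_nonneg measurableSet_Ioi fun x _ =>
      mul_nonneg (inv_nonneg.2 (Real.sqrt_nonneg x)) (hu.increment_nonneg p x)

end IsRegularSolution
end Smoluchowski

/-! ### Moment inequality with polynomial approximations of an exponential weight. -/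

namespace Smoluchowski

variable {ε : ℝ} {W : ℝ → ℝ → ℝ} {u : ℝ → ℝ}

theorem HasLaplace.pow_mul {ω : ℝ → ℝ} (h : HasLaplace ω) {c : ℝ} (hc : 0 ≤ c) (n : ℕ) :
    HasLaplace fun x => (1 + c * x) ^ n * ω x := by
  induction n with
  | zero => simpa using h
  | succ n ih =>
    have := ih.mul_of_le (c := fun x => 1 + c * x) (a := 1) (b := c) (by fun_prop) fun x hx => by
      rw [abs_of_nonneg (by positivity)]
    simpa only [pow_succ', mul_assoc] using this

theorem one_add_pow_sub_one_le {s : ℝ} (hs : 0 ≤ s) (n : ℕ) :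
    (1 + s) ^ (n + 1) - 1 ≤ (n + 1) * s * (1 + s) ^ n := by
  induction n with
  | zero => simp
  | succ n ih =>
    have h1 : (1 + s) ^ (n + 1 + 1) = (1 + s) ^ (n + 1) + s * (1 + s) ^ (n + 1) := by ring
    have h2 : (1 + s) ^ n ≤ (1 + s) ^ (n + 1) := pow_le_pow_right₀ (by linarith) (by omega)
    have h3 : (n + 1) * s * (1 + s) ^ n ≤ (n + 1) * s * (1 + s) ^ (n + 1) := by gcongr
    push_cast
    linarith

/-- The weight `(1 + h x / (n+1))^{n+1}`, a submultiplicative approximation of `e^{hx}`. -/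
noncomputable def expWeight (h : ℝ) (n : ℕ) (x : ℝ) : ℝ := (1 + h / (n + 1) * x) ^ (n + 1)

theorem one_le_expWeight {h x : ℝ} (hh : 0 ≤ h) (hx : 0 ≤ x) (n : ℕ) : 1 ≤ expWeight h n x := by
  refine one_le_pow₀ ?_
  have : 0 ≤ h / (n + 1) * x := by positivity
  linarith

theorem expWeight_add_le {h y z : ℝ} (hh : 0 ≤ h) (hy : 0 ≤ y) (hz : 0 ≤ z) (n : ℕ) :
    expWeight h n (y + z) ≤ expWeight h n y * expWeight h n z := by
  have hc : 0 ≤ h / ((n : ℝ) + 1) := by positivity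
  rw [expWeight, expWeight, expWeight, ← mul_pow]
  refine pow_le_pow_left₀ (by positivity) ?_ _
  nlinarith [mul_nonneg (mul_nonneg hc hy) (mul_nonneg hc hz)]

theorem expWeight_sub_one_le {h x : ℝ} (hh : 0 ≤ h) (hx : 0 ≤ x) (n : ℕ) :
    expWeight h n x - 1 ≤ h * x * (1 + h / (n + 1) * x) ^ n := by
  have hc : 0 ≤ h / ((n : ℝ) + 1) := by positivity
  have := one_add_pow_sub_one_le (mul_nonneg hc hx) n
  have e : ((n : ℝ) + 1) * (h / (n + 1) * x) = h * x := by field_simp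
  rwa [e] at this

theorem pow_le_expWeight {h x : ℝ} (hh : 0 ≤ h) (hx : 0 ≤ x) (n : ℕ) :
    (1 + h / (n + 1) * x) ^ n ≤ expWeight h n x := by
  have hc : 0 ≤ h / ((n : ℝ) + 1) := by positivity
  exact pow_le_pow_right₀ (by nlinarith [mul_nonneg hc hx]) (by omega)

theorem expWeight_le_exp {h x : ℝ} (hh : 0 ≤ h) (hx : 0 ≤ x) (n : ℕ) :
    expWeight h n x ≤ Real.exp (h * x) := by
  have hc : 0 ≤ h / ((n : ℝ) + 1) := by positivity
  have h1 : 1 + h / (n + 1) * x ≤ Real.exp (h / (n + 1) * x) := by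
    rw [add_comm]; exact Real.add_one_le_exp _
  refine (pow_le_pow_left₀ (by positivity) h1 _).trans_eq ?_
  rw [← Real.exp_nat_mul]; congr 1; push_cast; field_simp

theorem measurable_expWeight (h : ℝ) (n : ℕ) : Measurable (expWeight h n) := by
  unfold expWeight; fun_prop

theorem hasDerivAt_expWeight (h : ℝ) (n : ℕ) (x : ℝ) :
    HasDerivAt (expWeight h n) (h * (1 + h / (n + 1) * x) ^ n) x := by
  have := (((hasDerivAt_id x).const_mul (h / ((n : ℝ) + 1))).const_add 1).pow (n + 1)
  refine this.congr_deriv ?_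
  simp only [id, Nat.cast_add, Nat.cast_one, add_tsub_cancel_right]
  field_simp

namespace IsRegularSolution

theorem hasLaplace_expWeight (hu : IsRegularSolution ε W u) {h : ℝ} (hh : 0 ≤ h) (n : ℕ) :
    HasLaplace fun x => expWeight h n x * u x :=
  hu.hasLaplace.pow_mul (by positivity) _

/-- The equation is tested with χ = e^{(1-p)x} w, where w is the weight. Since w is
submultiplicative, so is χ, and the bracket is at most (χ(y) - 1)(χ(z) - 1): the Laplace identity
survives as an inequality. The weight is polynomial, so all integrals are finite a priori, while the
constants do not depend on n. -/
theorem expWeight_moment_le (hε : 0 ≤ ε) (hW : IsSqrtPerturbation W)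
    (hu : IsRegularSolution ε W u) {h p : ℝ} (hh : 0 ≤ h) (hh1 : h ≤ 1) (hp : 0 < p) (hp1 : p ≤ 1)
    (n : ℕ) {Y D : ℝ} (hY : Y = laplace (fun x => expWeight h n x * u x) p - laplace u 1)
    (hD : D = laplaceMoment (fun x => expWeight h n x * u x) p) :
    (1 - p) * D ≤ Y + Y ^ 2 +
      ε * (√(Y * D) * (2 * Real.exp 2 * laplace u 1 + Y)) := by
  have hum := hu.measurable
  have hwm := measurable_expWeight h n
  have hv := hu.hasLaplace_expWeight hh n
  set χ : ℝ → ℝ := fun x => Real.exp ((1 - p) * x) * expWeight h n x with hχ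
  set χ' : ℝ → ℝ := fun x => (1 - p) * χ x +
    Real.exp ((1 - p) * x) * (h * (1 + h / (n + 1) * x) ^ n) with hχ'
  have hd : ∀ x, HasDerivAt χ (χ' x) x := fun x => by
    have h1 : HasDerivAt (fun x => Real.exp ((1 - p) * x))
        (Real.exp ((1 - p) * x) * ((1 - p) * 1)) x := ((hasDerivAt_id x).const_mul (1 - p)).exp
    exact (h1.mul (hasDerivAt_expWeight h n x)).congr_deriv (by simp only [hχ', hχ]; ring)
  have hc' : Continuous χ' := by
    have : Continuous (expWeight h n) := by unfold expWeight; fun_prop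
    simp only [hχ', hχ]; fun_prop
  have hw1 : ∀ x, 0 < x → 1 ≤ expWeight h n x := fun x hx => one_le_expWeight hh hx.le n
  have he1 : ∀ x, 0 < x → 1 ≤ Real.exp ((1 - p) * x) := fun x hx =>
    Real.one_le_exp (mul_nonneg (by linarith) hx.le)
  have hχ1 : ∀ x, 0 < x → 1 ≤ χ x := fun x hx =>
    one_le_mul_of_one_le_of_one_le (he1 x hx) (hw1 x hx)
  have hexpb : ∀ x, Real.exp ((1 - p) * x) - 1 ≤ (1 - p) * x * Real.exp ((1 - p) * x) := by
    intro x
    have h1 := Real.add_one_le_exp (-((1 - p) * x))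
    have h2 : Real.exp (-((1 - p) * x)) * Real.exp ((1 - p) * x) = 1 := by
      rw [← Real.exp_add]; simp
    nlinarith [Real.exp_pos ((1 - p) * x)]
  have hpos : ∀ x, 0 < x → 0 ≤ x * χ' x - (χ x - 1) := by
    intro x hx
    have h1 := hexpb x
    have h2 := expWeight_sub_one_le hh hx.le n
    have h3 := mul_le_mul_of_nonneg_left h2 (Real.exp_pos ((1 - p) * x)).le
    have h4 : (1 - p) * x * Real.exp ((1 - p) * x) ≤
        (1 - p) * x * Real.exp ((1 - p) * x) * expWeight h n x :=
      le_mul_of_one_le_right (mul_nonneg (mul_nonneg (by linarith) hx.le)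
        (Real.exp_pos _).le) (hw1 x hx)
    simp only [hχ', hχ]
    nlinarith
  have key := hu.two_mul_lintegral_eq hε hW hd hc' hpos
  set g : ℝ → ℝ := fun x => u x * Real.exp (-x) * (χ x - 1) with hg
  have hexp : ∀ x, Real.exp (-x) * Real.exp ((1 - p) * x) = Real.exp (-(p * x)) := by
    intro x; rw [← Real.exp_add]; ring_nf
  have hge : g = fun x => expWeight h n x * u x * Real.exp (-(p * x)) -
      u x * Real.exp (-(1 * x)) := by
    ext x; simp only [hg, hχ]; rw [← hexp x, one_mul]; ring
  have hgm : Measurable g := by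
    rw [hge]; fun_prop
  have hg0 : ∀ x, 0 < x → 0 ≤ g x := fun x hx =>
    mul_nonneg (mul_nonneg (hu.nonneg x) (Real.exp_pos _).le) (sub_nonneg.2 (hχ1 x hx))
  have hgi : IntegrableOn g (Ioi 0) := by
    rw [hge]; exact (hv p hp).sub (hu.hasLaplace 1 one_pos)
  have hgI : ∫ x in Ioi 0, g x = Y := by
    rw [hge, hY]; exact integral_sub (hv p hp) (hu.hasLaplace 1 one_pos)
  have hgle : ∀ x, 0 < x → g x ≤ expWeight h n x * u x * Real.exp (-(p * x)) := by
    intro x _; rw [hge]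
    have := mul_nonneg (hu.nonneg x) (Real.exp_pos (-(1 * x))).le
    simp only; linarith
  have hgx : IntegrableOn (fun x => x * g x) (Ioi 0) := by
    refine (hv.id_mul p hp).mono' (by fun_prop) ?_
    filter_upwards [ae_restrict_mem measurableSet_Ioi] with x hx
    have hx : 0 < x := hx
    rw [Real.norm_of_nonneg (mul_nonneg hx.le (hg0 x hx)), mul_assoc]
    exact mul_le_mul_of_nonneg_left (hgle x hx) hx.le
  have hgxI : ∫ x in Ioi 0, x * g x ≤ D := by
    rw [hD, laplaceMoment, laplace]
    refine setIntegral_mono_on hgx (hv.id_mul p hp) measurableSet_Ioi fun x hx => ?_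
    rw [mul_assoc]
    exact mul_le_mul_of_nonneg_left (hgle x hx) (le_of_lt hx)
  have hgs : IntegrableOn (fun x => √x * g x) (Ioi 0) := by
    refine (hgi.add hgx).mono' (by fun_prop) ?_
    filter_upwards [ae_restrict_mem measurableSet_Ioi] with x hx
    have hx : 0 < x := hx
    rw [Real.norm_of_nonneg (mul_nonneg (Real.sqrt_nonneg x) (hg0 x hx))]
    have := mul_le_mul_of_nonneg_right (sqrt_le_one_add hx) (hg0 x hx)
    simp only [Pi.add_apply]; linarith
  have hgsI : ∫ x in Ioi 0, √x * g x ≤ √(Y * D) := by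
    refine (integral_sqrt_mul_le hg0 hgi hgx hgs).trans ?_
    rw [hgI]
    refine Real.sqrt_le_sqrt (mul_le_mul_of_nonneg_left hgxI ?_)
    rw [← hgI]; exact setIntegral_nonneg measurableSet_Ioi hg0
  -- For x ≤ 1 both factors of χ are at most e, whence χ' ≤ 2e² and χ - 1 ≤ x χ' ≤ 2e² x; for x ≥ 1
  -- simply x^{-1/2} ≤ 1.
  have hchi_le : ∀ x, 0 < x → (√x)⁻¹ * g x ≤
      2 * Real.exp 2 * (u x * Real.exp (-(1 * x))) + g x := by
    intro x hx
    have hf : 0 ≤ u x * Real.exp (-x) := mul_nonneg (hu.nonneg x) (Real.exp_pos _).le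
    have hs : 0 < √x := Real.sqrt_pos.2 hx
    have hmain : (√x)⁻¹ * (χ x - 1) ≤ 2 * Real.exp 2 + (χ x - 1) := by
      rcases le_total x 1 with hx1 | hx1
      · have h1 := hpos x hx
        have h2 := pow_le_expWeight hh hx.le n
        have h3 : expWeight h n x ≤ Real.exp 1 := (expWeight_le_exp hh hx.le n).trans
          (Real.exp_le_exp.2 (by nlinarith))
        have h4 : Real.exp ((1 - p) * x) ≤ Real.exp 1 := Real.exp_le_exp.2 (by nlinarith)
        have h5 : χ x ≤ Real.exp 2 := by
          rw [show (2:ℝ) = 1 + 1 by norm_num, Real.exp_add]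
          exact mul_le_mul h4 h3 (by linarith [hw1 x hx]) (Real.exp_pos _).le
        have h6 : χ' x ≤ 2 * Real.exp 2 := by
          have h7 : Real.exp ((1 - p) * x) * (h * (1 + h / (n + 1) * x) ^ n) ≤ χ x := by
            refine mul_le_mul_of_nonneg_left ?_ (Real.exp_pos _).le
            have : 0 ≤ (1 + h / ((n:ℝ) + 1) * x) ^ n := by positivity
            nlinarith
          have h8 : (1 - p) * χ x ≤ χ x := by nlinarith [hχ1 x hx]
          simp only [hχ']; linarith
        have h9 : χ x - 1 ≤ x * (2 * Real.exp 2) := by nlinarith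
        have h10 : (√x)⁻¹ * (χ x - 1) ≤ √x * (2 * Real.exp 2) := by
          have := mul_le_mul_of_nonneg_left h9 (inv_pos.2 hs).le
          rwa [← mul_assoc, inv_mul_eq_div, inv_mul_eq_div, Real.div_sqrt, ← inv_mul_eq_div] at this
        have h11 : √x ≤ 1 := Real.sqrt_le_one.2 hx1
        nlinarith [Real.exp_pos 2, hχ1 x hx]
      · have h1 : (√x)⁻¹ ≤ 1 := inv_le_one_of_one_le₀ (Real.one_le_sqrt.2 hx1)
        nlinarith [Real.exp_pos 2, hχ1 x hx]
    have := mul_le_mul_of_nonneg_left hmain hf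
    simp only [hg, one_mul]; linarith
  have hgm' : IntegrableOn (fun x => (√x)⁻¹ * g x) (Ioi 0) := by
    refine (((hu.hasLaplace 1 one_pos).const_mul (2 * Real.exp 2)).add hgi).mono'
      (by fun_prop) ?_
    filter_upwards [ae_restrict_mem measurableSet_Ioi] with x hx
    rw [Real.norm_of_nonneg (mul_nonneg (inv_nonneg.2 (Real.sqrt_nonneg x)) (hg0 x hx))]
    exact hchi_le x hx
  have hgmI : ∫ x in Ioi 0, (√x)⁻¹ * g x ≤ 2 * Real.exp 2 * laplace u 1 + Y := by
    have h1 := setIntegral_mono_on hgm'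
      (((hu.hasLaplace 1 one_pos).const_mul (2 * Real.exp 2)).add hgi) measurableSet_Ioi
      fun x hx => hchi_le x hx
    refine h1.trans_eq ?_
    refine (integral_add ((hu.hasLaplace 1 one_pos).const_mul (2 * Real.exp 2)) hgi).trans ?_
    rw [integral_const_mul, hgI]; rfl
  have hR : ∫⁻ y in Ioi (0 : ℝ), ∫⁻ z in Ioi (0 : ℝ),
        ENNReal.ofReal (kernel ε W y z * (u y * Real.exp (-y)) * (u z * Real.exp (-z)) *
          (χ (y + z) - χ y - χ z + 1)) ≤
      ∫⁻ y in Ioi (0 : ℝ), ∫⁻ z in Ioi (0 : ℝ), ENNReal.ofReal (kernel ε W y z * g y * g z) := by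
    refine setLIntegral_mono' measurableSet_Ioi fun y hy => ?_
    refine setLIntegral_mono' measurableSet_Ioi fun z hz => ?_
    have hy : 0 < y := hy
    have hz : 0 < z := hz
    refine ENNReal.ofReal_le_ofReal ?_
    have h1 : χ (y + z) ≤ χ y * χ z := by
      have e1 : Real.exp ((1 - p) * (y + z)) =
          Real.exp ((1 - p) * y) * Real.exp ((1 - p) * z) := by
        rw [← Real.exp_add]; ring_nf
      simp only [hχ]
      rw [e1]
      have := mul_le_mul_of_nonneg_left (expWeight_add_le hh hy.le hz.le n)
        (mul_pos (Real.exp_pos ((1 - p) * y)) (Real.exp_pos ((1 - p) * z))).le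
      linarith
    have hK : 0 ≤ kernel ε W y z := by
      have := mul_nonneg hε (hW.nonneg y z); unfold kernel; linarith
    have h2 : 0 ≤ kernel ε W y z * (u y * Real.exp (-y)) * (u z * Real.exp (-z)) :=
      mul_nonneg (mul_nonneg hK (mul_nonneg (hu.nonneg y) (Real.exp_pos _).le))
        (mul_nonneg (hu.nonneg z) (Real.exp_pos _).le)
    have h3 := mul_le_mul_of_nonneg_left h1 h2
    simp only [hg]
    linarith
  have hpow := hu.hasLaplace.pow_mul (c := h / ((n : ℝ) + 1)) (by positivity) n
  -- Left-hand side of the tested equation. The term with factor h comes from differentiating the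
  -- weight; it is non-negative and is dropped at the end.
  set I : ℝ := (1 - p) * D + h * laplace (fun x => x * ((1 + h / ((n : ℝ) + 1) * x) ^ n * u x)) p
    - Y with hI
  have hLe : (fun x => u x * Real.exp (-x) * (x * χ' x - (χ x - 1))) = fun x =>
      (1 - p) * (x * (expWeight h n x * u x) * Real.exp (-(p * x))) +
      h * (x * ((1 + h / ((n : ℝ) + 1) * x) ^ n * u x) * Real.exp (-(p * x))) - g x := by
    ext x
    simp only [hg, hχ', hχ]
    rw [← hexp x]; ring
  have j1 := (hv.id_mul p hp).const_mul (1 - p)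
  have j2 := (hpow.id_mul p hp).const_mul h
  have hLi : IntegrableOn (fun x => u x * Real.exp (-x) * (x * χ' x - (χ x - 1))) (Ioi 0) := by
    rw [hLe]; exact (j1.add j2).sub hgi
  have hLI : ∫ x in Ioi 0, u x * Real.exp (-x) * (x * χ' x - (χ x - 1)) = I := by
    rw [hLe]
    refine (integral_sub (j1.add j2) hgi).trans ?_
    rw [hgI, hI]
    congr 1
    refine (integral_add j1 j2).trans ?_
    rw [integral_const_mul, integral_const_mul, hD]; rfl
  rw [← ofReal_integral_eq_lintegral_ofReal hLi, hLI] at key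
  swap
  · filter_upwards [ae_restrict_mem measurableSet_Ioi] with x hx
    exact mul_nonneg (mul_nonneg (hu.nonneg x) (Real.exp_pos _).le) (hpos x hx)
  have hfin := key.trans_le hR
  rw [hW.lintegral_kernel hε hgm hg0 hgi, hgI] at hfin
  set a := ∫ x in Ioi 0, √x * g x with ha
  set b := ∫ x in Ioi 0, (√x)⁻¹ * g x with hb
  have ha0 : 0 ≤ a := setIntegral_nonneg measurableSet_Ioi fun x hx =>
    mul_nonneg (Real.sqrt_nonneg x) (hg0 x hx)
  have hb0 : 0 ≤ b := setIntegral_nonneg measurableSet_Ioi fun x hx =>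
    mul_nonneg (inv_nonneg.2 (Real.sqrt_nonneg x)) (hg0 x hx)
  have hfin2 : ENNReal.ofReal (2 * I) ≤ ENNReal.ofReal (2 * Y ^ 2 + ε * (2 * a * b)) := by
    rw [ENNReal.ofReal_add (by positivity) (by positivity), ENNReal.ofReal_mul (by norm_num),
      ENNReal.ofReal_mul hε]
    have := hW.quadForm_le hgm hg0 hgs hgm'
    simp only [ENNReal.ofReal_ofNat]
    exact hfin.trans (by gcongr)
  rw [ENNReal.ofReal_le_ofReal_iff (by positivity)] at hfin2
  have h1 : 0 ≤ laplace (fun x => x * ((1 + h / ((n : ℝ) + 1) * x) ^ n * u x)) p :=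
    laplace_nonneg (fun x hx => mul_nonneg hx.le (mul_nonneg (by positivity) (hu.nonneg x))) p
  have h2 : a * b ≤ √(Y * D) * (2 * Real.exp 2 * laplace u 1 + Y) :=
    mul_le_mul hgsI hgmI hb0 (Real.sqrt_nonneg _)
  have h3 := mul_le_mul_of_nonneg_left h2 hε
  have h4 := mul_nonneg hh h1
  linarith

end IsRegularSolution
end Smoluchowski

/-! ### Blow-up of the Laplace transform at the origin. -/

namespace Smoluchowski

variable {ε : ℝ} {W : ℝ → ℝ → ℝ} {u : ℝ → ℝ}

namespace IsRegularSolution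

theorem continuousOn_expWeight_laplace (hu : IsRegularSolution ε W u) {p : ℝ} (hp : 0 < p)
    (n : ℕ) : ContinuousOn (fun h => laplace (fun x => expWeight h n x * u x) p) (Icc 0 1) := by
  have hum := hu.measurable
  refine continuousOn_of_dominated
    (bound := fun x => expWeight 1 n x * u x * Real.exp (-(p * x))) ?_ ?_
    (hu.hasLaplace_expWeight zero_le_one n p hp) ?_
  · intro h _
    have := measurable_expWeight h n
    exact (by fun_prop : Measurable fun x => expWeight h n x * u x *
      Real.exp (-(p * x))).aestronglyMeasurable
  · intro h hh
    filter_upwards [ae_restrict_mem measurableSet_Ioi] with x hx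
    have hx : 0 < x := hx
    have h0 : 0 ≤ expWeight h n x := zero_le_one.trans (one_le_expWeight hh.1 hx.le n)
    rw [Real.norm_of_nonneg (mul_nonneg (mul_nonneg h0 (hu.nonneg x)) (Real.exp_pos _).le)]
    refine mul_le_mul_of_nonneg_right (mul_le_mul_of_nonneg_right ?_ (hu.nonneg x))
      (Real.exp_pos _).le
    have h1 := hh.1
    have h2 := hh.2
    unfold expWeight
    gcongr
  · refine Eventually.of_forall fun x => ?_
    unfold expWeight
    fun_prop

/-- If the Laplace transform were bounded near `0`, it would extend to some negative arguments. -/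
theorem exists_expWeight_bound (hε : 0 ≤ ε) (hW : IsSqrtPerturbation W)
    (hu : IsRegularSolution ε W u) {A : ℝ} (hA0 : 0 < A)
    (hA : ∀ p, 0 < p → p < 1 → laplace u p ≤ A) :
    ∃ h : ℝ, 0 < h ∧ ∀ p, 0 < p → p ≤ 1 / 2 → ∀ n : ℕ,
      laplace (fun x => expWeight h n x * u x) p ≤ 3 * A := by
  set N := laplace u 1 with hN
  have hN0 : 0 ≤ N := laplace_nonneg (fun x _ => hu.nonneg x) 1
  have hNA : N ≤ A := (hu.hasLaplace.laplace_anti (fun x _ => hu.nonneg x)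
    (by norm_num : (0:ℝ) < 1 / 2) (by norm_num)).trans (hA _ (by norm_num) (by norm_num))
  set b : ℝ := ε * (2 * Real.exp 2 * N + 2 * A) * √(2 * A) with hb
  set M : ℝ := 4 * (2 * A + 4 * A ^ 2 + b ^ 2) with hM
  have hM0 : 0 < M := by positivity
  -- As long as the weighted increment Y is at most 2A, the moment inequality gives D/2 ≤ 2A + 4A² +
  -- b√D, and b√D ≤ D/4 + b². Hence D ≤ M uniformly in h, p and n.
  have hDM : ∀ h p, 0 ≤ h → h ≤ 1 → 0 < p → p ≤ 1 / 2 → ∀ n,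
      laplace (fun x => expWeight h n x * u x) p - N ≤ 2 * A →
      laplaceMoment (fun x => expWeight h n x * u x) p ≤ M := by
    intro h p hh hh1 hp hp1 n hY
    have hw0 : ∀ x, 0 < x → 0 ≤ expWeight h n x * u x := fun x hx =>
      mul_nonneg (zero_le_one.trans (one_le_expWeight hh hx.le n)) (hu.nonneg x)
    have key := hu.expWeight_moment_le hε hW hh hh1 hp (by linarith) n rfl rfl
    set Y := laplace (fun x => expWeight h n x * u x) p - laplace u 1 with hYd
    set D := laplaceMoment (fun x => expWeight h n x * u x) p
    have hD0 : 0 ≤ D := laplace_nonneg (fun x hx => mul_nonneg hx.le (hw0 x hx)) p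
    have hY0 : 0 ≤ Y := by
      have h1 : laplace u p ≤ laplace (fun x => expWeight h n x * u x) p := by
        refine setIntegral_mono_on (hu.hasLaplace p hp) (hu.hasLaplace_expWeight hh n p hp)
          measurableSet_Ioi fun x hx => ?_
        refine mul_le_mul_of_nonneg_right ?_ (Real.exp_pos _).le
        exact le_mul_of_one_le_left (hu.nonneg x) (one_le_expWeight hh (le_of_lt hx) n)
      have h2 := hu.hasLaplace.laplace_anti (fun x _ => hu.nonneg x) hp
        (by linarith : p ≤ 1)
      linarith
    have hs : √(Y * D) ≤ √(2 * A) * √D := by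
      rw [← Real.sqrt_mul (by positivity)]
      exact Real.sqrt_le_sqrt (mul_le_mul_of_nonneg_right hY hD0)
    have h1 : √(Y * D) * (2 * Real.exp 2 * N + Y) ≤
        √(2 * A) * √D * (2 * Real.exp 2 * N + 2 * A) := by gcongr
    have h2 := mul_le_mul_of_nonneg_left h1 hε
    have h3 : ε * (√(2 * A) * √D * (2 * Real.exp 2 * N + 2 * A)) = b * √D := by
      rw [hb]; ring
    have h4 : b * √D ≤ D / 4 + b ^ 2 := by
      nlinarith [Real.sq_sqrt hD0, sq_nonneg (√D / 2 - b)]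
    have h5 : Y ^ 2 ≤ 4 * A ^ 2 := by nlinarith
    have h6 : D / 2 ≤ (1 - p) * D := by nlinarith
    rw [hM]; linarith
  -- Continuity argument in h: the weighted transform exceeds U(p) by at most h D, hence by at most
  -- A/2 while D ≤ M. The value Y = 2A thus cannot be reached for h ≤ A/(2M), although a violation
  -- of the claim would force it by the intermediate value theorem.
  refine ⟨min 1 (A / (2 * M)), by positivity, fun p hp hp1 n => ?_⟩
  set h₀ := min 1 (A / (2 * M)) with hh₀
  have hh₀0 : 0 < h₀ := by positivity
  have hh₀1 : h₀ ≤ 1 := min_le_left _ _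
  by_contra! hcon
  have hgrow : ∀ h, 0 ≤ h → laplace (fun x => expWeight h n x * u x) p - laplace u p ≤
      h * laplaceMoment (fun x => expWeight h n x * u x) p := by
    intro h hh
    have hv := hu.hasLaplace_expWeight hh n
    rw [laplaceMoment, laplace, laplace, laplace, ← integral_sub (hv p hp) (hu.hasLaplace p hp),
      ← integral_const_mul]
    refine setIntegral_mono_on ((hv p hp).sub (hu.hasLaplace p hp))
      ((hv.id_mul p hp).const_mul h) measurableSet_Ioi fun x hx => ?_
    have hx : 0 < x := hx
    have h1 := expWeight_sub_one_le hh hx.le n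
    have h2 := mul_le_mul_of_nonneg_left (pow_le_expWeight hh hx.le n) (mul_nonneg hh hx.le)
    have h3 := mul_le_mul_of_nonneg_right (h1.trans h2)
      (mul_nonneg (hu.nonneg x) (Real.exp_pos (-(p * x))).le)
    linarith
  have hcont : ContinuousOn (fun h => laplace (fun x => expWeight h n x * u x) p - N)
      (Icc 0 h₀) := ((hu.continuousOn_expWeight_laplace hp n).mono
        (Icc_subset_Icc_right hh₀1)).sub continuousOn_const
  have hzero : laplace (fun x => expWeight 0 n x * u x) p - N ≤ 2 * A := by
    have : (fun x => expWeight 0 n x * u x) = u := by ext x; simp [expWeight]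
    rw [this]
    have := hA p hp (by linarith)
    linarith
  obtain ⟨h, hh, hheq⟩ := intermediate_value_Icc hh₀0.le hcont
    (show 2 * A ∈ _ from ⟨hzero, by
      change 2 * A ≤ laplace (fun x => expWeight h₀ n x * u x) p - N
      linarith⟩)
  simp only at hheq
  have h1 := hDM h p hh.1 (hh.2.trans hh₀1) hp hp1 n hheq.le
  have h2 := hgrow h hh.1
  have h3 := hA p hp (by linarith)
  have h4 : h * laplaceMoment (fun x => expWeight h n x * u x) p ≤ A / (2 * M) * M :=
    mul_le_mul (hh.2.trans (min_le_right _ _)) h1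
      (laplace_nonneg (fun x hx => mul_nonneg hx.le (mul_nonneg
        (zero_le_one.trans (one_le_expWeight hh.1 hx.le n)) (hu.nonneg x))) p) (by positivity)
  have h5 : A / (2 * M) * M = A / 2 := by field_simp
  linarith

theorem tendsto_expWeight (h x : ℝ) :
    Tendsto (fun n : ℕ => expWeight h n x) atTop (𝓝 (Real.exp (h * x))) := by
  have h1 := (Real.tendsto_one_add_div_pow_exp (h * x)).comp (tendsto_add_atTop_nat 1)
  refine h1.congr fun n => ?_
  simp only [Function.comp, expWeight, Nat.cast_add, Nat.cast_one]
  congr 2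
  ring

/-- The Laplace transform blows up at `0`. -/
theorem exists_lt_laplace (hε : 0 ≤ ε) (hW : IsSqrtPerturbation W)
    (hu : IsRegularSolution ε W u) (A : ℝ) : ∃ p, 0 < p ∧ p < 1 ∧ A < laplace u p := by
  by_contra! hcon
  have hum := hu.measurable
  obtain ⟨h, hh, hbd⟩ := hu.exists_expWeight_bound hε hW (A := max A 1) (by positivity)
    fun p hp hp1 => (hcon p hp hp1).trans (le_max_left _ _)
  set B := 3 * max A 1
  obtain ⟨X, hX, hlow⟩ := hu.lower h hh
  -- The Laplace variable tends to 0 along the same index as the weight tends to e^{hx}, so one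
  -- application of Fatou bounds the integral of e^{hx} u.
  set P : ℕ → ℝ := fun n => 1 / ((n : ℝ) + 2) with hP
  have hP0 : ∀ n, 0 < P n := fun n => by simp only [hP]; positivity
  have hP1 : ∀ n, P n ≤ 1 / 2 := fun n => by
    simp only [hP]; exact one_div_le_one_div_of_le two_pos (by linarith [n.cast_nonneg (α := ℝ)])
  have hPt : Tendsto P atTop (𝓝 0) := by
    have := (tendsto_const_div_atTop_nhds_zero_nat (1 : ℝ)).comp (tendsto_add_atTop_nat 2)
    refine this.congr fun n => ?_
    simp [hP]
  set F : ℕ → ℝ → ℝ≥0∞ := fun n x =>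
    ENNReal.ofReal (expWeight h n x * u x * Real.exp (-(P n * x))) with hF
  have hFm : ∀ n, Measurable (F n) := fun n => by
    have := measurable_expWeight h n
    simp only [hF]; fun_prop
  have hFle : ∀ n, ∫⁻ x in Ioi (0 : ℝ), F n x ≤ ENNReal.ofReal B := by
    intro n
    have := ofReal_integral_eq_lintegral_ofReal (hu.hasLaplace_expWeight hh.le n (P n) (hP0 n)) ?_
    · simp only [hF]
      rw [← this]
      exact ENNReal.ofReal_le_ofReal (hbd (P n) (hP0 n) (hP1 n) n)
    · filter_upwards [ae_restrict_mem measurableSet_Ioi] with x hx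
      exact mul_nonneg (mul_nonneg (zero_le_one.trans (one_le_expWeight hh.le (le_of_lt hx) n))
        (hu.nonneg x)) (Real.exp_pos _).le
  have hlim : ∀ x, Tendsto (fun n => F n x) atTop (𝓝 (ENNReal.ofReal (Real.exp (h * x) * u x))) := by
    intro x
    refine ENNReal.tendsto_ofReal ?_
    have h1 : Tendsto (fun n => Real.exp (-(P n * x))) atTop (𝓝 1) := by
      have := (Real.continuous_exp.tendsto _).comp ((hPt.mul_const x).neg)
      simp only [zero_mul, neg_zero, Real.exp_zero] at this
      exact this
    simpa using ((tendsto_expWeight h x).mul_const (u x)).mul h1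
  have hfatou : ∫⁻ x in Ioi (0 : ℝ), ENNReal.ofReal (Real.exp (h * x) * u x) ≤
      ENNReal.ofReal B := by
    have h1 := lintegral_liminf_le (μ := volume.restrict (Ioi (0:ℝ))) (u := atTop) hFm
    simp only [fun x => (hlim x).liminf_eq] at h1
    exact h1.trans (liminf_le_of_le (by isBoundedDefault) fun b hb => by
      obtain ⟨n, hn⟩ := hb.exists
      exact hn.trans (hFle n))
  -- The normalisation gives u ≥ e^{-hx} beyond X, so the integrand is at least 1 on a half-line.
  have hinf : ∫⁻ x in Ioi (0 : ℝ), ENNReal.ofReal (Real.exp (h * x) * u x) = ∞ := by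
    refine top_le_iff.1 ?_
    have h1 : ∫⁻ _ in Ioi X, (1 : ℝ≥0∞) = ∞ := by simp
    rw [← h1]
    refine (lintegral_mono_ae ?_).trans (lintegral_mono_set (Ioi_subset_Ioi hX.le))
    filter_upwards [ae_restrict_mem measurableSet_Ioi, ae_restrict_of_ae hlow] with x hx hx'
    have h2 := hx' hx
    rw [← ENNReal.ofReal_one]
    refine ENNReal.ofReal_le_ofReal ?_
    have h3 : Real.exp (h * x) * Real.exp (-(h * x)) = 1 := by rw [← Real.exp_add]; simp
    rw [← h3]
    exact mul_le_mul_of_nonneg_left h2 (Real.exp_pos _).le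
  rw [hinf] at hfatou
  exact ENNReal.ofReal_ne_top (top_le_iff.1 hfatou)

end IsRegularSolution
end Smoluchowski

/-! ### The Riccati equation: remainder bounds in terms of U. -/

namespace Smoluchowski

/-- The analytic properties of the Laplace transform `U` of a rescaled solution, together with
`D = -U'`, the remainder `R` in the transformed equation, and the auxiliary transforms `B`, `S`
with `S' = -B` that control `R` on `(0, 1)`. -/
structure TransformData (ε : ℝ) (U D B S R : ℝ → ℝ) : Prop where
  hasDerivAt : ∀ p, 0 < p → HasDerivAt U (-D p) p
  D_pos : ∀ p, 0 < p → 0 < D p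
  U_nonneg : ∀ p, 0 < p → 0 ≤ U p
  tendsto_U : Tendsto U atTop (𝓝 0)
  unbounded : ∀ A, ∃ p, 0 < p ∧ p < 1 ∧ A < U p
  B_le : ∀ p, 0 < p → B p ≤ √(U p * D p)
  hasDerivAt_S : ∀ p, 0 < p → HasDerivAt S (-B p) p
  S_one : S 1 = 0
  R_nonneg : ∀ p, 0 ≤ R p
  R_mono : ∀ p q, 1 ≤ p → p ≤ q → R p ≤ R q
  R_le_of_le_one : ∀ p, 0 < p → p ≤ 1 → R p ≤ √((U p - U 1) * D p) * S p
  R_le_of_one_le : ∀ p, 1 ≤ p → R p ≤ √((U 1 - U p) * D 1) * √((U 1 - U p) * ((p - 1) * U 1))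
  equation : ∀ p, 0 < p → U 1 - U p - (p - 1) * D p = (U 1 - U p) ^ 2 + ε * R p

theorem le_of_hasDerivAt_nonneg {f f' : ℝ → ℝ} {a b : ℝ} (hab : a ≤ b)
    (hc : ContinuousOn f (Icc a b)) (hd : ∀ x ∈ Ioo a b, HasDerivAt f (f' x) x)
    (h0 : ∀ x ∈ Ioo a b, 0 ≤ f' x) : f a ≤ f b := by
  refine monotoneOn_of_hasDerivWithinAt_nonneg (convex_Icc a b) hc (f' := f') ?_ ?_
    (left_mem_Icc.2 hab) (right_mem_Icc.2 hab) hab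
  · rw [interior_Icc]; exact fun x hx => (hd x hx).hasDerivWithinAt
  · rw [interior_Icc]; exact h0

namespace TransformData

variable {ε : ℝ} {U D B S R : ℝ → ℝ}

theorem continuousOn (h : TransformData ε U D B S R) : ContinuousOn U (Ioi 0) :=
  fun p hp => (h.hasDerivAt p hp).continuousAt.continuousWithinAt

theorem strictAnti (h : TransformData ε U D B S R) {p q : ℝ} (hp : 0 < p) (hpq : p < q) :
    U q < U p := by
  refine strictAntiOn_of_deriv_neg (convex_Ioi 0) h.continuousOn ?_ hp (hp.trans hpq) hpq
  rw [interior_Ioi]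
  intro x hx
  rw [(h.hasDerivAt x hx).deriv]
  linarith [h.D_pos x hx]

theorem anti (h : TransformData ε U D B S R) {p q : ℝ} (hp : 0 < p) (hpq : p ≤ q) :
    U q ≤ U p := by
  rcases hpq.eq_or_lt with rfl | hlt
  · exact le_rfl
  · exact (h.strictAnti hp hlt).le

/-- Dropping non-negative terms from the equation leaves Q² ≤ Q for Q = U(1) - U(p). Letting p → ∞
then bounds U(1) by 1. -/
theorem sub_le_one (hε : 0 ≤ ε) (h : TransformData ε U D B S R) {p : ℝ} (hp : 1 ≤ p) :
    U 1 - U p ≤ 1 := by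
  have h1 := h.equation p (by linarith)
  have h2 := mul_nonneg hε (h.R_nonneg p)
  have h3 := mul_nonneg (sub_nonneg.2 hp) (h.D_pos p (by linarith)).le
  nlinarith

theorem U_one_le (hε : 0 ≤ ε) (h : TransformData ε U D B S R) : U 1 ≤ 1 := by
  have h1 : Tendsto (fun p => U 1 - U p) atTop (𝓝 (U 1)) := by
    simpa using h.tendsto_U.const_sub (U 1)
  refine le_of_tendsto h1 ?_
  filter_upwards [eventually_ge_atTop 1] with p hp using h.sub_le_one hε hp

/-- S(p) is the integral of B ≤ √(U D) over (p, 1). With Y = U - U(1), the equation gives Y(1+Y) ≤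
(1-s) D, and U ≤ 1 + Y since U(1) ≤ 1; hence U Y ≤ (1-p) D and B ≤ √(1-p) D/√Y. The last expression
is the exact derivative of -2 √(1-p) √Y. -/
theorem S_le (hε : 0 ≤ ε) (h : TransformData ε U D B S R) {p : ℝ} (hp : 0 < p) (hp1 : p < 1) :
    S p ≤ 2 * √(1 - p) * √(U p - U 1) := by
  have hcU : ContinuousOn U (Icc p 1) := h.continuousOn.mono fun x hx => hp.trans_le hx.1
  have hcS : ContinuousOn S (Icc p 1) := fun x hx =>
    (h.hasDerivAt_S x (hp.trans_le hx.1)).continuousAt.continuousWithinAt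
  have key := le_of_hasDerivAt_nonneg (f := fun s => S s - 2 * √(1 - p) * √(U s - U 1))
    (f' := fun s => -B s - 2 * √(1 - p) * (-D s / (2 * √(U s - U 1)))) hp1.le
    (hcS.sub (continuousOn_const.mul (hcU.sub continuousOn_const).sqrt)) ?_ ?_
  · simp only [sub_self, Real.sqrt_zero, mul_zero, h.S_one] at key
    linarith
  · intro s hs
    have hs0 : 0 < s := hp.trans hs.1
    have hY : 0 < U s - U 1 := sub_pos.2 (h.strictAnti hs0 hs.2)
    exact (h.hasDerivAt_S s hs0).sub
      ((((h.hasDerivAt s hs0).sub_const (U 1)).sqrt hY.ne').const_mul _)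
  · intro s hs
    have hs0 : 0 < s := hp.trans hs.1
    have hY : 0 < U s - U 1 := sub_pos.2 (h.strictAnti hs0 hs.2)
    have hD := h.D_pos s hs0
    have hN := h.U_one_le hε
    set Y := U s - U 1 with hYdef
    have h1 : Y * (1 + Y) ≤ (1 - s) * D s := by
      have := h.equation s hs0
      have h2 := mul_nonneg hε (h.R_nonneg s)
      have e : U 1 - U s = -Y := by rw [hYdef]; ring
      rw [e] at this; nlinarith
    have h2 : B s * √Y ≤ √(1 - p) * D s := by
      refine (mul_le_mul_of_nonneg_right (h.B_le s hs0) (Real.sqrt_nonneg _)).trans ?_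
      rw [← Real.sqrt_mul (mul_nonneg (h.U_nonneg s hs0) hD.le)]
      have h3 : √(1 - p) * D s = √((1 - p) * D s * D s) := by
        rw [mul_assoc, Real.sqrt_mul (by linarith), Real.sqrt_mul_self hD.le]
      rw [h3]
      refine Real.sqrt_le_sqrt ?_
      have h4 : U s * Y ≤ (1 - p) * D s := by
        have h5 : U s ≤ 1 + Y := by rw [hYdef]; linarith
        have h6 : U s * Y ≤ (1 + Y) * Y := mul_le_mul_of_nonneg_right h5 hY.le
        have h7 : (1 - s) * D s ≤ (1 - p) * D s :=
          mul_le_mul_of_nonneg_right (by linarith [hs.1]) hD.le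
        linarith
      have := mul_le_mul_of_nonneg_right h4 hD.le
      linarith
    have h3 : B s ≤ √(1 - p) * D s / √Y := by
      rwa [le_div_iff₀ (Real.sqrt_pos.2 hY)]
    have h4 : 2 * √(1 - p) * (-D s / (2 * √Y)) = -(√(1 - p) * D s / √Y) := by
      have := Real.sqrt_pos.2 hY
      field_simp
    rw [h4]; linarith

/-- Inserting `S_le` gives R ≤ 2Y √((1-p) D), and (1-p) D = Y(1+Y) + ε R contains R again. Young's
inequality absorbs it: R ≤ 4YT + 4εY² with T = √(Y(1+Y)) ≥ Y, and ε ≤ 1/4 turns 4 + 1 into the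
constant 5. -/
theorem R_le_of_lt_one (hε : 0 ≤ ε) (hε1 : ε ≤ 1 / 4) (h : TransformData ε U D B S R) {p : ℝ}
    (hp : 0 < p) (hp1 : p < 1) :
    R p ≤ 5 * (U p - U 1) * √((U p - U 1) * (1 + (U p - U 1))) := by
  have hY : 0 < U p - U 1 := sub_pos.2 (h.strictAnti hp hp1)
  have hD := h.D_pos p hp
  have h1 := h.R_le_of_le_one p hp hp1.le
  have hS := h.S_le hε hp hp1
  have heq := h.equation p hp
  set Y := U p - U 1 with hYdef
  have e : U 1 - U p = -Y := by rw [hYdef]; ring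
  rw [e] at heq
  have heq' : (1 - p) * D p = Y * (1 + Y) + ε * R p := by linarith
  have hR0 := h.R_nonneg p
  set r := R p
  set T := √(Y * (1 + Y)) with hT
  have hYT : Y ≤ T := Real.le_sqrt_of_sq_le (by nlinarith)
  have h2 : r ≤ 2 * Y * √((1 - p) * D p) := by
    refine (h1.trans (mul_le_mul_of_nonneg_left hS (Real.sqrt_nonneg _))).trans_eq ?_
    rw [Real.sqrt_mul hY.le, Real.sqrt_mul (by linarith)]
    have := Real.mul_self_sqrt hY.le
    linear_combination (2 * √(D p) * √(1 - p)) * this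
  have h3 : √((1 - p) * D p) ≤ T + √(ε * r) := by
    rw [heq']
    have a1 : 0 ≤ ε * r := mul_nonneg hε hR0
    rw [Real.sqrt_le_left (by positivity)]
    nlinarith [Real.sq_sqrt a1, Real.sq_sqrt (by positivity : 0 ≤ Y * (1 + Y)),
      mul_nonneg (Real.sqrt_nonneg (Y * (1 + Y))) (Real.sqrt_nonneg (ε * r))]
  have h4 : 2 * Y * √(ε * r) ≤ r / 2 + 2 * ε * Y ^ 2 := by
    rcases hε.eq_or_lt with h0 | h0
    · rw [← h0]; simp; positivity
    rw [Real.sqrt_mul hε]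
    have a1 := Real.sq_sqrt hR0
    have a2 := Real.sq_sqrt hε
    nlinarith [sq_nonneg (√r - 2 * √ε * Y)]
  have h5 : r ≤ 2 * Y * T + (r / 2 + 2 * ε * Y ^ 2) := by nlinarith
  have h6 : 2 * ε * Y ^ 2 ≤ Y * T / 2 := by nlinarith [mul_le_mul_of_nonneg_left hYT hY.le, sq_nonneg Y]
  linarith

/-! ### The linearising quotient Z and its closeness to p. -/

/-- The function `(p - 1) / (U 1 - U p)`, extended continuously to `p = 1`. It equals `p` for the
constant kernel. -/
noncomputable def quotient (U : ℝ → ℝ) (p : ℝ) : ℝ := (dslope (fun q => U 1 - U q) 1 p)⁻¹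

theorem quotient_of_ne {p : ℝ} (hp : p ≠ 1) : quotient U p = (p - 1) / (U 1 - U p) := by
  rw [quotient, dslope_of_ne _ hp, slope_def_field]
  simp

theorem quotient_one (h : TransformData ε U D B S R) : quotient U 1 = (D 1)⁻¹ := by
  rw [quotient, dslope_same, ((h.hasDerivAt 1 one_pos).const_sub (U 1)).deriv, neg_neg]

theorem sub_ne_zero (h : TransformData ε U D B S R) {p : ℝ} (hp : 0 < p) (hp1 : p ≠ 1) :
    U 1 - U p ≠ 0 := by
  rcases lt_or_gt_of_ne hp1 with h1 | h1
  · have := h.strictAnti hp h1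
    intro h0; linarith
  · have := h.strictAnti one_pos h1
    intro h0; linarith

theorem quotient_pos (h : TransformData ε U D B S R) {p : ℝ} (hp : 0 < p) :
    0 < quotient U p := by
  rcases lt_trichotomy p 1 with h1 | h1 | h1
  · rw [quotient_of_ne h1.ne]
    have := h.strictAnti hp h1
    exact div_pos_of_neg_of_neg (by linarith) (by linarith)
  · rw [h1, h.quotient_one]; exact inv_pos.2 (h.D_pos 1 one_pos)
  · rw [quotient_of_ne h1.ne']
    have := h.strictAnti one_pos h1
    exact div_pos (by linarith) (by linarith)

/-- The numerator of the quotient rule is the left-hand side of the transformed equation, so the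
quadratic term becomes the constant 1. -/
theorem hasDerivAt_quotient (h : TransformData ε U D B S R) {p : ℝ} (hp : 0 < p) (hp1 : p ≠ 1) :
    HasDerivAt (quotient U) (1 + ε * R p / (U 1 - U p) ^ 2) p := by
  have h0 := h.sub_ne_zero hp hp1
  have h1 := ((hasDerivAt_id p).sub_const 1).div ((h.hasDerivAt p hp).const_sub (U 1)) h0
  have h2 : HasDerivAt (fun q => (q - 1) / (U 1 - U q)) (1 + ε * R p / (U 1 - U p) ^ 2) p := by
    refine h1.congr_deriv ?_
    have := h.equation p hp
    simp only [id]
    field_simp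
    linear_combination this
  refine h2.congr_of_eventuallyEq ?_
  filter_upwards [isOpen_ne.mem_nhds hp1] with q hq using quotient_of_ne hq

theorem continuousOn_quotient (h : TransformData ε U D B S R) :
    ContinuousOn (quotient U) (Ioi 0) := by
  intro p hp
  refine ContinuousAt.continuousWithinAt ?_
  by_cases hp1 : p = 1
  · subst hp1
    refine ContinuousAt.inv₀ ?_ ?_
    · exact continuousAt_dslope_same.2 ((h.hasDerivAt 1 one_pos).const_sub (U 1)).differentiableAt
    · have := h.quotient_pos one_pos
      rw [quotient] at this
      exact (inv_pos.1 this).ne'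
  · exact (h.hasDerivAt_quotient hp hp1).continuousAt

theorem quotient_sub_le_of_not_mem (hε : 0 ≤ ε) (h : TransformData ε U D B S R) {a b : ℝ}
    (ha : 0 < a) (hab : a ≤ b) (h1 : 1 ∉ Ioo a b) : quotient U a - a ≤ quotient U b - b := by
  refine le_of_hasDerivAt_nonneg (f := fun p => quotient U p - p)
    (f' := fun p => 1 + ε * R p / (U 1 - U p) ^ 2 - 1) hab ?_ ?_ ?_
  · exact (h.continuousOn_quotient.mono fun x hx => ha.trans_le hx.1).sub continuousOn_id
  · intro x hx
    exact (h.hasDerivAt_quotient (ha.trans hx.1) fun h0 => h1 (h0 ▸ hx)).sub (hasDerivAt_id x)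
  · intro x _
    have := mul_nonneg hε (h.R_nonneg x)
    have : 0 ≤ ε * R x / (U 1 - U x) ^ 2 := by positivity
    linarith

/-- The derivative formula fails to cover p = 1; the two sides are glued by continuity there. -/
theorem quotient_sub_mono (hε : 0 ≤ ε) (h : TransformData ε U D B S R) {a b : ℝ}
    (ha : 0 < a) (hab : a ≤ b) : quotient U a - a ≤ quotient U b - b := by
  by_cases h1 : (1 : ℝ) ∈ Ioo a b
  · exact (h.quotient_sub_le_of_not_mem hε ha h1.1.le (by simp)).trans
      (h.quotient_sub_le_of_not_mem hε one_pos h1.2.le (by simp))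
  · exact h.quotient_sub_le_of_not_mem hε ha hab h1

theorem quotient_mono (hε : 0 ≤ ε) (h : TransformData ε U D B S R) {a b : ℝ}
    (ha : 0 < a) (hab : a ≤ b) : quotient U a ≤ quotient U b := by
  linarith [h.quotient_sub_mono hε ha hab]

/-- Z - p is nondecreasing and Z > 0, so Z - p is bounded below by its behaviour at 0, where it
exceeds -a for every small a. -/
theorem le_quotient (hε : 0 ≤ ε) (h : TransformData ε U D B S R) {p : ℝ} (hp : 0 < p) :
    p ≤ quotient U p := by
  by_contra! hcon
  set a := min p ((p - quotient U p) / 2) with ha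
  have ha0 : 0 < a := lt_min hp (by linarith)
  have h1 := h.quotient_sub_mono hε ha0 (min_le_left _ _ : a ≤ p)
  have h2 := h.quotient_pos ha0
  have h3 : a ≤ (p - quotient U p) / 2 := min_le_right _ _
  linarith

theorem D_one_le (hε : 0 ≤ ε) (h : TransformData ε U D B S R) : D 1 ≤ 1 := by
  have h1 := h.le_quotient hε one_pos
  rw [h.quotient_one] at h1
  exact (one_le_inv₀ (h.D_pos 1 one_pos)).1 h1

/-- The quotient is at most 5 √((1+Y)/Y). Since Z Y = 1 - p, multiplying (1+Y)/Y by 1 - p gives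
(1-p) + Z ≤ (1+Z)². The remaining singularity (1-p)^{-1/2} is integrable. -/
theorem R_div_le_of_lt_one (hε : 0 ≤ ε) (hε1 : ε ≤ 1 / 4) (h : TransformData ε U D B S R) {p : ℝ}
    (hp : 0 < p) (hp1 : p < 1) : R p / (U 1 - U p) ^ 2 ≤ 5 * (1 + quotient U p) / √(1 - p) := by
  have hY : 0 < U p - U 1 := sub_pos.2 (h.strictAnti hp hp1)
  have h1 := h.R_le_of_lt_one hε hε1 hp hp1
  have hZ : quotient U p = (1 - p) / (U p - U 1) := by
    rw [quotient_of_ne hp1.ne, ← neg_sub, ← neg_sub (U p), neg_div_neg_eq]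
  have hZ0 := h.quotient_pos hp
  set Z := quotient U p
  set Y := U p - U 1 with hYdef
  have e : (U 1 - U p) ^ 2 = Y ^ 2 := by rw [hYdef]; ring
  have hp' : 0 < 1 - p := by linarith
  rw [e, div_le_div_iff₀ (by positivity) (Real.sqrt_pos.2 hp')]
  have hZY : Z * Y = 1 - p := by rw [hZ]; field_simp
  have h2 : √(Y * (1 + Y)) * √(1 - p) ≤ (1 + Z) * Y := by
    rw [← Real.sqrt_mul (by positivity), Real.sqrt_le_left (by positivity)]
    have h3 : (1 + Y) * (1 - p) ≤ (1 + Z) ^ 2 * Y := by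
      have : Y * (1 - p) ≤ Y := by nlinarith
      nlinarith [mul_pos hZ0 hY, mul_pos hZ0 (mul_pos hZ0 hY)]
    nlinarith
  calc R p * √(1 - p) ≤ 5 * Y * √(Y * (1 + Y)) * √(1 - p) := by gcongr
    _ = 5 * Y * (√(Y * (1 + Y)) * √(1 - p)) := by ring
    _ ≤ 5 * Y * ((1 + Z) * Y) := by gcongr
    _ = _ := by ring

/-- With U(1), D(1) ≤ 1 the bound on R reduces to Q √(p-1), Q = U(1) - U(p), and √(p-1)/Q =
Z/√(p-1). -/
theorem R_div_le_of_one_lt (hε : 0 ≤ ε) (h : TransformData ε U D B S R) {p : ℝ}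
    (hp1 : 1 < p) : R p / (U 1 - U p) ^ 2 ≤ 5 * (1 + quotient U p) / √(p - 1) := by
  have hp : 0 < p := by linarith
  have hQ : 0 < U 1 - U p := sub_pos.2 (h.strictAnti one_pos hp1)
  have h1 := h.R_le_of_one_le p hp1.le
  have hZ := quotient_of_ne (U := U) hp1.ne'
  have hZ0 := h.quotient_pos hp
  have hD1 := h.D_one_le hε
  have hD0 := h.D_pos 1 one_pos
  have hN1 := h.U_one_le hε
  have hN0 := h.U_nonneg 1 one_pos
  set Z := quotient U p
  set Q := U 1 - U p with hQdef
  have hp' : 0 < p - 1 := by linarith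
  have h2 : R p ≤ Q * √(p - 1) := by
    have a1 : √(Q * D 1) ≤ √Q := Real.sqrt_le_sqrt (by nlinarith)
    have a2 : √(Q * ((p - 1) * U 1)) ≤ √(Q * (p - 1)) := Real.sqrt_le_sqrt (by
      have : (p - 1) * U 1 ≤ p - 1 := by nlinarith
      exact mul_le_mul_of_nonneg_left this hQ.le)
    refine (h1.trans (mul_le_mul a1 a2 (Real.sqrt_nonneg _) (Real.sqrt_nonneg _))).trans_eq ?_
    rw [Real.sqrt_mul hQ.le, ← mul_assoc, Real.mul_self_sqrt hQ.le]
  have hZQ : Z * Q = p - 1 := by rw [hZ]; field_simp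
  rw [div_le_div_iff₀ (by positivity) (Real.sqrt_pos.2 hp')]
  have h3 : R p * √(p - 1) ≤ Q * (p - 1) := by
    refine (mul_le_mul_of_nonneg_right h2 (Real.sqrt_nonneg _)).trans_eq ?_
    rw [mul_assoc, Real.mul_self_sqrt hp'.le]
  have h4 : Q * (p - 1) = Z * Q ^ 2 := by rw [← hZQ]; ring
  nlinarith [mul_pos hZ0 (mul_pos hQ hQ), mul_pos hQ hQ]

/-- The blow-up of U at 0 enters here: it fixes the integration constant by forcing Z to be
arbitrarily small near 0. -/
theorem exists_quotient_lt (h : TransformData ε U D B S R) {P η : ℝ} (hP : 0 < P) (hη : 0 < η) :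
    ∃ a, 0 < a ∧ a < P ∧ quotient U a < η := by
  obtain ⟨a, ha, ha1, haU⟩ := h.unbounded (max (U P) (U 1 + 1 / η))
  refine ⟨a, ha, ?_, ?_⟩
  · by_contra! hcon
    exact absurd (h.anti hP hcon) (not_le.2 ((le_max_left _ _).trans_lt haU))
  · have h1 : 1 / η < U a - U 1 := by linarith [(le_max_right (U P) (U 1 + 1 / η)).trans_lt haU]
    have h2 : 0 < U a - U 1 := (by positivity : 0 < 1 / η).trans h1
    rw [quotient_of_ne ha1.ne, ← neg_sub, ← neg_sub (U a), neg_div_neg_eq, div_lt_iff₀ h2]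
    rw [div_lt_iff₀ hη] at h1
    linarith

/-- Z' is integrated from a point near 0, with Z replaced by its larger value at P. The integral of
(1-x)^{-1/2} over (0, P) is 2(1 - √(1-P)) ≤ 2P, which supplies the factor P. -/
theorem quotient_le_of_le_one (hε : 0 ≤ ε) (hε1 : ε ≤ 1 / 4) (h : TransformData ε U D B S R)
    {P : ℝ} (hP : 0 < P) (hP1 : P ≤ 1) :
    quotient U P - P ≤ 10 * ε * P * (1 + quotient U P) := by
  have hZ0 := h.quotient_pos hP
  refine le_of_forall_pos_le_add fun η hη => ?_
  obtain ⟨a, ha, haP, haZ⟩ := h.exists_quotient_lt hP hη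
  set c := 5 * ε * (1 + quotient U P) with hc
  have hc0 : 0 ≤ c := by positivity
  have key := le_of_hasDerivAt_nonneg
    (f := fun p => p - c * (2 * √(1 - p)) - quotient U p)
    (f' := fun p => 1 - c * (2 * (-1 / (2 * √(1 - p)))) - (1 + ε * R p / (U 1 - U p) ^ 2))
    haP.le ?_ ?_ ?_
  · have h1 : √(1 - a) ≤ 1 := Real.sqrt_le_one.2 (by linarith)
    have h2 : 1 - P ≤ √(1 - P) := Real.le_sqrt_of_sq_le (by nlinarith)
    have h3 := mul_le_mul_of_nonneg_left h1 hc0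
    have h4 := mul_le_mul_of_nonneg_left h2 hc0
    have h5 : c * (2 * P) = 10 * ε * P * (1 + quotient U P) := by rw [hc]; ring
    linarith
  · refine ContinuousOn.sub (by fun_prop) (h.continuousOn_quotient.mono ?_)
    exact fun x hx => ha.trans_le hx.1
  · intro x hx
    have hx1 : 0 < 1 - x := by linarith [hx.2]
    have d1 := (((hasDerivAt_id x).const_sub 1).sqrt hx1.ne').const_mul 2
    exact ((hasDerivAt_id x).sub (d1.const_mul c)).sub
      (h.hasDerivAt_quotient (ha.trans hx.1) (by linarith [hx.2]))
  · intro x hx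
    have hx0 : 0 < x := ha.trans hx.1
    have hx1 : 0 < 1 - x := by linarith [hx.2]
    have h1 := h.R_div_le_of_lt_one hε hε1 hx0 (by linarith)
    have h2 := h.quotient_mono hε hx0 hx.2.le
    have h3 : ε * R x / (U 1 - U x) ^ 2 ≤ c / √(1 - x) := by
      calc _ = ε * (R x / (U 1 - U x) ^ 2) := by ring
        _ ≤ ε * (5 * (1 + quotient U P) / √(1 - x)) := by
          refine mul_le_mul_of_nonneg_left (h1.trans ?_) hε
          gcongr
        _ = _ := by rw [hc]; ring
    have h4 : c * (2 * (-1 / (2 * √(1 - x)))) = -(c / √(1 - x)) := by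
      have := Real.sqrt_pos.2 hx1
      field_simp
    rw [h4]; linarith

theorem quotient_sub_le (hε : 0 ≤ ε) (hε1 : ε ≤ 1 / 4) (h : TransformData ε U D B S R)
    {P : ℝ} (hP : 0 < P) : quotient U P - P ≤ 20 * ε * P * (1 + quotient U P) := by
  have hZ0 := h.quotient_pos hP
  rcases le_total P 1 with hP1 | hP1
  · refine (h.quotient_le_of_le_one hε hε1 hP hP1).trans ?_
    have : 0 ≤ 10 * ε * P * (1 + quotient U P) := by positivity
    linarith
  have hone := h.quotient_le_of_le_one hε hε1 one_pos le_rfl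
  set c := 5 * ε * (1 + quotient U P) with hc
  have hc0 : 0 ≤ c := by positivity
  -- Beyond 1 the integral of (x-1)^{-1/2} is 2√(P-1) ≤ P; it is added to the bound already
  -- available at p = 1.
  have key := le_of_hasDerivAt_nonneg
    (f := fun p => p + c * (2 * √(p - 1)) - quotient U p)
    (f' := fun p => 1 + c * (2 * (1 / (2 * √(p - 1)))) - (1 + ε * R p / (U 1 - U p) ^ 2))
    hP1 ?_ ?_ ?_
  · simp only [sub_self, Real.sqrt_zero, mul_zero, add_zero] at key
    have h2 : √(P - 1) ≤ P / 2 := by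
      rw [Real.sqrt_le_left (by linarith)]; nlinarith [sq_nonneg (P - 2)]
    have h4 := mul_le_mul_of_nonneg_left h2 hc0
    have h5 : 10 * ε * 1 * (1 + quotient U 1) ≤ 10 * ε * P * (1 + quotient U P) := by
      have := h.quotient_mono hε one_pos hP1
      have := h.quotient_pos one_pos
      gcongr
    have h6 : c * P = 5 * ε * P * (1 + quotient U P) := by rw [hc]; ring
    have h7 : 0 ≤ 5 * ε * P * (1 + quotient U P) := by positivity
    linarith
  · refine ContinuousOn.sub (by fun_prop) (h.continuousOn_quotient.mono ?_)
    exact fun x hx => one_pos.trans_le hx.1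
  · intro x hx
    have hx1 : 0 < x - 1 := by linarith [hx.1]
    have d1 := (((hasDerivAt_id x).sub_const 1).sqrt hx1.ne').const_mul 2
    exact ((hasDerivAt_id x).add (d1.const_mul c)).sub
      (h.hasDerivAt_quotient (one_pos.trans hx.1) (by linarith [hx.1]))
  · intro x hx
    have hx0 : 0 < x := one_pos.trans hx.1
    have hx1 : 0 < x - 1 := by linarith [hx.1]
    have h1 := h.R_div_le_of_one_lt hε hx.1
    have h2 := h.quotient_mono hε hx0 hx.2.le
    have h3 : ε * R x / (U 1 - U x) ^ 2 ≤ c / √(x - 1) := by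
      calc _ = ε * (R x / (U 1 - U x) ^ 2) := by ring
        _ ≤ ε * (5 * (1 + quotient U P) / √(x - 1)) := by
          refine mul_le_mul_of_nonneg_left (h1.trans ?_) hε
          gcongr
        _ = _ := by rw [hc]; ring
    have h4 : c * (2 * (1 / (2 * √(x - 1)))) = c / √(x - 1) := by
      have := Real.sqrt_pos.2 hx1
      field_simp
    rw [h4]; linarith

end TransformData
end Smoluchowski

/-! ### Closeness of U to 1/p, uniformly on the half-line. -/

namespace Smoluchowski

namespace TransformData

variable {ε : ℝ} {U D B S R : ℝ → ℝ}

/-- R is nondecreasing on [1, ∞), so its values are bounded by letting the argument tend to infinity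
in the equation. -/
theorem mul_R_le (hε : 0 ≤ ε) (h : TransformData ε U D B S R) {p : ℝ} (hp : 1 ≤ p) :
    ε * R p ≤ U 1 - U 1 ^ 2 := by
  have h1 : Tendsto (fun q => U 1 - U q) atTop (𝓝 (U 1)) := by
    simpa using h.tendsto_U.const_sub (U 1)
  refine ge_of_tendsto (h1.sub (h1.pow 2)) ?_
  filter_upwards [eventually_ge_atTop p] with q hq
  have h2 := h.equation q (by linarith)
  have h3 := mul_le_mul_of_nonneg_left (h.R_mono p q hp hq) hε
  have h4 := mul_nonneg (by linarith : 0 ≤ q - 1) (h.D_pos q (by linarith)).le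
  linarith

/-- Combining the equation with `mul_R_le` gives (x-1) D ≥ U (2U(1) - 1 - U) ≥ U/2. Hence U decays
at least like (x-1)^{-1/2}, with no restriction on how large x is compared with ε. -/
theorem U_mul_sqrt_le (hε : 0 ≤ ε) (h : TransformData ε U D B S R) {P p : ℝ} (hP : 1 < P)
    (hp : P ≤ p) (hN : 1 / 2 ≤ 2 * U 1 - 1 - U P) : U p * √(p - 1) ≤ U P * √(P - 1) := by
  have key := le_of_hasDerivAt_nonneg (f := fun p => -(U p * √(p - 1)))
    (f' := fun p => -(-D p * √(p - 1) + U p * (1 / (2 * √(p - 1))))) hp ?_ ?_ ?_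
  · linarith
  · refine ((h.continuousOn.mono fun x hx => ?_).mul (by fun_prop)).neg
    have : P ≤ x := hx.1
    exact (by linarith : (0:ℝ) < x)
  · intro x hx
    have hx1 : 0 < x - 1 := by linarith [hx.1]
    exact ((h.hasDerivAt x (by linarith)).mul (((hasDerivAt_id x).sub_const 1).sqrt hx1.ne')).neg
  · intro x hx
    have hx1 : 0 < x - 1 := by linarith [hx.1]
    have h1 := h.equation x (by linarith)
    have h2 := h.mul_R_le hε (by linarith : 1 ≤ x)
    have h3 := h.anti (by linarith : 0 < P) hx.1.le
    have h4 := h.U_nonneg x (by linarith)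
    have h5 : U x ≤ 2 * ((x - 1) * D x) := by nlinarith
    have hs := Real.sqrt_pos.2 hx1
    have h6 : U x * (1 / (2 * √(x - 1))) ≤ D x * √(x - 1) := by
      rw [mul_one_div, div_le_iff₀ (by positivity)]
      have := Real.mul_self_sqrt hx1.le
      calc U x ≤ 2 * ((x - 1) * D x) := h5
        _ = 2 * ((√(x - 1) * √(x - 1)) * D x) := by rw [this]
        _ = _ := by ring
    linarith

/-- A bootstrap: the term ε p Z is first absorbed, giving Z ≤ 2p; then 1 + Z ≤ 3P makes (Z - p) P at
most 60 p ε P², below p by the choice of 1000. -/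
theorem quotient_le_of_small (hε : 0 ≤ ε) (h : TransformData ε U D B S R) {P p : ℝ}
    (hP : 100 ≤ P) (hεP : ε * (1000 * P ^ 2) ≤ 1) (hp : 0 < p) (hpP : p ≤ P) :
    quotient U p - p ≤ p / P := by
  have hε1 : ε ≤ 1 / 4 := by nlinarith
  have h1 := h.quotient_sub_le hε hε1 hp
  have hZ := h.quotient_pos hp
  have hεp : ε * P ≤ 1 / 1000 := by nlinarith [mul_nonneg hε (by linarith : 0 ≤ P)]
  set Z := quotient U p
  have h2 : 20 * ε * p * (1 + Z) ≤ 20 * (ε * P) * Z + 20 * ε * p := by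
    have : ε * p * Z ≤ ε * P * Z := by gcongr
    linarith
  have h3 : Z ≤ 2 * p := by nlinarith
  have h4 : 20 * ε * p * (1 + Z) ≤ 20 * ε * p * (3 * P) := by
    refine mul_le_mul_of_nonneg_left ?_ (by positivity)
    linarith
  rw [le_div_iff₀ (by linarith)]
  have h5 : (Z - p) * P ≤ 20 * ε * p * (3 * P) * P :=
    mul_le_mul_of_nonneg_right (h1.trans h4) (by linarith)
  have h6 : 20 * ε * p * (3 * P) * P = 60 * p * (ε * P ^ 2) := by ring
  nlinarith

/-- At p = P the quotient is at most P + 1, so U(1) ≥ U(1) - U(P) ≥ (P-1)/(P+1). -/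
theorem one_sub_le_U_one (hε : 0 ≤ ε) (h : TransformData ε U D B S R) {P : ℝ}
    (hP : 100 ≤ P) (hεP : ε * (1000 * P ^ 2) ≤ 1) : 1 - 2 / P ≤ U 1 := by
  have hP0 : 0 < P := by linarith
  have h1 := h.quotient_le_of_small hε hP hεP hP0 le_rfl
  have hZ := h.quotient_pos hP0
  rw [div_self hP0.ne'] at h1
  have h2 : quotient U P * (U 1 - U P) = P - 1 := by
    have := h.sub_ne_zero hP0 (by linarith)
    rw [quotient_of_ne (by linarith)]; field_simp
  have h3 := h.U_nonneg P hP0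
  have h4 : P - 1 ≤ (P + 1) * (U 1 - U P) := by
    have : 0 < U 1 - U P := sub_pos.2 (h.strictAnti one_pos (by linarith))
    nlinarith
  have h5 : 1 - 2 / P = (P - 2) / P := by field_simp
  rw [h5, div_le_iff₀ hP0]
  nlinarith

theorem abs_sub_le_of_le (hε : 0 ≤ ε) (h : TransformData ε U D B S R) {P p : ℝ}
    (hP : 100 ≤ P) (hεP : ε * (1000 * P ^ 2) ≤ 1) (hp : 0 < p) (hpP : p ≤ P) :
    |U p - 1 / p| ≤ 3 / P + 1 / (P * p) := by
  have hP0 : 0 < P := by linarith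
  have hN1 := h.U_one_le hε
  have hN2 := h.one_sub_le_U_one hε hP hεP
  have hN : |U 1 - 1| ≤ 2 / P := abs_le.2 ⟨by linarith, by
    have : 0 ≤ 2 / P := by positivity
    linarith⟩
  have h3P : 3 / P = 2 / P + 1 / P := by ring
  by_cases hp1 : p = 1
  · subst hp1
    have : 0 ≤ 1 / P := by positivity
    have : 0 ≤ 1 / (P * 1) := by positivity
    rw [div_one]; linarith
  have h1 := h.quotient_le_of_small hε hP hεP hp hpP
  have h2 := h.le_quotient hε hp
  have hZ := h.quotient_pos hp
  have h3 : quotient U p * (U 1 - U p) = p - 1 := by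
    have := h.sub_ne_zero hp hp1
    rw [quotient_of_ne hp1]; field_simp
  set Z := quotient U p
  -- Substitution of U = U(1) - (p-1)/Z; the first term is the error at p = 1, the second the error
  -- of Z.
  have h4 : U p - 1 / p = (U 1 - 1) + (p - 1) * ((Z - p) / (p * Z)) := by
    field_simp; linear_combination (-p) * h3
  have h5 : |(p - 1) * ((Z - p) / (p * Z))| ≤ 1 / P + 1 / (P * p) := by
    rw [abs_mul, abs_of_nonneg (div_nonneg (by linarith) (by positivity) : 0 ≤ (Z - p) / (p * Z))]
    have h6 : (Z - p) / (p * Z) ≤ 1 / (P * p) := by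
      rw [div_le_div_iff₀ (by positivity) (by positivity)]
      rw [le_div_iff₀ hP0] at h1
      nlinarith
    have h7 : |p - 1| ≤ p + 1 := abs_le.2 ⟨by linarith, by linarith⟩
    calc _ ≤ (p + 1) * (1 / (P * p)) := by
          refine mul_le_mul h7 h6 (div_nonneg (by linarith) (by positivity)) (by linarith)
      _ = _ := by field_simp
  rw [h4]
  refine (abs_add_le _ _).trans ?_
  linarith

/-- Smallness of `ε` forces the Laplace transform to be close to that of the constant `1`. -/
theorem abs_sub_le (hε : 0 ≤ ε) (h : TransformData ε U D B S R) {δ P : ℝ} (hδ : 0 < δ)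
    (hP : 100 ≤ P) (hPδ : 10 ≤ δ * √P) (hεP : ε * (1000 * P ^ 2) ≤ 1) {p : ℝ} (hp : 0 < p) :
    |U p - 1 / p| ≤ δ * (√(1 + p) / p) := by
  have hP0 : 0 < P := by linarith
  have hsP := Real.sqrt_pos.2 hP0
  have hsp := Real.sqrt_pos.2 hp
  have hPP := Real.mul_self_sqrt hP0.le
  have hpp := Real.mul_self_sqrt hp.le
  have hg1 : 1 / p ≤ √(1 + p) / p :=
    div_le_div_of_nonneg_right (Real.one_le_sqrt.2 (by linarith)) hp.le
  have hg2 : 1 / √p ≤ √(1 + p) / p := by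
    rw [← Real.sqrt_div_self']
    exact div_le_div_of_nonneg_right (Real.sqrt_le_sqrt (by linarith)) hp.le
  have hd : 10 / √P ≤ δ := by rwa [div_le_iff₀ hsP]
  set G := √(1 + p) / p
  have hG0 : 0 < G := (by positivity : 0 < 1 / p).trans_le hg1
  have hinvP : 1 / P = 1 / √P * (1 / √P) := by rw [one_div_mul_one_div, hPP]
  have hinv : 1 / P ≤ 1 / √P * (1 / 10) := by
    have : 10 ≤ √P := Real.le_sqrt_of_sq_le (by linarith)
    rw [hinvP]
    exact mul_le_mul_of_nonneg_left (one_div_le_one_div_of_le (by norm_num) this) (by positivity)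
  rcases le_total p P with hpP | hpP
  · refine (h.abs_sub_le_of_le hε hP hεP hp hpP).trans ?_
    have h1 : 3 / P ≤ 3 / √P * G := by
      have : 1 / √P ≤ G := (one_div_le_one_div_of_le hsp (Real.sqrt_le_sqrt hpP)).trans hg2
      calc 3 / P = 3 * (1 / P) := by ring
        _ = 3 / √P * (1 / √P) := by rw [hinvP]; ring
        _ ≤ _ := by gcongr
    have h2 : 1 / (P * p) ≤ 1 / √P * G := by
      rw [← one_div_mul_one_div]
      have a : 1 / P ≤ 1 / √P := by
        have : 0 < 1 / √P := by positivity
        linarith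
      exact mul_le_mul a hg1 (by positivity) (by positivity)
    have h3 : 4 / √P ≤ δ := le_trans (by gcongr; norm_num) hd
    calc _ ≤ 3 / √P * G + 1 / √P * G := add_le_add h1 h2
      _ = 4 / √P * G := by ring
      _ ≤ _ := by gcongr
  -- For p beyond P no closeness is needed: U and 1/p are each bounded by 10/√P times 1/√p, and 1/√p
  -- ≤ √(1+p)/p.
  · have hN := h.one_sub_le_U_one hε hP hεP
    have hUP : U P ≤ 5 / P := by
      have h1 := (abs_le.1 (h.abs_sub_le_of_le hε hP hεP hP0 le_rfl)).2
      have h2 : 1 / (P * P) ≤ 1 / P := one_div_le_one_div_of_le hP0 (by nlinarith)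
      have h3 : 5 / P = 3 / P + 1 / P + 1 / P := by ring
      linarith
    have hPs : 1 / P ≤ 1 / 100 := one_div_le_one_div_of_le (by norm_num) hP
    have h1 := h.U_mul_sqrt_le hε (by linarith : 1 < P) hpP (by
      have e1 : 2 / P = 2 * (1 / P) := by ring
      have e2 : 5 / P = 5 * (1 / P) := by ring
      linarith)
    have hU0 := h.U_nonneg p hp
    have h2 : √p / 2 ≤ √(p - 1) := by
      refine Real.le_sqrt_of_sq_le ?_
      rw [div_pow, Real.sq_sqrt hp.le]; linarith
    have h3 : U P * √(P - 1) ≤ 5 / √P := by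
      calc U P * √(P - 1) ≤ 5 / P * √P := by
            refine mul_le_mul hUP (Real.sqrt_le_sqrt (by linarith)) (Real.sqrt_nonneg _)
              (by positivity)
        _ = 5 / √P := by
            rw [eq_div_iff hsP.ne', mul_assoc, hPP]; field_simp
    have h4 : U p ≤ 10 / √P * (1 / √p) := by
      have h5 : U p * (√p / 2) ≤ 5 / √P :=
        ((mul_le_mul_of_nonneg_left h2 hU0).trans h1).trans h3
      rw [mul_one_div, le_div_iff₀ hsp]
      have : 10 / √P = 2 * (5 / √P) := by ring
      linarith
    have h5 : 1 / p ≤ 10 / √P * (1 / √p) := by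
      have hinvp : 1 / p = 1 / √p * (1 / √p) := by rw [one_div_mul_one_div, hpp]
      rw [hinvp]
      refine mul_le_mul_of_nonneg_right ?_ (by positivity)
      have a : 1 / √p ≤ 1 / √P := one_div_le_one_div_of_le hsP (Real.sqrt_le_sqrt hpP)
      have b : 1 / √P ≤ 10 / √P := by gcongr; norm_num
      linarith
    have h6 : 10 / √P * (1 / √p) ≤ δ * G := mul_le_mul hd hg2 (by positivity) hδ.le
    have h7 : 0 ≤ 1 / p := by positivity
    rw [abs_le]
    constructor <;> linarith

end TransformData

/-! ### Passing from convex functions to their derivatives. -/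

/-- V is convex because V' = -V₁ is nondecreasing; its tangent at p lies below the graph at p(1+τ)
and p(1-τ). -/
theorem slope_bounds {V V₁ : ℝ → ℝ} (hV : ∀ q, 0 < q → HasDerivAt V (-V₁ q) q)
    (hanti : ∀ a b, 0 < a → a ≤ b → V₁ b ≤ V₁ a) {p τ : ℝ} (hp : 0 < p) (hτ : 0 < τ)
    (hτ1 : τ < 1) : V p - V (p * (1 + τ)) ≤ p * τ * V₁ p ∧
      p * τ * V₁ p ≤ V (p * (1 - τ)) - V p := by
  have hc : ∀ a b, 0 < a → ContinuousOn V (Icc a b) := fun a b ha x hx =>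
    (hV x (ha.trans_le hx.1)).continuousAt.continuousWithinAt
  have ha : 0 < p * (1 - τ) := mul_pos hp (by linarith)
  constructor
  · have := le_of_hasDerivAt_nonneg (f := fun q => V q + V₁ p * q)
      (f' := fun q => -V₁ q + V₁ p * 1) (show p ≤ p * (1 + τ) by nlinarith)
      ((hc _ _ hp).add (by fun_prop))
      (fun x hx => (hV x (hp.trans hx.1)).add ((hasDerivAt_id x).const_mul _))
      (fun x hx => by linarith [hanti p x hp hx.1.le])
    linarith
  · have := le_of_hasDerivAt_nonneg (f := fun q => -(V q + V₁ p * q))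
      (f' := fun q => -(-V₁ q + V₁ p * 1)) (show p * (1 - τ) ≤ p by nlinarith)
      ((hc _ _ ha).add (by fun_prop)).neg
      (fun x hx => ((hV x (ha.trans hx.1)).add ((hasDerivAt_id x).const_mul _)).neg)
      (fun x hx => by linarith [hanti x p (ha.trans hx.1) hx.2.le])
    linarith

theorem sqrt_one_add_le {p q : ℝ} (hq : 0 < q) (hqp : q ≤ 3 * p) :
    √(1 + q) ≤ 2 * √(1 + p) := by
  rw [Real.sqrt_le_left (by positivity), mul_pow, Real.sq_sqrt (by linarith)]
  linarith

/-- Convex functions close to `1 / p` have derivatives close to `-1 / p²`. -/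
theorem abs_sq_mul_sub_one_le {V V₁ : ℝ → ℝ} (hV : ∀ q, 0 < q → HasDerivAt V (-V₁ q) q)
    (hanti : ∀ a b, 0 < a → a ≤ b → V₁ b ≤ V₁ a) {δ τ : ℝ} (hδ : 0 ≤ δ) (hτ : 0 < τ)
    (hτ1 : τ ≤ 1 / 4) (hclose : ∀ q, 0 < q → |q * V q - 1| ≤ δ * √(1 + q)) {p : ℝ} (hp : 0 < p) :
    |p ^ 2 * V₁ p - 1| ≤ (12 * τ + 16 * δ / τ) * √(1 + p) := by
  obtain ⟨h1, h2⟩ := slope_bounds hV hanti hp hτ (by linarith)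
  have hs1 : 1 ≤ √(1 + p) := Real.one_le_sqrt.2 (by linarith)
  have ha : 0 < 1 - τ := by linarith
  have hb : 0 < 1 + τ := by linarith
  have c0 := abs_le.1 (hclose p hp)
  have c1 := abs_le.1 (hclose (p * (1 - τ)) (by positivity))
  have c2 := abs_le.1 (hclose (p * (1 + τ)) (by positivity))
  have s1 := mul_le_mul_of_nonneg_left
    (sqrt_one_add_le (by positivity : 0 < p * (1 - τ)) (by nlinarith : _ ≤ 3 * p)) hδ
  have s2 := mul_le_mul_of_nonneg_left
    (sqrt_one_add_le (by positivity : 0 < p * (1 + τ)) (by nlinarith : _ ≤ 3 * p)) hδ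
  set s := √(1 + p)
  have hds : 0 ≤ δ * s := by positivity
  set A := p * V (p * (1 - τ)) with hA
  set C := p * V (p * (1 + τ)) with hC
  have e1 : p * (1 - τ) * V (p * (1 - τ)) = A * (1 - τ) := by rw [hA]; ring
  have e2 : p * (1 + τ) * V (p * (1 + τ)) = C * (1 + τ) := by rw [hC]; ring
  rw [e1] at c1
  rw [e2] at c2
  have i1 := mul_le_mul_of_nonneg_left h1 hp.le
  have i2 := mul_le_mul_of_nonneg_left h2 hp.le
  -- Second-order expansions of 1/(1±τ). In the difference quotient the quadratic error becomes O(τ)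
  -- and the closeness error becomes O(δ/τ).
  have hC1 : C ≤ 1 - τ + τ ^ 2 + 4 * (δ * s) := by
    have : C * (1 + τ) ≤ (1 - τ + τ ^ 2 + 4 * (δ * s)) * (1 + τ) := by nlinarith [pow_pos hτ 3]
    exact le_of_mul_le_mul_right this hb
  have hA2 : A ≤ 1 + τ + 2 * τ ^ 2 + 4 * (δ * s) := by
    have : A * (1 - τ) ≤ (1 + τ + 2 * τ ^ 2 + 4 * (δ * s)) * (1 - τ) := by
      nlinarith [pow_pos hτ 3, pow_pos hτ 2]
    exact le_of_mul_le_mul_right this ha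
  set T := p ^ 2 * V₁ p
  have e4 : p * (p * τ * V₁ p) = τ * T := by simp only [T]; ring
  have e5 : p * (V (p * (1 - τ)) - V p) = A - p * V p := by rw [hA]; ring
  have e6 : p * (V p - V (p * (1 + τ))) = p * V p - C := by rw [hC]; ring
  rw [e4, e6] at i1
  rw [e4, e5] at i2
  have ht2 := sq_nonneg τ
  have j1 : τ * T ≤ τ + 2 * τ ^ 2 + 5 * (δ * s) := by linarith
  have j2 : τ - τ ^ 2 - 5 * (δ * s) ≤ τ * T := by linarith
  have e3 : (12 * τ + 16 * δ / τ) * s = (12 * τ ^ 2 * s + 16 * (δ * s)) / τ := by field_simp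
  have hts : τ ^ 2 ≤ τ ^ 2 * s := le_mul_of_one_le_right (by positivity) hs1
  rw [e3, le_div_iff₀ hτ, ← abs_of_pos hτ, ← abs_mul, abs_of_pos hτ, abs_le]
  constructor <;> linarith

/-- Convex functions close to `1 / p²` have derivatives close to `-2 / p³`. -/
theorem abs_cube_mul_sub_two_le {V V₁ : ℝ → ℝ} (hV : ∀ q, 0 < q → HasDerivAt V (-V₁ q) q)
    (hanti : ∀ a b, 0 < a → a ≤ b → V₁ b ≤ V₁ a) {δ τ : ℝ} (hδ : 0 ≤ δ) (hτ : 0 < τ)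
    (hτ1 : τ ≤ 1 / 4) (hclose : ∀ q, 0 < q → |q ^ 2 * V q - 1| ≤ δ * √(1 + q)) {p : ℝ}
    (hp : 0 < p) : |p ^ 3 * V₁ p - 2| ≤ (12 * τ + 16 * δ / τ) * √(1 + p) := by
  obtain ⟨h1, h2⟩ := slope_bounds hV hanti hp hτ (by linarith)
  have hs1 : 1 ≤ √(1 + p) := Real.one_le_sqrt.2 (by linarith)
  have ha : 0 < 1 - τ := by linarith
  have hb : 0 < 1 + τ := by linarith
  have c0 := abs_le.1 (hclose p hp)
  have c1 := abs_le.1 (hclose (p * (1 - τ)) (by positivity))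
  have c2 := abs_le.1 (hclose (p * (1 + τ)) (by positivity))
  have s1 := mul_le_mul_of_nonneg_left
    (sqrt_one_add_le (by positivity : 0 < p * (1 - τ)) (by nlinarith : _ ≤ 3 * p)) hδ
  have s2 := mul_le_mul_of_nonneg_left
    (sqrt_one_add_le (by positivity : 0 < p * (1 + τ)) (by nlinarith : _ ≤ 3 * p)) hδ
  set s := √(1 + p)
  have hds : 0 ≤ δ * s := by positivity
  set A := p ^ 2 * V (p * (1 - τ)) with hA
  set C := p ^ 2 * V (p * (1 + τ)) with hC
  have e1 : (p * (1 - τ)) ^ 2 * V (p * (1 - τ)) = A * (1 - τ) ^ 2 := by rw [hA]; ring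
  have e2 : (p * (1 + τ)) ^ 2 * V (p * (1 + τ)) = C * (1 + τ) ^ 2 := by rw [hC]; ring
  rw [e1] at c1
  rw [e2] at c2
  have i1 := mul_le_mul_of_nonneg_left h1 (sq_nonneg p)
  have i2 := mul_le_mul_of_nonneg_left h2 (sq_nonneg p)
  have t2 : 0 < τ ^ 2 := by positivity
  have t3 : τ ^ 3 ≤ τ ^ 2 / 4 := by nlinarith
  have t3' : 0 < τ ^ 3 := by positivity
  have t4 : τ ^ 4 ≤ τ ^ 2 / 16 := by nlinarith
  have t4' : 0 < τ ^ 4 := by positivity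
  have hsq : 1 / 2 ≤ (1 - τ) ^ 2 := by nlinarith
  have hsq' : 1 / 2 ≤ (1 + τ) ^ 2 := by nlinarith
  -- Second-order expansions of (1±τ)^{-2}, valid because τ ≤ 1/4.
  have hC1 : C ≤ 1 - 2 * τ + 3 * τ ^ 2 + 4 * (δ * s) := by
    have : C * (1 + τ) ^ 2 ≤ (1 - 2 * τ + 3 * τ ^ 2 + 4 * (δ * s)) * (1 + τ) ^ 2 := by
      have a1 := mul_le_mul_of_nonneg_left hsq' hds
      have a2 : 1 ≤ (1 - 2 * τ + 3 * τ ^ 2) * (1 + τ) ^ 2 := by linarith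
      linarith
    exact le_of_mul_le_mul_right this (by positivity)
  have hA2 : A ≤ 1 + 2 * τ + 8 * τ ^ 2 + 4 * (δ * s) := by
    have : A * (1 - τ) ^ 2 ≤ (1 + 2 * τ + 8 * τ ^ 2 + 4 * (δ * s)) * (1 - τ) ^ 2 := by
      have a1 := mul_le_mul_of_nonneg_left hsq hds
      have a2 : 1 ≤ (1 + 2 * τ + 8 * τ ^ 2) * (1 - τ) ^ 2 := by linarith
      linarith
    exact le_of_mul_le_mul_right this (by positivity)
  set T := p ^ 3 * V₁ p
  have e4 : p ^ 2 * (p * τ * V₁ p) = τ * T := by simp only [T]; ring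
  have e5 : p ^ 2 * (V (p * (1 - τ)) - V p) = A - p ^ 2 * V p := by rw [hA]; ring
  have e6 : p ^ 2 * (V p - V (p * (1 + τ))) = p ^ 2 * V p - C := by rw [hC]; ring
  rw [e4, e6] at i1
  rw [e4, e5] at i2
  have j1 : τ * T ≤ 2 * τ + 8 * τ ^ 2 + 5 * (δ * s) := by linarith
  have j2 : 2 * τ - 3 * τ ^ 2 - 5 * (δ * s) ≤ τ * T := by linarith
  have e3 : (12 * τ + 16 * δ / τ) * s = (12 * τ ^ 2 * s + 16 * (δ * s)) / τ := by field_simp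
  have hts : τ ^ 2 ≤ τ ^ 2 * s := le_mul_of_one_le_right (by positivity) hs1
  rw [e3, le_div_iff₀ hτ, ← abs_of_pos hτ, ← abs_mul, abs_of_pos hτ, abs_le]
  constructor <;> linarith

end Smoluchowski

/-! ### Transfer to solutions and to the norm. -/

namespace Smoluchowski

variable {ε : ℝ} {W : ℝ → ℝ → ℝ} {u : ℝ → ℝ}

namespace IsRegularSolution

/-- The lower bound makes u positive on a half-line. Strictness keeps the denominator of the
quotient nonzero away from p = 1. -/
theorem laplaceMoment_pos (hu : IsRegularSolution ε W u) {p : ℝ} (hp : 0 < p) :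
    0 < laplaceMoment u p := by
  have h0 : ∀ x, 0 < x → 0 ≤ x * u x * Real.exp (-(p * x)) := fun x hx =>
    mul_nonneg (mul_nonneg hx.le (hu.nonneg x)) (Real.exp_pos _).le
  have h0' : 0 ≤ᵐ[volume.restrict (Ioi 0)] fun x => x * u x * Real.exp (-(p * x)) := by
    filter_upwards [ae_restrict_mem measurableSet_Ioi] with x hx using h0 x hx
  refine (laplace_nonneg (fun x hx => mul_nonneg hx.le (hu.nonneg x)) p).lt_of_ne fun heq => ?_
  have hz := (integral_eq_zero_iff_of_nonneg_ae h0' (hu.hasLaplace.id_mul p hp)).1 heq.symm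
  obtain ⟨X, hX, hlow⟩ := hu.lower 1 one_pos
  have h1 : ∀ᵐ x ∂(volume.restrict (Ioi X)), False := by
    filter_upwards [ae_restrict_mem measurableSet_Ioi, ae_restrict_of_ae hlow,
      ae_restrict_of_ae_restrict_of_subset (Ioi_subset_Ioi hX.le) hz] with x hx hx1 hx2
    have hx0 : 0 < x := hX.trans hx
    have h2 : 0 < u x := (Real.exp_pos _).trans_le (hx1 hx)
    have h3 : 0 < x * u x * Real.exp (-(p * x)) := by positivity
    exact h3.ne' hx2
  have h2 : volume.restrict (Ioi X) = 0 := by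
    rw [← ae_eq_bot]; exact Filter.eventually_false_iff_eq_bot.1 h1
  have h3 : volume (Ioi X) = 0 := Measure.restrict_eq_zero.1 h2
  simp at h3

/-- For p ≥ 1 the increment e^{-x} - e^{-px} is pointwise nondecreasing in p, and W is non-negative.
-/
theorem remainder_mono (hW : IsSqrtPerturbation W) (hu : IsRegularSolution ε W u) {p q : ℝ}
    (hp : 1 ≤ p) (hpq : p ≤ q) : remainder W u p ≤ remainder W u q := by
  refine div_le_div_of_nonneg_right (ENNReal.toReal_mono
    (hu.remainder_le hW (by linarith : 0 < q)).1 ?_) zero_le_two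
  have hmono : ∀ x, 0 < x → u x * |Real.exp (-(p * x)) - Real.exp (-x)| ≤
      u x * |Real.exp (-(q * x)) - Real.exp (-x)| := by
    intro x hx
    refine mul_le_mul_of_nonneg_left ?_ (hu.nonneg x)
    rw [abs_sub_comm, abs_sub_comm (Real.exp (-(q * x))),
      abs_of_nonneg (sub_nonneg.2 (Real.exp_le_exp.2 (by nlinarith))),
      abs_of_nonneg (sub_nonneg.2 (Real.exp_le_exp.2 (by nlinarith)))]
    have : Real.exp (-(q * x)) ≤ Real.exp (-(p * x)) := Real.exp_le_exp.2 (by nlinarith)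
    linarith
  refine setLIntegral_mono' measurableSet_Ioi fun y hy => ?_
  refine setLIntegral_mono' measurableSet_Ioi fun z hz => ?_
  refine ENNReal.ofReal_le_ofReal ?_
  have h1 := mul_le_mul (hmono y hy) (hmono z hz) (hu.increment_nonneg p z)
    (hu.increment_nonneg q y)
  have := mul_le_mul_of_nonneg_left h1 (hW.nonneg y z)
  linarith

theorem transformData (hε : 0 ≤ ε) (hW : IsSqrtPerturbation W) (hu : IsRegularSolution ε W u) :
    TransformData ε (laplace u) (laplaceMoment u) (laplace fun x => √x * u x) (smallPart u)
      (remainder W u) where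
  hasDerivAt _ hp := hu.hasLaplace.hasDerivAt hp
  D_pos _ hp := hu.laplaceMoment_pos hp
  U_nonneg p _ := laplace_nonneg (fun x _ => hu.nonneg x) p
  tendsto_U := hu.hasLaplace.tendsto_atTop
  unbounded A := hu.exists_lt_laplace hε hW A
  B_le _ hp := hu.laplace_sqrt_le hp
  hasDerivAt_S _ hp := hu.hasDerivAt_smallPart hp
  S_one := by simp [smallPart]
  R_nonneg p := remainder_nonneg W u p
  R_mono _ _ hp hpq := hu.remainder_mono hW hp hpq
  R_le_of_le_one _ hp hp1 := hu.remainder_le_of_lt_one hW hp hp1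
  R_le_of_one_le _ hp := hu.remainder_le_of_one_le hW hp
  equation _ hp := hu.laplace_equation hε hW hp

/-- Closeness of the Laplace transform and its first two derivatives to those of the constant
function `1`. -/
theorem exists_close {δ : ℝ} (hδ : 0 < δ) : ∃ ε₀ : ℝ, 0 < ε₀ ∧ ∀ ε : ℝ, 0 < ε → ε < ε₀ →
    ∀ (W : ℝ → ℝ → ℝ) (u : ℝ → ℝ), IsSqrtPerturbation W → IsRegularSolution ε W u →
    ∀ p, 0 < p → |p * laplace u p - 1| ≤ δ * √(1 + p) ∧
      |p ^ 2 * laplaceMoment u p - 1| ≤ δ * √(1 + p) ∧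
      |p ^ 3 * laplaceMoment (fun x => x * u x) p - 2| ≤ δ * √(1 + p) := by
  -- Each differentiation costs 12τ + 16 d'/τ; τ ≤ d/24 and d' ≤ dτ/32 make both terms at most d/2.
  -- Two uses, in backward order, lead from the target δ to the accuracy d₂ required of U itself.
  have htau : ∀ d : ℝ, 0 < d → ∃ d' τ : ℝ, 0 < d' ∧ 0 < τ ∧ τ ≤ 1 / 4 ∧ d' ≤ d ∧
      12 * τ + 16 * d' / τ ≤ d := by
    intro d hd
    refine ⟨min d (d * min (1 / 4) (d / 24) / 32), min (1 / 4) (d / 24), by positivity,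
      by positivity, min_le_left _ _, min_le_left _ _, ?_⟩
    set τ := min (1 / 4) (d / 24)
    have hτ : 0 < τ := by positivity
    have h1 : 16 * min d (d * τ / 32) / τ ≤ d / 2 := by
      rw [div_le_iff₀ hτ]
      linarith [min_le_right d (d * τ / 32)]
    have h2 : τ ≤ d / 24 := min_le_right _ _
    linarith
  obtain ⟨d₁, τ₁, hd₁, hτ₁, hτ₁', hdd₁, hτd₁⟩ := htau δ hδ
  obtain ⟨d₂, τ₂, hd₂, hτ₂, hτ₂', hdd₂, hτd₂⟩ := htau d₁ hd₁
  set P : ℝ := 100 + (10 / d₂) ^ 2 with hP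
  have hP0 : 0 < P := by positivity
  have hP100 : 100 ≤ P := by rw [hP]; linarith [sq_nonneg (10 / d₂)]
  have hPd : 10 ≤ d₂ * √P := by
    have : 10 / d₂ ≤ √P := Real.le_sqrt_of_sq_le (by rw [hP]; linarith)
    rwa [div_le_iff₀ hd₂, mul_comm] at this
  refine ⟨1 / (1000 * P ^ 2), by positivity, fun ε hε hε1 W u hW hu => ?_⟩
  have hεP : ε * (1000 * P ^ 2) ≤ 1 := by
    rw [lt_div_iff₀ (by positivity)] at hε1; exact hε1.le
  have hT := hu.transformData hε.le hW
  have h0 : ∀ p, 0 < p → |p * laplace u p - 1| ≤ d₂ * √(1 + p) := by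
    intro p hp
    have h1 := hT.abs_sub_le hε.le hd₂ hP100 hPd hεP hp
    have h2 : p * laplace u p - 1 = p * (laplace u p - 1 / p) := by field_simp
    rw [h2, abs_mul, abs_of_pos hp]
    refine (mul_le_mul_of_nonneg_left h1 hp.le).trans_eq ?_
    field_simp
  have h1 : ∀ p, 0 < p → |p ^ 2 * laplaceMoment u p - 1| ≤ d₁ * √(1 + p) := by
    intro p hp
    refine (abs_sq_mul_sub_one_le (fun q hq => hu.hasLaplace.hasDerivAt hq) (fun a b ha hab =>
      hu.hasLaplace.id_mul.laplace_anti (fun x hx => mul_nonneg hx.le (hu.nonneg x)) ha hab)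
      hd₂.le hτ₂ hτ₂' h0 hp).trans ?_
    exact mul_le_mul_of_nonneg_right hτd₂ (Real.sqrt_nonneg _)
  intro p hp
  refine ⟨(h0 p hp).trans (mul_le_mul_of_nonneg_right (hdd₂.trans hdd₁) (Real.sqrt_nonneg _)),
    (h1 p hp).trans (mul_le_mul_of_nonneg_right hdd₁ (Real.sqrt_nonneg _)), ?_⟩
  refine (abs_cube_mul_sub_two_le (fun q hq => hu.hasLaplace.id_mul.hasDerivAt hq)
    (fun a b ha hab => hu.hasLaplace.id_mul.id_mul.laplace_anti
      (fun x hx => mul_nonneg hx.le (mul_nonneg hx.le (hu.nonneg x))) ha hab)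
      hd₁.le hτ₁ hτ₁' h1 hp).trans ?_
  exact mul_le_mul_of_nonneg_right hτd₁ (Real.sqrt_nonneg _)

end IsRegularSolution

/-- Errors growing like √(1+p) are admissible because θ < 1/2 makes √(1+p) ≤ (1+p)^{1-θ}; the factor
3 counts the seminorms. -/
theorem fnorm_two_le {θ c : ℝ} (hθ : θ < 1 / 2) (hc : 0 ≤ c) {ω L L₁ L₂ : ℝ → ℝ}
    (hL : ∀ p, 0 < p → laplace ω p = L p) (hL₁ : ∀ p, 0 < p → HasDerivAt L (L₁ p) p)
    (hL₂ : ∀ p, 0 < p → HasDerivAt L₁ (L₂ p) p)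
    (h0 : ∀ p, 0 < p → |p * L p| ≤ c * √(1 + p))
    (h1 : ∀ p, 0 < p → |p ^ 2 * L₁ p| ≤ c * √(1 + p))
    (h2 : ∀ p, 0 < p → |p ^ 3 * L₂ p| ≤ c * √(1 + p)) :
    fnorm 2 θ ω ≤ ENNReal.ofReal (3 * c) := by
  have d1 : EqOn (deriv (laplace ω)) L₁ (Ioi 0) := by
    intro p hp
    have : laplace ω =ᶠ[𝓝 p] L := by
      filter_upwards [Ioi_mem_nhds hp] with q hq using hL q hq
    rw [this.deriv_eq, (hL₁ p hp).deriv]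
  have d2 : EqOn (deriv (deriv (laplace ω))) L₂ (Ioi 0) := by
    intro p hp
    have : deriv (laplace ω) =ᶠ[𝓝 p] L₁ := by
      filter_upwards [Ioi_mem_nhds hp] with q hq using d1 hq
    rw [this.deriv_eq, (hL₂ p hp).deriv]
  have key : ∀ (k : ℕ) (a : ℝ → ℝ), (∀ p, 0 < p → iteratedDeriv k (laplace ω) p = a p) →
      (∀ p, 0 < p → |p ^ (1 + k) * a p| ≤ c * √(1 + p)) → snorm k θ ω ≤ ENNReal.ofReal c := by
    intro k a ha hb
    refine iSup₂_le fun p hp => ENNReal.ofReal_le_ofReal ?_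
    have h3 := hb p hp
    rw [abs_mul, abs_of_pos (pow_pos hp _)] at h3
    have h4 : √(1 + p) ≤ (1 + p) ^ (1 - θ) := by
      rw [Real.sqrt_eq_rpow]
      exact Real.rpow_le_rpow_of_exponent_le (by linarith) (by linarith)
    have h5 : 0 < (1 + p) ^ (1 - θ) := Real.rpow_pos_of_pos (by linarith) _
    rw [ha p hp, div_mul_eq_mul_div, div_le_iff₀ h5]
    exact h3.trans (mul_le_mul_of_nonneg_left h4 hc)
  have k0 := key 0 L (fun p hp => by rw [iteratedDeriv_zero, hL p hp]) (by simpa using h0)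
  have k1 := key 1 L₁ (fun p hp => by rw [iteratedDeriv_one, d1 hp]) (by simpa using h1)
  have k2 := key 2 L₂ (fun p hp => by
    rw [iteratedDeriv_succ, iteratedDeriv_one, d2 hp]) (by simpa using h2)
  rw [fnorm, Finset.sum_range_succ, Finset.sum_range_succ, Finset.sum_range_one,
    show 3 * c = c + c + c by ring, ENNReal.ofReal_add (by positivity) hc,
    ENNReal.ofReal_add hc hc]
  exact add_le_add (add_le_add k0 k1) k2

theorem laplace_congr {ω ω' : ℝ → ℝ} (h : ω =ᵐ[volume.restrict (Ioi 0)] ω') :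
    laplace ω = laplace ω' := by
  ext p
  refine integral_congr_ae ?_
  filter_upwards [h] with x hx
  rw [hx]

theorem HasLaplace.congr {ω ω' : ℝ → ℝ} (h : HasLaplace ω)
    (he : ω =ᵐ[volume.restrict (Ioi 0)] ω') : HasLaplace ω' := by
  intro p hp
  refine (h p hp).congr ?_
  filter_upwards [he] with x hx
  rw [hx]

theorem hasLaplace_one : HasLaplace fun _ => 1 := by
  intro p hp
  simp only [one_mul]
  simpa only [neg_mul] using integrableOn_exp_mul_Ioi (neg_lt_zero.2 hp) 0

theorem laplace_one {p : ℝ} (hp : 0 < p) : laplace (fun _ => 1) p = 1 / p := by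
  rw [laplace]
  simp only [one_mul]
  have := integral_exp_mul_Ioi (neg_lt_zero.2 hp) 0
  simp only [neg_mul] at this
  rw [this]; simp

theorem HasLaplace.sub_one {ω : ℝ → ℝ} (h : HasLaplace ω) : HasLaplace fun x => ω x - 1 := by
  intro p hp
  have := (h p hp).sub (hasLaplace_one p hp)
  refine this.congr (Eventually.of_forall fun x => ?_)
  simp only [Pi.sub_apply]; ring

theorem HasLaplace.laplace_sub_one {ω : ℝ → ℝ} (h : HasLaplace ω) {p : ℝ} (hp : 0 < p) :
    laplace (fun x => ω x - 1) p = laplace ω p - 1 / p := by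
  rw [← laplace_one hp, laplace, laplace, laplace, ← integral_sub (h p hp) (hasLaplace_one p hp)]
  refine integral_congr_ae (Eventually.of_forall fun x => ?_)
  simp only; ring

/-- The norm bounds for solutions in the regular class. -/
theorem IsRegularSolution.fnorm_le {θ δ : ℝ} (hθ : θ < 1 / 2) (hδ : 0 ≤ δ)
    (hu : IsRegularSolution ε W u)
    (h : ∀ p, 0 < p → |p * laplace u p - 1| ≤ δ * √(1 + p) ∧
      |p ^ 2 * laplaceMoment u p - 1| ≤ δ * √(1 + p) ∧
      |p ^ 3 * laplaceMoment (fun x => x * u x) p - 2| ≤ δ * √(1 + p)) :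
    fnorm 2 θ u ≤ ENNReal.ofReal (3 * (2 + δ)) ∧
      fnorm 2 θ (fun x => u x - 1) ≤ ENNReal.ofReal (3 * δ) := by
  have e1 : ∀ p : ℝ, 0 < p → HasDerivAt (laplace u) (-laplaceMoment u p) p :=
    fun p hp => hu.hasLaplace.hasDerivAt hp
  have e2 : ∀ p : ℝ, 0 < p →
      HasDerivAt (fun p => -laplaceMoment u p) (laplaceMoment (fun x => x * u x) p) p :=
    fun p hp => (hu.hasLaplace.id_mul.hasDerivAt hp).neg.congr_deriv (neg_neg _)
  have hs : ∀ p : ℝ, 0 < p → 1 ≤ √(1 + p) := fun p hp => Real.one_le_sqrt.2 (by linarith)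
  constructor
  -- The limiting values are 1, 1 and 2, all at most 2√(1+p); hence the constant 2 + δ.
  · refine fnorm_two_le hθ (by linarith) (fun p _ => rfl) e1 e2 ?_ ?_ ?_
    · intro p hp
      have h1 := abs_le.1 (h p hp).1
      have h2 := hs p hp
      rw [abs_le]; constructor <;> linarith
    · intro p hp
      have h1 := abs_le.1 (h p hp).2.1
      have h2 := hs p hp
      rw [abs_le]; constructor <;> linarith
    · intro p hp
      have h1 := abs_le.1 (h p hp).2.2
      have h2 := hs p hp
      rw [abs_le]; constructor <;> linarith
  · refine fnorm_two_le hθ hδ (L := fun p => laplace u p - p⁻¹)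
      (L₁ := fun p => -laplaceMoment u p - -(p ^ 2)⁻¹)
      (L₂ := fun p => laplaceMoment (fun x => x * u x) p - 2 * (p ^ 3)⁻¹)
      (fun p hp => by rw [hu.hasLaplace.laplace_sub_one hp, one_div])
      (fun p hp => (e1 p hp).sub (hasDerivAt_inv hp.ne')) (fun p hp => ?_) ?_ ?_ ?_
    · have h3 : HasDerivAt (fun p : ℝ => -(p ^ 2)⁻¹) (2 * (p ^ 3)⁻¹) p := by
        have := ((hasDerivAt_pow 2 p).inv (pow_ne_zero 2 hp.ne')).neg
        refine this.congr_deriv ?_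
        have := hp.ne'
        field_simp
        simp; ring
      exact (e2 p hp).sub h3
    · intro p hp
      have h1 : p * (laplace u p - p⁻¹) = p * laplace u p - 1 := by field_simp
      rw [h1]; exact (h p hp).1
    · intro p hp
      have h1 : p ^ 2 * (-laplaceMoment u p - -(p ^ 2)⁻¹) =
          -(p ^ 2 * laplaceMoment u p - 1) := by field_simp; ring
      rw [h1, abs_neg]; exact (h p hp).2.1
    · intro p hp
      have h1 : p ^ 3 * (laplaceMoment (fun x => x * u x) p - 2 * (p ^ 3)⁻¹) =
          p ^ 3 * laplaceMoment (fun x => x * u x) p - 2 := by field_simp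
      rw [h1]; exact (h p hp).2.2

end Smoluchowski

/-! ### Reduction of admissible perturbations and rescaled solutions to the regular setting. -/

namespace Smoluchowski

variable {ε : ℝ} {W : ℝ → ℝ → ℝ} {u : ℝ → ℝ}

/-- The left side is 2 cosh(α log(x/y)), which increases with |α|. -/
theorem rpow_add_rpow_le {α x y : ℝ} (hα : 0 ≤ α) (hα' : α ≤ 1 / 2) (hx : 0 < x) (hy : 0 < y) :
    (x / y) ^ α + (y / x) ^ α ≤ √x * (√y)⁻¹ + (√x)⁻¹ * √y := by
  have key : ∀ β : ℝ, (x / y) ^ β + (y / x) ^ β = 2 * Real.cosh (β * Real.log (x / y)) := by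
    intro β
    rw [Real.cosh_eq, Real.rpow_def_of_pos (by positivity), Real.rpow_def_of_pos (by positivity),
      ← inv_div x y, Real.log_inv]
    ring_nf
  have h1 : √x * (√y)⁻¹ + (√x)⁻¹ * √y = (x / y) ^ (1 / 2 : ℝ) + (y / x) ^ (1 / 2 : ℝ) := by
    rw [← Real.sqrt_eq_rpow, ← Real.sqrt_eq_rpow, Real.sqrt_div hx.le, Real.sqrt_div hy.le]
    ring
  rw [h1, key, key]
  refine mul_le_mul_of_nonneg_left (Real.cosh_le_cosh.2 ?_) zero_le_two
  rw [abs_mul, abs_mul, abs_of_nonneg hα, abs_of_nonneg (by norm_num : (0:ℝ) ≤ 1 / 2)]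
  exact mul_le_mul_of_nonneg_right hα' (abs_nonneg _)

open Classical in
/-- The restriction of `W` to the open quadrant, extended by zero. -/
noncomputable def quadrantRestriction (W : ℝ → ℝ → ℝ) (x y : ℝ) : ℝ :=
  if 0 < x ∧ 0 < y then W x y else 0

theorem quadrantRestriction_of_pos {x y : ℝ} (hx : 0 < x) (hy : 0 < y) :
    quadrantRestriction W x y = W x y := if_pos ⟨hx, hy⟩

/-- Measurability comes from the analytic extension: by homogeneity W(x, y) = Re F(x/y), and F is
continuous on the positive axis. -/
theorem IsAdmissiblePerturbation.isSqrtPerturbation {α : ℝ} (hα : 0 ≤ α) (hα' : α ≤ 1 / 2)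
    (hW : IsAdmissiblePerturbation α W) : IsSqrtPerturbation (quadrantRestriction W) where
  measurable := by
    obtain ⟨F, -, -, -, -, -, hF, hFW, -⟩ := hW.analytic
    have hc : ContinuousOn (fun t : ℝ => (F t).re) (Ioi 0) := by
      refine Complex.continuous_re.comp_continuousOn (hF.continuousOn.comp
        Complex.continuous_ofReal.continuousOn fun t ht => ?_)
      exact Complex.ofReal_mem_slitPlane.2 ht
    have hm : Measurable ((Ioi (0 : ℝ)).indicator fun t : ℝ => (F t).re) := by
      classical
      rw [← piecewise_eq_indicator]
      exact hc.measurable_piecewise continuousOn_const measurableSet_Ioi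
    have hS : MeasurableSet {t : ℝ × ℝ | 0 < t.1 ∧ 0 < t.2} :=
      (measurableSet_lt measurable_const measurable_fst).inter
        (measurableSet_lt measurable_const measurable_snd)
    have heq : Function.uncurry (quadrantRestriction W) =
        {t : ℝ × ℝ | 0 < t.1 ∧ 0 < t.2}.indicator
          fun t => (Ioi (0 : ℝ)).indicator (fun t : ℝ => (F t).re) (t.1 / t.2) := by
      ext ⟨x, y⟩
      by_cases h : 0 < x ∧ 0 < y
      · have hxy : 0 < x / y := div_pos h.1 h.2
        rw [indicator_of_mem (by exact h), indicator_of_mem (by exact hxy)]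
        simp only [Function.uncurry_apply_pair]
        rw [quadrantRestriction_of_pos h.1 h.2, hFW _ hxy, Complex.ofReal_re,
          ← hW.homogeneous y⁻¹ x y (inv_pos.2 h.2) h.1 h.2, inv_mul_cancel₀ h.2.ne',
          inv_mul_eq_div]
      · rw [indicator_of_notMem (by exact h)]
        exact if_neg h
    rw [heq]
    exact (hm.comp (measurable_fst.div measurable_snd)).indicator hS
  symm x y := by
    unfold quadrantRestriction
    by_cases h : 0 < x ∧ 0 < y
    · rw [if_pos h, if_pos h.symm, hW.symm x y h.1 h.2]
    · rw [if_neg h, if_neg fun h' => h h'.symm]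
  nonneg x y := by
    unfold quadrantRestriction
    split_ifs with h
    · exact hW.nonneg x y h.1 h.2
    · exact le_rfl
  le x y hx hy := by
    rw [quadrantRestriction_of_pos hx hy]
    exact (hW.le x y hx hy).trans (rpow_add_rpow_le hα hα' hx hy)

namespace IsRescaledSolution

variable {K : ℝ → ℝ → ℝ} {μ : ℝ → ℝ}

theorem aestronglyMeasurable (h : IsRescaledSolution K μ) :
    AEStronglyMeasurable μ (volume.restrict (Ioi 0)) :=
  h.locallyIntegrable.aestronglyMeasurable.mono_measure
    (Measure.restrict_mono Ioi_subset_Ici_self le_rfl)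

/-- The normalisation gives two-sided subexponential bounds. -/
theorem exp_bounds (h : IsRescaledSolution K μ) {η : ℝ} (hη : 0 < η) :
    ∃ X : ℝ, 0 < X ∧ ∀ᵐ x : ℝ, X < x → Real.exp (-(η * x)) ≤ μ x ∧ μ x ≤ Real.exp (η * x) := by
  set η' := min η (1 / 2)
  have hη' : 0 < η' := by positivity
  have hnhds : Ioo (-1 - η') (-1 + η') ∈ 𝓝 (-1 : ℝ) :=
    Ioo_mem_nhds (by linarith) (by linarith)
  obtain ⟨s, hs, t, ht, hst⟩ := mem_inf_iff.1 (h.normalized hnhds)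
  obtain ⟨X, hX⟩ := mem_atTop_sets.1 hs
  have hnn := (ae_restrict_iff' measurableSet_Ioi).1 h.nonneg
  refine ⟨max X 1, by positivity, ?_⟩
  filter_upwards [ht, hnn] with x hxt hx0 hxX
  have hx1 : 1 < x := (le_max_right _ _).trans_lt hxX
  have hxp : 0 < x := by linarith
  have hmem : x ∈ s ∩ t := ⟨hX x ((le_max_left _ _).trans hxX.le), hxt⟩
  rw [← hst] at hmem
  obtain ⟨h1, h2⟩ : -1 - η' < Real.log (Real.exp (-x) * μ x) / x ∧
    Real.log (Real.exp (-x) * μ x) / x < -1 + η' := hmem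
  rw [lt_div_iff₀ hxp] at h1
  rw [div_lt_iff₀ hxp] at h2
  have hμ0 : 0 ≤ μ x := hx0 hxp
  have hle : η' ≤ η := min_le_left _ _
  have hle2 : η' ≤ 1 / 2 := min_le_right _ _
  -- Since `Real.log 0 = 0`, a zero of μ would make the ratio 0, which the bound η' ≤ 1/2 excludes
  -- from the neighbourhood of -1.
  have hμ : 0 < μ x := by
    refine hμ0.lt_of_ne fun h0 => ?_
    rw [← h0] at h2
    simp only [mul_zero, Real.log_zero] at h2
    nlinarith
  rw [Real.log_mul (Real.exp_pos _).ne' hμ.ne', Real.log_exp] at h1 h2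
  constructor
  · rw [← Real.exp_log hμ]
    exact Real.exp_le_exp.2 (by nlinarith)
  · rw [← Real.exp_log hμ]
    exact Real.exp_le_exp.2 (by nlinarith)

/-- Local integrability handles a bounded interval at 0, and the upper bound μ ≤ e^{px/2} handles
the tail. -/
theorem hasLaplace (h : IsRescaledSolution K μ) : HasLaplace μ := by
  intro p hp
  obtain ⟨X, hX, hbd⟩ := h.exp_bounds (half_pos hp)
  have hnn := h.nonneg
  have hm := h.aestronglyMeasurable
  rw [← Ioc_union_Ioi_eq_Ioi hX.le]
  refine IntegrableOn.union ?_ ?_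
  · have h1 : IntegrableOn μ (Ioc 0 X) :=
      (h.locallyIntegrable.integrableOn_compact_subset Icc_subset_Ici_self
        isCompact_Icc).mono_set Ioc_subset_Icc_self
    refine h1.norm.mono' (h1.aestronglyMeasurable.mul (by fun_prop)) ?_
    filter_upwards [ae_restrict_mem measurableSet_Ioc] with x hx
    have hx0 : 0 < x := hx.1
    rw [norm_mul, Real.norm_of_nonneg (Real.exp_pos _).le]
    refine mul_le_of_le_one_right (norm_nonneg _) (Real.exp_le_one_iff.2 ?_)
    have := mul_pos hp hx0
    linarith
  · have h1 : IntegrableOn (fun x => Real.exp (-(p / 2) * x)) (Ioi X) :=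
      integrableOn_exp_mul_Ioi (by linarith) X
    refine h1.mono' ((hm.mono_measure (Measure.restrict_mono (Ioi_subset_Ioi hX.le) le_rfl)).mul
      (by fun_prop)) ?_
    filter_upwards [ae_restrict_mem measurableSet_Ioi, ae_restrict_of_ae hbd,
      ae_restrict_of_ae_restrict_of_subset (Ioi_subset_Ioi hX.le) hnn] with x hx hx1 hx2
    have hx2' : 0 ≤ μ x := hx2
    rw [Real.norm_of_nonneg (mul_nonneg hx2' (Real.exp_pos _).le)]
    refine (mul_le_mul_of_nonneg_right (hx1 hx).2 (Real.exp_pos _).le).trans_eq ?_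
    rw [← Real.exp_add]; congr 1; ring

/-- Every rescaled solution has a measurable non-negative representative. -/
theorem exists_isRegularSolution (h : IsRescaledSolution (kernel ε W) μ) :
    ∃ u, IsRegularSolution ε (quadrantRestriction W) u ∧ μ =ᵐ[volume.restrict (Ioi 0)] u := by
  have hm := h.aestronglyMeasurable
  set u : ℝ → ℝ := fun x => max (hm.mk μ x) 0 with hu
  have hae : μ =ᵐ[volume.restrict (Ioi 0)] u := by
    filter_upwards [hm.ae_eq_mk, h.nonneg] with x hx hx0
    have hx0' : 0 ≤ μ x := hx0
    simp only [hu]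
    rw [← hx, max_eq_left hx0']
  have hae' := (ae_restrict_iff' measurableSet_Ioi).1 hae
  refine ⟨u, ⟨?_, fun x => le_max_right _ _, h.hasLaplace.congr hae, ?_, ?_⟩, hae⟩
  · exact hm.stronglyMeasurable_mk.measurable.max measurable_const
  · filter_upwards [h.equation, hae, ae_restrict_mem measurableSet_Ioi] with x hx hxu hx0
    rw [← hxu, hx]
    refine setLIntegral_congr_fun_ae measurableSet_Ioo ?_
    filter_upwards [hae'] with y hy hyx
    refine setLIntegral_congr_fun_ae measurableSet_Ioi ?_
    filter_upwards [hae'] with z hz hzx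
    have hzx : x - y < z := hzx
    have hz0 : 0 < z := by linarith [hyx.2]
    rw [hy hyx.1, hz hz0, kernel, kernel, quadrantRestriction_of_pos hyx.1 hz0]
  · intro η hη
    obtain ⟨X, hX, hbd⟩ := h.exp_bounds hη
    refine ⟨X, hX, ?_⟩
    filter_upwards [hbd, hae'] with x hx hxu hxX
    rw [← hxu (hX.trans hxX)]
    exact (hx hxX).1

end IsRescaledSolution

theorem fnorm_congr {k : ℕ} {θ : ℝ} {ω ω' : ℝ → ℝ} (h : ω =ᵐ[volume.restrict (Ioi 0)] ω') :
    fnorm k θ ω = fnorm k θ ω' := by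
  simp only [fnorm, snorm, laplace_congr h]

/-- Norm bounds for rescaled solutions with small `ε`. -/
theorem exists_fnorm_le {α θ : ℝ} (hα : 0 ≤ α) (hα' : α ≤ 1 / 2) (hθ : θ < 1 / 2)
    (hW : IsAdmissiblePerturbation α W) {δ : ℝ} (hδ : 0 < δ) :
    ∃ ε₀ : ℝ, 0 < ε₀ ∧ ∀ ε : ℝ, 0 < ε → ε < ε₀ → ∀ μ : ℝ → ℝ,
      IsRescaledSolution (kernel ε W) μ →
        fnorm 2 θ μ ≤ ENNReal.ofReal (3 * (2 + δ)) ∧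
        fnorm 2 θ (fun x => μ x - 1) ≤ ENNReal.ofReal (3 * δ) := by
  obtain ⟨ε₀, hε₀, H⟩ := IsRegularSolution.exists_close hδ
  refine ⟨ε₀, hε₀, fun ε hε hε1 μ hμ => ?_⟩
  obtain ⟨u, hu, hae⟩ := hμ.exists_isRegularSolution
  have hsub : (fun x => μ x - 1) =ᵐ[volume.restrict (Ioi 0)] fun x => u x - 1 := by
    filter_upwards [hae] with x hx
    rw [hx]
  rw [fnorm_congr hae, fnorm_congr hsub]
  exact hu.fnorm_le hθ hδ.le (H ε hε hε1 _ u (hW.isSqrtPerturbation hα hα') hu)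

end Smoluchowski

theorem proposition3p2 (α θ : ℝ) (hα : 0 ≤ α) (hαθ : α < θ) (hθ : θ < 1 / 2)
    (W : ℝ → ℝ → ℝ) (hW : Smoluchowski.IsAdmissiblePerturbation α W) :
    (∃ C : ℝ, 0 < C ∧ ∃ ε₀ : ℝ, 0 < ε₀ ∧ ∀ ε : ℝ, 0 < ε → ε < ε₀ → ∀ μ : ℝ → ℝ,
      Smoluchowski.IsRescaledSolution (Smoluchowski.kernel ε W) μ →
        Smoluchowski.HasLaplace μ ∧ Smoluchowski.fnorm 2 θ μ < ENNReal.ofReal C) ∧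
    (∀ δ : ℝ, 0 < δ → ∃ ε₀ : ℝ, 0 < ε₀ ∧ ∀ ε : ℝ, 0 < ε → ε < ε₀ → ∀ μ : ℝ → ℝ,
      Smoluchowski.IsRescaledSolution (Smoluchowski.kernel ε W) μ →
        Smoluchowski.HasLaplace (fun x => μ x - 1) ∧
          Smoluchowski.fnorm 2 θ (fun x => μ x - 1) ≤ ENNReal.ofReal δ) := by
  have hα' : α ≤ 1 / 2 := by linarith
  constructor
  · obtain ⟨ε₀, hε₀, H⟩ := Smoluchowski.exists_fnorm_le hα hα' hθ hW one_pos
    -- Closeness with δ = 1 bounds the norm by 3(2 + 1) = 9; the value 10 makes the inequality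
    -- strict.
    refine ⟨10, by norm_num, ε₀, hε₀, fun ε hε hε1 μ hμ => ⟨hμ.hasLaplace, ?_⟩⟩
    refine (H ε hε hε1 μ hμ).1.trans_lt ?_
    exact (ENNReal.ofReal_lt_ofReal_iff (by norm_num)).2 (by norm_num)
  · intro δ hδ
    obtain ⟨ε₀, hε₀, H⟩ := Smoluchowski.exists_fnorm_le hα hα' hθ hW
      (show 0 < δ / 3 by positivity)
    refine ⟨ε₀, hε₀, fun ε hε hε1 μ hμ => ⟨hμ.hasLaplace.sub_one, ?_⟩⟩
    have := (H ε hε hε1 μ hμ).2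
    rwa [mul_div_cancel₀ δ (by norm_num : (3:ℝ) ≠ 0)] at this
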